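/- \textbf{Setting.} Let $V,\zeta,\phi:\mathbb R^d\to\mathbb R$ be smooth, $\sigma>0$, $f=-\nabla V$, $g=\nabla\zeta$, $G=|g|^2$. Suppose that $\mathcal M=\{\zeta=0\}$ is compact and that $g\ne0$ on $\mathcal M$. Let $d\mu_\infty=Z^{-1}e^{-2V/\sigma^2}d\sigma_{\mathcal M}$ be the normalised Gibbs measure, where $\sigma_{\mathcal M}$ is the canonical surface measure of $\mathcal M$. \textbf{Forests.} An exotic aromatic forest $\gamma\in\mathcal{EAT}$ is a finite graph, up to isomorphism, with a root $r$ and other nodes which are black (for $f$) or white (for $g$). Every node $v\neq r$ has exactly one outgoing edge: either an oriented standard edge $v\to w$ (then $v$ is a predecessor of $w$), or a non-oriented scalar-product edge joining $v$ to a node $w\ne v$, $w\neq r$, which is then the outgoing edge of both; $r$ has no outgoing edge. There are also finitely many lianas, that is, unordered pairs of possibly equal nodes, with repetitions allowed. An exotic aromatic vector field $\tau\in\mathcal{EAV}$ is the same, except that its root is itself a black or a white node; an aroma graph is the same without a root. $N_f,N_g,N_l,N_S$ count black nodes, white nodes (for $\tau$ including the root), lianas and scalar-product edges. Put $S(v)=w$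 if a scalar-product edge joins $v$ and $w$, and $S(v)=v$ otherwise. With $N=V\smallsetminus\{r\}$ and $h^v=f$ or $g$ according to the colour of $v$, $$F(\gamma)(\phi)=\sigma^{2N_l+N_g-2N_S}\,G^{-N_g/2}\sum_{i:N\to\{1..d\}}\ \sum_{j:L\to\{1..d\}}\Big(\prod_{v\in N}\delta_{i_v,i_{S(v)}}\,\partial_{I_v}h^v_{i_v}\Big)\,\partial_{I_r}\phi,$$ where $L$ is the set of lianas and the multi-index $I_u$ has an entry $i_w$ for every predecessor $w$ of $u$ and an entry $j_l$ for each end of the liana $l$ at $u$ (two entries if both ends are at $u$). $F$ is extended linearly to $\mathrm{Span}(\mathcal{EAT})$. \textbf{Operations.} $\circ$, $\bullet$ denote the one-node vector fields $g$, $f$. $\gamma\triangleleft_w\tau$: link the root of $\tau$ to the node $w$ of $\gamma$ by a standard edge (likewise for a vector field in place of $\gamma$); $\gamma\triangleleft\tau=\sum_w\gamma\triangleleft_w\tau$, the sum being over all nodes $w$ of $\gamma$, root included. $(\circ,\tau)$, $(\bullet,\tau)$: the aroma obtained by linking the root of $\tau$ to a new white, resp. black, node by a scalar-product edge. $\mathrm{Div}\,\tau$: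 the sum, over all nodes $w$ of $\tau$, of the aromas obtained by linking the root of $\tau$ to $w$ by a standard edge. $\ell_v\gamma$: the sum over all nodes $w$ of $\gamma$ ($w=v$ included) of the forests obtained by adding a liana between $v$ and $w$. $\circ\triangleleft\circ$ is the vector field $g'g$. Juxtaposition is disjoint union. \textbf{Statement.} For all $\gamma\in\mathcal{EAT}$ and $\tau\in\mathcal{EAV}$ (edge rule), $$\int_{\mathcal M}F\big(\gamma\triangleleft\tau-(\circ,\tau)\,(\gamma\triangleleft\circ)\big)(\phi)\,d\mu_\infty=\int_{\mathcal M}F\big((\circ,\tau\triangleleft\circ)\,\gamma-(N_g(\gamma)+N_g(\tau)+1)\,(\circ,\circ\triangleleft\circ)\,(\circ,\tau)\,\gamma-\mathrm{Div}(\tau)\,\gamma$$ $$\qquad+(N_g(\gamma)+N_g(\tau))\,(\circ,\circ\triangleleft\tau)\,\gamma+\mathrm{Div}(\circ)\,(\circ,\tau)\,\gamma+2\,(\circ,\bullet)\,(\circ,\tau)\,\gamma-2\,(\bullet,\tau)\,\gamma\big)(\phi)\,d\mu_\infty,$$ and for every node $v$ of $\gamma$ (liana rule; on the left, one first grafts $\circ$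 to every node of $\gamma$ and then grafts a second $\circ$ to $v$), $$\int_{\mathcal M}F\Big(\ell_v\gamma-\sum_{w}(\gamma\triangleleft_w\circ)\triangleleft_v\circ\Big)(\phi)\,d\mu_\infty=\int_{\mathcal M}F\big(-(N_g(\gamma)+1)\,(\circ,\circ\triangleleft\circ)\,(\gamma\triangleleft_v\circ)+N_g(\gamma)\,\gamma\triangleleft_v(\circ\triangleleft\circ)$$ $$\qquad+\mathrm{Div}(\circ)\,(\gamma\triangleleft_v\circ)+2\,(\circ,\bullet)\,(\gamma\triangleleft_v\circ)-2\,\gamma\triangleleft_v\bullet\big)(\phi)\,d\mu_\infty,$$ all integrands being $\mu_\infty$-integrable. \textbf{Euclidean case.} If $N_g(\gamma)=N_g(\tau)=0$, then deleting all forests which contain a white node turns the two sides of the edge rule into $\gamma\triangleleft\tau$ and $-\mathrm{Div}(\tau)\,\gamma-2(\bullet,\tau)\,\gamma$, and those of the liana rule into $\ell_v\gamma$ and $-2\,\gamma\triangleleft_v\bullet$. These reduced rules hold on $\mathbb R^d$: if $V$, $\phi$ and all their derivatives have polynomial growth and $|x|^pe^{-2V/\sigma^2}$ is integrable for every $p\in\mathbb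 N$, then for all such $\gamma$, $\tau$, $v$, the two sides of each reduced rule have integrable elementary differentials with the same integral against $Z^{-1}e^{-2V/\sigma^2}dx$. -/

import Mathlib

open MeasureTheory
open scoped ContDiff

noncomputable section

namespace ExoticAromatic

/-! ### Exotic aromatic graphs -/

/-- The two kinds of ordinary nodes: black nodes stand for the drift `f`, white nodes stand for the
normal field `g`. -/
inductive Colour where
  | black
  | white

/-- A finite exotic aromatic graph with ordinary nodes `N`, distinguished nodes `R` (which have no
outgoing edge) and lianas `L`. Every ordinary node `v` has exactly one outgoing edge `out v`:
`out v = Sum.inl u` is an oriented standard edge from `v` to the node `u`, and `out v = Sum.inr w` is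
a non-oriented scalar-product edge (drawn as a double line) joining `v` and `w`, which is the outgoing
edge of both `v` and `w`. A liana is an unordered pair of nodes, possibly equal; several lianas may
join the same nodes. -/
structure Graph (R : Type) where
  N : Type
  L : Type
  [fintypeN : Fintype N]
  [fintypeL : Fintype L]
  colour : N → Colour
  out : N → (N ⊕ R) ⊕ N
  liana : L → Sym2 (N ⊕ R)
  scal_symm : ∀ v w, out v = Sum.inr w → v ≠ w ∧ out w = Sum.inr v

attribute [instance] Graph.fintypeN Graph.fintypeL

namespace Graph

variable {R : Type}

/-- All the nodes of a graph. -/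
abbrev Node (γ : Graph R) : Type := γ.N ⊕ R

/-- `S v` is the node joined to `v` by a scalar-product edge, and `v` itself if there is none. -/
def S (γ : Graph R) (v : γ.N) : γ.N :=
  Sum.elim (fun _ => v) id (γ.out v)

open Classical in
/-- Number of black (`f`) nodes among the ordinary nodes. -/
def Nf (γ : Graph R) : ℕ := (Finset.univ.filter fun v : γ.N => γ.colour v = Colour.black).card

open Classical in
/-- Number of white (`g`) nodes among the ordinary nodes. -/
def Ng (γ : Graph R) : ℕ := (Finset.univ.filter fun v : γ.N => γ.colour v = Colour.white).card

/-- Number of lianas. -/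
def Nl (γ : Graph R) : ℕ := Fintype.card γ.L

open Classical in
/-- Number of scalar-product edges; each of them joins two distinct nodes, and is the outgoing edge of
both. -/
def cardES (γ : Graph R) : ℝ :=
  ((Finset.univ.filter fun v : γ.N => ∃ w, γ.out v = Sum.inr w).card : ℝ) / 2

/-- The order `|γ| = N_f + N_l + N_g / 2 - |E_S|`. -/
def order (γ : Graph R) : ℝ := (γ.Nf : ℝ) + (γ.Nl : ℝ) + (γ.Ng : ℝ) / 2 - γ.cardES

/-- Equivalence of graphs: a bijection of the nodes, fixing the distinguished ones, which respects
the colours, both kinds of edges, and the lianas with their multiplicities. -/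
structure Iso (γ γ' : Graph R) where
  nodes : γ.N ≃ γ'.N
  lianas : γ.L ≃ γ'.L
  colour_eq : ∀ v, γ'.colour (nodes v) = γ.colour v
  out_eq : ∀ v, γ'.out (nodes v) = Sum.map (Sum.map nodes id) nodes (γ.out v)
  liana_eq : ∀ l, γ'.liana (lianas l) = Sym2.map (Sum.map nodes id) (γ.liana l)

end Graph

/-- Concrete representatives of exotic aromatic forests: one distinguished node, the root `r`, which
stands for the test function `φ`. -/
abbrev Forest := Graph Unit

/-- Concrete representatives of products of aromas: no distinguished node. -/
abbrev Aroma := Graph Empty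

/-- Concrete representatives of exotic aromatic vector fields: the root, which has no outgoing edge,
is itself a black or a white node. -/
structure VField where
  graph : Graph Unit
  rootColour : Colour

open Classical in
/-- Number of white nodes of an exotic aromatic vector field, the root included. -/
def VField.Ng (τ : VField) : ℕ := τ.graph.Ng + if τ.rootColour = Colour.white then 1 else 0

/-- The vector field reduced to a single node. -/
def dot (c : Colour) : VField where
  graph :=
    { N := Empty
      L := Empty
      colour := Empty.elim
      out := fun v => v.elim
      liana := Empty.elim
      scal_symm := fun v => v.elim }
  rootColour := c

/-! ### Operations on graphs -/

namespace Graph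

variable {R : Type}

/-- Link the root of `τ` to the node `w` of `γ` with a new standard edge. -/
def graft (γ : Graph R) (τ : VField) (w : γ.Node) : Graph R where
  N := γ.N ⊕ (τ.graph.N ⊕ Unit)
  L := γ.L ⊕ τ.graph.L
  colour := Sum.elim γ.colour (Sum.elim τ.graph.colour fun _ => τ.rootColour)
  out := Sum.elim
    (fun v => Sum.map (Sum.map Sum.inl id) Sum.inl (γ.out v))
    (Sum.elim
      (fun v => Sum.map (fun u => Sum.inl (Sum.inr u)) (fun u => Sum.inr (Sum.inl u))
        (τ.graph.out v))
      (fun _ => Sum.inl (Sum.map Sum.inl id w)))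
  liana := Sum.elim
    (fun l => Sym2.map (Sum.map Sum.inl id) (γ.liana l))
    (fun l => Sym2.map (fun u => Sum.inl (Sum.inr u)) (τ.graph.liana l))
  scal_symm := by
    rintro (v | v | v) (w | w | w) h
    · rcases h' : γ.out v with a | a <;> simp_all
      obtain rfl := h
      obtain ⟨h1, h2⟩ := γ.scal_symm _ _ h'
      exact ⟨h1, by simp [h2]⟩
    · rcases h' : γ.out v with a | a <;> simp_all
    · rcases h' : γ.out v with a | a <;> simp_all
    · rcases h' : τ.graph.out v with a | a <;> simp_all
    · rcases h' : τ.graph.out v with a | a <;> simp_all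
      obtain rfl := h
      obtain ⟨h1, h2⟩ := τ.graph.scal_symm _ _ h'
      exact ⟨h1, by simp [h2]⟩
    · rcases h' : τ.graph.out v with a | a <;> simp_all
    all_goals simp at h

/-- A node of `γ`, seen as a node of `γ.graft τ w`. -/
def graftNode (γ : Graph R) (τ : VField) (w : γ.Node) (v : γ.Node) : (γ.graft τ w).Node :=
  Sum.map Sum.inl id v

/-- Link the nodes `v` and `w` of `γ` with a new liana. -/
def addLiana (γ : Graph R) (v w : γ.Node) : Graph R where
  N := γ.N
  L := γ.L ⊕ Unit
  colour := γ.colour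
  out := γ.out
  liana := Sum.elim γ.liana (fun _ => s(v, w))
  scal_symm := γ.scal_symm

end Graph

namespace VField

/-- Link the root of `κ` to the node `w` of the vector field `τ` with a new standard edge. -/
def graft (τ κ : VField) (w : τ.graph.Node) : VField := ⟨τ.graph.graft κ w, τ.rootColour⟩

/-- Aroma obtained by linking the root of `τ` to a new node of colour `c` with a new scalar-product
edge. -/
def scal (τ : VField) (c : Colour) : Aroma where
  N := (τ.graph.N ⊕ Unit) ⊕ Unit
  L := τ.graph.L
  colour := Sum.elim (Sum.elim τ.graph.colour fun _ => τ.rootColour) fun _ => c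
  out := Sum.elim
    (Sum.elim
      (fun v => Sum.map (fun u => Sum.inl (Sum.inl u)) (fun u => Sum.inl (Sum.inl u))
        (τ.graph.out v))
      (fun _ => Sum.inr (Sum.inr ())))
    (fun _ => Sum.inr (Sum.inl (Sum.inr ())))
  liana := fun l => Sym2.map (fun u => Sum.inl (Sum.inl u)) (τ.graph.liana l)
  scal_symm := by
    rintro ((v | v) | v) ((w | w) | w) h
    · rcases h' : τ.graph.out v with a | a <;> simp_all
      obtain rfl := h
      obtain ⟨h1, h2⟩ := τ.graph.scal_symm _ _ h'
      exact ⟨h1, by simp [h2]⟩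
    · rcases h' : τ.graph.out v with a | a <;> simp_all
    · rcases h' : τ.graph.out v with a | a <;> simp_all
    all_goals simp_all

/-- Aroma obtained by linking the root of `τ` to the node `w` of `τ` with a new standard edge. -/
def loop (τ : VField) (w : τ.graph.Node) : Aroma where
  N := τ.graph.N ⊕ Unit
  L := τ.graph.L
  colour := Sum.elim τ.graph.colour fun _ => τ.rootColour
  out := Sum.elim
    (fun v => Sum.map Sum.inl Sum.inl (τ.graph.out v))
    (fun _ => Sum.inl (Sum.inl w))
  liana := fun l => Sym2.map Sum.inl (τ.graph.liana l)
  scal_symm := by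
    rintro (v | v) (w' | w') h
    · rcases h' : τ.graph.out v with a | a <;> simp_all
      obtain rfl := h
      obtain ⟨h1, h2⟩ := τ.graph.scal_symm _ _ h'
      exact ⟨h1, by simp [h2]⟩
    · rcases h' : τ.graph.out v with a | a <;> simp_all
    all_goals simp at h

end VField

/-- Juxtaposition (disjoint union) of a product of aromas and a graph. -/
def Aroma.mul {R : Type} (a : Aroma) (γ : Graph R) : Graph R where
  N := a.N ⊕ γ.N
  L := a.L ⊕ γ.L
  colour := Sum.elim a.colour γ.colour
  out := Sum.elim
    (fun v => Sum.map (Sum.map Sum.inl Empty.elim) Sum.inl (a.out v))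
    (fun v => Sum.map (Sum.map Sum.inr id) Sum.inr (γ.out v))
  liana := Sum.elim
    (fun l => Sym2.map (Sum.map Sum.inl Empty.elim) (a.liana l))
    (fun l => Sym2.map (Sum.map Sum.inr id) (γ.liana l))
  scal_symm := by
    rintro (v | v) (w | w) h
    · rcases h' : a.out v with b | b <;> simp_all
      obtain rfl := h
      obtain ⟨h1, h2⟩ := a.scal_symm _ _ h'
      exact ⟨h1, by simp [h2]⟩
    · rcases h' : a.out v with b | b <;> simp_all
    · rcases h' : γ.out v with b | b <;> simp_all
    · rcases h' : γ.out v with b | b <;> simp_all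
      obtain rfl := h
      obtain ⟨h1, h2⟩ := γ.scal_symm _ _ h'
      exact ⟨h1, by simp [h2]⟩

infixr:70 " ⊙ " => Aroma.mul

/-! ### Elementary differentials -/

/-- The Euclidean space `ℝ^d`. -/
abbrev E (d : ℕ) := EuclideanSpace ℝ (Fin d)

/-- Partial derivative `∂_k h`. -/
def partialD {d : ℕ} (k : Fin d) (h : E d → ℝ) : E d → ℝ :=
  fun x => fderiv ℝ h x (EuclideanSpace.single k 1)

/-- Iterated partial derivative `∂_I h` for a multiset `I` of indices, taken in a fixed order (the
order is irrelevant for a smooth function). -/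
def iterD {d : ℕ} (I : Multiset (Fin d)) (h : E d → ℝ) : E d → ℝ :=
  (I.sort (· ≤ ·)).foldr partialD h

/-- The vector field represented by a node. -/
def fieldOf {d : ℕ} (f g : E d → E d) : Colour → E d → E d
  | Colour.black => f
  | Colour.white => g

namespace Graph

variable {R : Type}

open Classical in
/-- The indices of the derivatives at the node `u`: one index `i v` for each predecessor `v` of `u`
(through standard edges), and one index `j l` for each end of the liana `l` which is `u`, so that a
liana with both ends at `u` contributes twice. -/
def indices {d : ℕ} (γ : Graph R) (i : γ.N → Fin d) (j : γ.L → Fin d) (u : γ.Node) :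
    Multiset (Fin d) :=
  (∑ v : γ.N, if γ.out v = Sum.inl u then {i v} else 0)
    + ∑ l : γ.L, (γ.liana l).toMultiset.count u • {j l}

end Graph

open Classical in
/-- The elementary differential `F(γ)(f, g, φ)`, at the point `x`, of a forest, with `G = |g|²`. -/
def Forest.F {d : ℕ} (σ : ℝ) (f g : E d → E d) (φ : E d → ℝ) (x : E d) (γ : Forest) : ℝ :=
  σ ^ (2 * (γ.order - γ.Nf)) * (‖g x‖ ^ 2) ^ (-(γ.Ng : ℝ) / 2) *
    ∑ i : γ.N → Fin d, ∑ j : γ.L → Fin d,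
      (∏ v : γ.N, (if i v = i (γ.S v) then (1 : ℝ) else 0) *
        iterD (γ.indices i j (Sum.inl v)) (fun y => fieldOf f g (γ.colour v) y (i v)) x) *
      iterD (γ.indices i j (Sum.inr ())) φ x

/-! ### Invariance under equivalence of graphs -/

namespace Graph

variable {R : Type} {γ γ' : Graph R}

/-- The identity equivalence. -/
def Iso.refl (γ : Graph R) : Iso γ γ where
  nodes := Equiv.refl _
  lianas := Equiv.refl _
  colour_eq := fun _ => rfl
  out_eq := fun v => by simp
  liana_eq := fun l => by simp

/-- The inverse equivalence. -/
def Iso.symm (e : Iso γ γ') : Iso γ' γ where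
  nodes := e.nodes.symm
  lianas := e.lianas.symm
  colour_eq := fun v => by
    have := e.colour_eq (e.nodes.symm v); simp_all
  out_eq := fun v => by
    have := e.out_eq (e.nodes.symm v)
    simp only [Equiv.apply_symm_apply] at this
    rw [this]; simp [Sum.map_map, ← Equiv.coe_trans]
  liana_eq := fun l => by
    have := e.liana_eq (e.lianas.symm l)
    simp only [Equiv.apply_symm_apply] at this
    rw [this]; simp [Sym2.map_map]

/-- The composite equivalence. -/
def Iso.trans {γ'' : Graph R} (e : Iso γ γ') (e' : Iso γ' γ'') : Iso γ γ'' where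
  nodes := e.nodes.trans e'.nodes
  lianas := e.lianas.trans e'.lianas
  colour_eq := fun v => by simp [e'.colour_eq, e.colour_eq]
  out_eq := fun v => by simp [e'.out_eq, e.out_eq, Sum.map_map, Sum.map_comp_map]
  liana_eq := fun l => by
    simp [e'.liana_eq, e.liana_eq, Sym2.map_map]

theorem Iso.Nf_eq (e : Iso γ γ') : γ.Nf = γ'.Nf := by
  classical
  unfold Nf
  refine Finset.card_equiv e.nodes fun v => ?_
  simp [e.colour_eq]

theorem Iso.Ng_eq (e : Iso γ γ') : γ.Ng = γ'.Ng := by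
  classical
  unfold Ng
  refine Finset.card_equiv e.nodes fun v => ?_
  simp [e.colour_eq]

theorem Iso.cardES_eq (e : Iso γ γ') : γ.cardES = γ'.cardES := by
  classical
  unfold cardES
  congr 2
  refine Finset.card_equiv e.nodes fun v => ?_
  rcases h : γ.out v with a | a <;> simp [e.out_eq, h]

theorem Iso.order_eq (e : Iso γ γ') : γ.order = γ'.order := by
  simp only [order, e.Nf_eq, e.Ng_eq, e.cardES_eq, Nl, Fintype.card_congr e.lianas]

theorem Iso.S_eq (e : Iso γ γ') (v : γ.N) : γ'.S (e.nodes v) = e.nodes (γ.S v) := by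
  unfold S
  rw [e.out_eq]
  rcases γ.out v with a | a <;> simp

theorem Iso.indices_eq {d : ℕ} (e : Iso γ γ') (i : γ'.N → Fin d) (j : γ'.L → Fin d) (u : γ.Node) :
    γ'.indices i j (Sum.map e.nodes id u) = γ.indices (i ∘ e.nodes) (j ∘ e.lianas) u := by
  classical
  have hinj : Function.Injective (Sum.map e.nodes (id : R → R)) :=
    Sum.map_injective.2 ⟨e.nodes.injective, Function.injective_id⟩
  have hmul : ∀ z : Sym2 γ.Node, (Sym2.map (Sum.map e.nodes (id : R → R)) z).toMultiset
      = z.toMultiset.map (Sum.map e.nodes id) := by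
    intro z
    induction z with
    | _ a b => simp [Sym2.toMultiset]
  unfold indices
  congr 1
  · refine (Fintype.sum_equiv e.nodes _ _ fun v => ?_).symm
    rw [e.out_eq]
    rcases h : γ.out v with a | a
    · simp [hinj.eq_iff]
    · simp
  · refine (Fintype.sum_equiv e.lianas _ _ fun l => ?_).symm
    rw [e.liana_eq, hmul, Multiset.count_map_eq_count' _ _ hinj]
    rfl

end Graph

/-- Equivalence of concrete forests. -/
instance forestSetoid : Setoid Forest where
  r γ γ' := Nonempty (Graph.Iso γ γ')
  iseqv :=
    ⟨fun γ => ⟨Graph.Iso.refl γ⟩, fun ⟨e⟩ => ⟨e.symm⟩, fun ⟨e⟩ ⟨e'⟩ => ⟨e.trans e'⟩⟩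

theorem Forest.F_congr {d : ℕ} (σ : ℝ) (f g : E d → E d) (φ : E d → ℝ) (x : E d)
    {γ γ' : Forest} (h : γ ≈ γ') : Forest.F σ f g φ x γ = Forest.F σ f g φ x γ' := by
  classical
  obtain ⟨e⟩ := h
  unfold Forest.F
  rw [e.order_eq, e.Nf_eq, e.Ng_eq]
  congr 1
  refine (Fintype.sum_equiv (e.nodes.symm.arrowCongr (Equiv.refl (Fin d))) _ _ fun i => ?_).symm
  refine Fintype.sum_equiv (e.lianas.symm.arrowCongr (Equiv.refl (Fin d))) _ _ fun j => ?_
  have hi : (e.nodes.symm.arrowCongr (Equiv.refl (Fin d))) i = i ∘ e.nodes := by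
    ext v; simp
  have hj : (e.lianas.symm.arrowCongr (Equiv.refl (Fin d))) j = j ∘ e.lianas := by
    ext v; simp
  rw [hi, hj]
  congr 1
  · refine (Fintype.prod_equiv e.nodes _ _ fun v => ?_).symm
    have := e.indices_eq i j (Sum.inl v)
    simp only [Sum.map_inl] at this
    rw [e.S_eq, e.colour_eq, this]
    rfl
  · have := e.indices_eq i j (Sum.inr ())
    simp only [Sum.map_inr, id] at this
    rw [this]

/-- The set `EAT` of exotic aromatic forests. -/
abbrev EAT := Quotient forestSetoid

/-- Number of white nodes of an exotic aromatic forest. -/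
def EAT.Ng : EAT → ℕ := Quotient.lift Graph.Ng fun _ _ ⟨e⟩ => e.Ng_eq

/-- Elementary differential of an exotic aromatic forest, at the point `x`. -/
def EAT.F {d : ℕ} (σ : ℝ) (f g : E d → E d) (φ : E d → ℝ) (x : E d) : EAT → ℝ :=
  Quotient.lift (Forest.F σ f g φ x) fun _ _ h => Forest.F_congr σ f g φ x h

/-- Finite real linear combinations of exotic aromatic forests. -/
abbrev Span := EAT →₀ ℝ

/-- The class of a concrete forest, as an element of `Span(EAT)`. -/
def cls (γ : Forest) : Span := Finsupp.single (Quotient.mk _ γ) 1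

/-- Linear extension of the elementary differentials to `Span(EAT)`. -/
def F {d : ℕ} (σ : ℝ) (f g : E d → E d) (φ : E d → ℝ) (u : Span) (x : E d) : ℝ :=
  u.sum fun γ c => c * γ.F σ f g φ x

/-- Delete from a linear combination all the forests which contain a white node. -/
def dropWhite (u : Span) : Span := Finsupp.filter (fun γ : EAT => γ.Ng = 0) u

/-! ### The rewriting rules

A class in `EAT` enters the rules through an arbitrary representative. -/

/-- The black vector field `f`. -/
abbrev black : VField := dot Colour.black

/-- The white vector field `g`. -/
abbrev white : VField := dot Colour.white

/-- The root of a vector field, as a node. -/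
abbrev VField.root (τ : VField) : τ.graph.Node := Sum.inr ()

/-- The vector field `g' H`, where `τ` represents `H`: the root of `τ` is linked to a white node. -/
abbrev VField.underWhite (τ : VField) : VField := white.graft τ white.root

/-- The aroma `div g`. -/
abbrev aromaDivG : Aroma := white.loop white.root

/-- The aroma `(g, f)`. -/
abbrev aromaGF : Aroma := black.scal Colour.white

/-- The aroma `(g, g' g)`. -/
abbrev aromaGGG : Aroma := white.underWhite.scal Colour.white

/-- Left-hand side of the rule for grafting the vector field `τ` to the forest `γ`. -/
def edgeLHS (γ : Forest) (τ : VField) : Span :=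
  (∑ w : γ.Node, cls (γ.graft τ w))
    - ∑ w : γ.Node, cls (τ.scal Colour.white ⊙ γ.graft white w)

/-- Right-hand side of the rule for grafting the vector field `τ` to the forest `γ`. -/
def edgeRHS (γ : Forest) (τ : VField) : Span :=
  (∑ w : τ.graph.Node, cls ((τ.graft white w).scal Colour.white ⊙ γ))
    - ((γ.Ng : ℝ) + τ.Ng + 1) • cls (aromaGGG ⊙ τ.scal Colour.white ⊙ γ)
    - (∑ w : τ.graph.Node, cls (τ.loop w ⊙ γ))
    + ((γ.Ng : ℝ) + τ.Ng) • cls (τ.underWhite.scal Colour.white ⊙ γ)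
    + cls (aromaDivG ⊙ τ.scal Colour.white ⊙ γ)
    + (2 : ℝ) • cls (aromaGF ⊙ τ.scal Colour.white ⊙ γ)
    - (2 : ℝ) • cls (τ.scal Colour.black ⊙ γ)

/-- Left-hand side of the rule for adding a liana at the node `v` of `γ`: in the second sum, a white
node is first grafted to any node of `γ`, then another one is grafted to `v`. -/
def lianaLHS (γ : Forest) (v : γ.Node) : Span :=
  (∑ w : γ.Node, cls (γ.addLiana v w))
    - ∑ w : γ.Node, cls ((γ.graft white w).graft white (γ.graftNode white w v))

/-- Right-hand side of the rule for adding a liana at the node `v` of `γ`. -/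
def lianaRHS (γ : Forest) (v : γ.Node) : Span :=
  -(((γ.Ng : ℝ) + 1) • cls (aromaGGG ⊙ γ.graft white v))
    + (γ.Ng : ℝ) • cls (γ.graft white.underWhite v)
    + cls (aromaDivG ⊙ γ.graft white v)
    + (2 : ℝ) • cls (aromaGF ⊙ γ.graft white v)
    - (2 : ℝ) • cls (γ.graft black v)

/-- Left-hand side of the Euclidean rule for grafting `τ` to `γ`. -/
def euclideanEdgeLHS (γ : Forest) (τ : VField) : Span := ∑ w : γ.Node, cls (γ.graft τ w)

/-- Right-hand side of the Euclidean rule for grafting `τ` to `γ`. -/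
def euclideanEdgeRHS (γ : Forest) (τ : VField) : Span :=
  -(∑ w : τ.graph.Node, cls (τ.loop w ⊙ γ)) - (2 : ℝ) • cls (τ.scal Colour.black ⊙ γ)

/-- Left-hand side of the Euclidean rule for adding a liana at `v`. -/
def euclideanLianaLHS (γ : Forest) (v : γ.Node) : Span := ∑ w : γ.Node, cls (γ.addLiana v w)

/-- Right-hand side of the Euclidean rule for adding a liana at `v`. -/
def euclideanLianaRHS (γ : Forest) (v : γ.Node) : Span := -((2 : ℝ) • cls (γ.graft black v))

/-! ### Measures -/

/-- The canonical (surface) measure of a hypersurface `M` of `ℝ^d`. -/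
def surfaceMeasure {d : ℕ} (M : Set (E d)) : Measure (E d) := (μHE[d - 1]).restrict M

/-- The Gibbs measure `Z⁻¹ exp(-2 V / σ²) dν`, where `Z = ∫ exp(-2 V / σ²) dν`. -/
def gibbs {d : ℕ} (ν : Measure (E d)) (σ : ℝ) (V : E d → ℝ) : Measure (E d) :=
  ν.tilted fun x => -(2 / σ ^ 2) * V x

/-- `u` and `v` are integrable and have the same integral. -/
def SameIntegral {d : ℕ} (μ : Measure (E d)) (u v : E d → ℝ) : Prop :=
  Integrable u μ ∧ Integrable v μ ∧ ∫ x, u x ∂μ = ∫ x, v x ∂μ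

end ExoticAromatic

end

open ExoticAromatic

/-!
Both rules are integration by parts. Write `f = -∇V`, `g = ∇ζ`, `G = |g|²`, `c = 2 / σ²`.

*On the hypersurface* `{ζ = 0}`, the surface measure is the limit of thin layers: if `δ_n`
approximates the Dirac mass, `∫ δ_n(ζ) ψ dx` tends to the integral of `ψ / |g|` over `{ζ = 0}`.
This case of the coarea formula (`tendsto_integral_layer`) is proved directly from the definition
of the Hausdorff measure: near a point of the level set there is a `K`-bi-Lipschitz chart, with `K`
as close to `1` as one likes, in which `ζ` is a multiple of the first coordinate (`exists_chart`).
In this chart the limit is elementary, and going back to `ζ` costs powers of `K`; a partition of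
unity and `K → 1` conclude. A compactly supported field `X` tangent to the level sets of `ζ`
satisfies `div (δ_n(ζ) X) = δ_n(ζ) div X`, whose integral vanishes, hence `div X / |g|` has
integral zero over `{ζ = 0}` (`integral_div_tangent`). For the tangential field
`X = e^{-cV} G^{-(n+1)/2} (G Y - (g, Y) g)`, cut off away from the zeros of `g`, this is the
formula `integral_surface_divergence`: the integral of `e^{-cV} G^{-n/2}` times

  `div Y - (g, Y'g)/G - (g, Y) div g/G + (n+1)(g, Y)(g, g'g)/G² - n (Y, g'g)/G`
  `+ c (Y, f) - c (g, Y)(g, f)/G`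

vanishes.

*Forests as functions.* Let `val` be the elementary differential without its prefactor, with
possible additional derivatives at the nodes. Grafting, closing a root by a scalar-product edge,
looping it, disjoint unions and new lianas are contractions and products of such values
(`rawVal_graft` and the following lemmas), and by the product rule a partial derivative of `val` is
the sum over the nodes of the values with one more derivative there (`partialD_rawVal`). As
prefactors are multiplicative, the difference of the two sides of the edge rule is at every point
where `g ≠ 0` a constant times the integrand above for `Y = F(γ) F(τ)` and `n = N_g(γ) + N_g(τ)`
(`F_edge_sub`). For the liana rule `Y` is the field obtained by differentiating `γ` once more at
the node `v`, and `n = N_g(γ)` (`F_liana_sub`).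

*On `ℝ^d`* the same computation without `g` reduces the rules to
`∫ e^{-cV} (div Y + c (Y, f)) dx = 0` for fields of polynomial growth
(`integral_euclidean_divergence`). That the rules reduce to the Euclidean ones is a count of white
nodes.
-/

noncomputable section

namespace ExoticAromatic

/-! ### Values of graphs with additional derivatives -/

section SumsOverIndices

variable {α β κ M : Type*} [AddCommMonoid M]

open Classical in
/-- A sum over the indices of a disjoint union of nodes. The finiteness instance is arbitrary,
because the sums in the definition of the elementary differential use a classical one. -/
theorem sum_arrow_sum [Fintype κ] [Fintype α] [Fintype β] {inst : Fintype (α ⊕ β → κ)}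
    (F : (α ⊕ β → κ) → M) :
    ∑ i, F i = ∑ a : α → κ, ∑ b : β → κ, F (Sum.elim a b) := by
  rw [← Fintype.sum_prod_type']
  exact (Fintype.sum_equiv (Equiv.sumArrowEquivProdArrow α β κ).symm _ _ fun p => rfl).symm

theorem sum_arrow_unit [Fintype κ] {inst : Fintype (Unit → κ)} (F : (Unit → κ) → M) :
    ∑ i, F i = ∑ k, F fun _ => k :=
  Fintype.sum_equiv (Equiv.funUnique Unit κ) _ _ fun i => by
    congr 1

theorem sum_arrow_empty {inst : Fintype (Empty → κ)} (F : (Empty → κ) → M) :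
    ∑ i, F i = F Empty.elim := by
  rw [Fintype.sum_eq_single Empty.elim]
  intro i hi
  exact absurd (Subsingleton.elim _ _) hi

theorem count_toMultiset_map [DecidableEq α] [DecidableEq β] {h : α → β}
    (hh : Function.Injective h) (z : Sym2 α) (a : α) :
    (Sym2.map h z).toMultiset.count (h a) = z.toMultiset.count a := by
  induction z with
  | _ b c =>
    change Multiset.count (h a) {h b, h c} = Multiset.count a {b, c}
    simp [Multiset.insert_eq_cons, Multiset.count_cons, hh.eq_iff, Multiset.count_singleton]

theorem count_toMultiset_map_of_ne [DecidableEq β] {h : α → β}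
    (z : Sym2 α) {b : β} (hb : ∀ a, h a ≠ b) : (Sym2.map h z).toMultiset.count b = 0 := by
  induction z with
  | _ a c =>
    change Multiset.count b {h a, h c} = 0
    simp [Multiset.insert_eq_cons, (hb _).symm]

end SumsOverIndices

section Incidence

variable {ι N N₁ N₂ L L₁ L₂ P P' Q Q' : Type*} [Fintype N] [Fintype N₁] [Fintype N₂]
  [Fintype L] [Fintype L₁] [Fintype L₂]

open Classical in
/-- The additional index `k` at the node `w`, and none at the other nodes. -/
def mark (w : P) (k : ι) (u : P) : Multiset ι := if u = w then {k} else 0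

open Classical in
/-- The indices `i v` of the predecessors `v` of `u`, when `out` gives the outgoing edges. -/
def edgeIndices (out : N → P ⊕ Q) (i : N → ι) (u : P) : Multiset ι :=
  ∑ v : N, if out v = Sum.inl u then {i v} else 0

open Classical in
/-- The indices `j l` of the lianas `l` which end at `u`, with multiplicity. -/
def lianaIndices (lia : L → Sym2 P) (j : L → ι) (u : P) : Multiset ι :=
  ∑ l : L, (lia l).toMultiset.count u • {j l}

open Classical in
/-- The product of Kronecker symbols attached to scalar-product edges: the index of a node is
compared with the index of the node at the other end of its outgoing edge, when it is a
scalar-product edge. -/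
def kronecker (out : N → P ⊕ Q) (i : N → ι) (i' : Q → ι) : ℝ :=
  ∏ v : N, if i v = Sum.elim (fun _ => i v) i' (out v) then (1 : ℝ) else 0

theorem edgeIndices_sum (o₁ : N₁ → P ⊕ Q) (o₂ : N₂ → P ⊕ Q) (i₁ : N₁ → ι) (i₂ : N₂ → ι) (u : P) :
    edgeIndices (Sum.elim o₁ o₂) (Sum.elim i₁ i₂) u =
      edgeIndices o₁ i₁ u + edgeIndices o₂ i₂ u :=
  Fintype.sum_sum_type _

theorem edgeIndices_map {h : P → P'} (hh : Function.Injective h) (k : Q → Q') (o : N → P ⊕ Q)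
    (i : N → ι) (u : P) :
    edgeIndices (fun v => Sum.map h k (o v)) i (h u) = edgeIndices o i u := by
  refine Finset.sum_congr rfl fun v _ => ?_
  classical
  apply if_congr _ rfl rfl
  rcases ho : o v with a | a <;> simp [ho, hh.eq_iff]

theorem edgeIndices_map_of_ne {h : P → P'} (k : Q → Q') (o : N → P ⊕ Q)
    (i : N → ι) {u : P'} (hu : ∀ a, h a ≠ u) :
    edgeIndices (fun v => Sum.map h k (o v)) i u = 0 := by
  refine Finset.sum_eq_zero fun v _ => ?_
  rcases ho : o v with a | a <;> simp [ho, hu]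

theorem mark_apply_of_injective {h : P → P'} (hh : Function.Injective h) (w u : P) (k : ι) :
    mark (h w) k (h u) = mark w k u := by
  classical
  apply if_congr _ rfl rfl
  rw [hh.eq_iff]

theorem mark_of_ne {w u : P} (h : u ≠ w) (k : ι) : mark w k u = 0 := if_neg h

theorem edgeIndices_unit (w u : P) (i : Unit → ι) :
    edgeIndices (fun _ : Unit => (Sum.inl w : P ⊕ Q)) i u =
      mark w (i ()) u := by
  classical
  refine (Fintype.sum_unique _).trans ?_
  apply if_congr _ rfl rfl
  simp [eq_comm]

theorem edgeIndices_unit_inr (w : Q) (u : P) (i : Unit → ι) :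
    edgeIndices (fun _ : Unit => (Sum.inr w : P ⊕ Q)) i u = 0 := by
  simp [edgeIndices]

theorem edgeIndices_empty (o : Empty → P ⊕ Q) (i : Empty → ι) (u : P) :
    edgeIndices o i u = 0 := by
  simp [edgeIndices]

theorem lianaIndices_sum (o₁ : L₁ → Sym2 P) (o₂ : L₂ → Sym2 P) (i₁ : L₁ → ι) (i₂ : L₂ → ι) (u : P) :
    lianaIndices (Sum.elim o₁ o₂) (Sum.elim i₁ i₂) u =
      lianaIndices o₁ i₁ u + lianaIndices o₂ i₂ u := by
  exact Fintype.sum_sum_type _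

theorem lianaIndices_map {h : P → P'} (hh : Function.Injective h) (o : L → Sym2 P)
    (i : L → ι) (u : P) :
    lianaIndices (fun l => Sym2.map h (o l)) i (h u) = lianaIndices o i u := by
  refine Finset.sum_congr rfl fun v _ => ?_
  classical
  exact congrArg (· • ({i v} : Multiset ι)) (count_toMultiset_map hh _ _)

theorem lianaIndices_map_of_ne {h : P → P'} (o : L → Sym2 P)
    (i : L → ι) {u : P'} (hu : ∀ a, h a ≠ u) :
    lianaIndices (fun l => Sym2.map h (o l)) i u = 0 := by
  refine Finset.sum_eq_zero fun v _ => ?_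
  classical
  exact (congrArg (· • ({i v} : Multiset ι)) (count_toMultiset_map_of_ne _ hu)).trans
    (zero_smul _ _)

theorem lianaIndices_unit (v w u : P) (j : Unit → ι) :
    lianaIndices (fun _ : Unit => s(v, w)) j u =
      mark v (j ()) u + mark w (j ()) u := by
  have : s(v, w).toMultiset = {v, w} := rfl
  simp only [lianaIndices, Finset.univ_unique, Finset.sum_singleton, this,
    Multiset.insert_eq_cons, Multiset.count_cons, Multiset.count_singleton, mark,
    add_smul]
  split_ifs <;> simp

theorem lianaIndices_empty (o : Empty → Sym2 P) (j : Empty → ι) (u : P) :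
    lianaIndices o j u = 0 := by
  simp [lianaIndices]

theorem kronecker_sum (o₁ : N₁ → P ⊕ Q) (o₂ : N₂ → P ⊕ Q) (i₁ : N₁ → ι) (i₂ : N₂ → ι) (i' : Q → ι) :
    kronecker (Sum.elim o₁ o₂) (Sum.elim i₁ i₂) i' = kronecker o₁ i₁ i' * kronecker o₂ i₂ i' := by
  exact Fintype.prod_sum_type _

theorem kronecker_map (h : P → P') (k : Q → Q') (o : N → P ⊕ Q) (i : N → ι) (i' : Q' → ι) :
    kronecker (fun v => Sum.map h k (o v)) i i' = kronecker o i (fun v => i' (k v)) := by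
  refine Finset.prod_congr rfl fun v _ => ?_
  classical
  apply if_congr _ rfl rfl
  rcases ho : o v with a | a <;> simp [ho]

theorem kronecker_unit (w : P) (i : Unit → ι) (i' : Q → ι) :
    kronecker (fun _ : Unit => (Sum.inl w : P ⊕ Q)) i i' = 1 := by
  simp [kronecker]

open Classical in
theorem kronecker_unit_inr (w : Q) (i : Unit → ι) (i' : Q → ι) :
    kronecker (fun _ : Unit => (Sum.inr w : P ⊕ Q)) i i' = if i () = i' w then 1 else 0 :=
  Fintype.prod_unique _

theorem kronecker_empty (o : Empty → P ⊕ Q) (i : Empty → ι) (i' : Q → ι) :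
    kronecker o i i' = 1 := by
  simp [kronecker]

end Incidence

section RawValue

variable {R A B L L' : Type} {d : ℕ} [Fintype R] [Fintype A] [Fintype B] [Fintype L] [Fintype L']
  (f g : E d → E d)

open Classical in
/-- The elementary differential of a graph given by its nodes, edges and lianas, without numerical
prefactor, with the functions `Φ` at the distinguished nodes, and with the additional derivatives
`e u` at each node `u`. -/
def rawVal (colour : A → Colour) (out : A → (A ⊕ R) ⊕ A) (lia : L → Sym2 (A ⊕ R))
    (Φ : R → E d → ℝ) (e : A ⊕ R → Multiset (Fin d)) (x : E d) : ℝ :=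
  ∑ i : A → Fin d, ∑ j : L → Fin d,
    kronecker out i i *
      ((∏ v : A, iterD (edgeIndices out i (Sum.inl v) + lianaIndices lia j (Sum.inl v)
          + e (Sum.inl v)) (fun y => fieldOf f g (colour v) y (i v)) x) *
       ∏ r : R, iterD (edgeIndices out i (Sum.inr r) + lianaIndices lia j (Sum.inr r)
          + e (Sum.inr r)) (Φ r) x)

/-- Grafting contracts the value of the grafted graph with an additional derivative at `w`. -/
theorem rawVal_graft (colour : A → Colour) (out : A → (A ⊕ R) ⊕ A) (lia : L → Sym2 (A ⊕ R))
    (colour' : B → Colour) (out' : B → (B ⊕ Unit) ⊕ B) (lia' : L' → Sym2 (B ⊕ Unit)) (c : Colour)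
    (w : A ⊕ R) (Φ : R → E d → ℝ) (e : (A ⊕ (B ⊕ Unit)) ⊕ R → Multiset (Fin d))
    (he : ∀ u, e (Sum.inl (Sum.inr u)) = 0) (x : E d) :
    rawVal f g (A := A ⊕ (B ⊕ Unit)) (L := L ⊕ L') (Sum.elim colour (Sum.elim colour' fun _ => c))
      (Sum.elim (fun v => Sum.map (Sum.map Sum.inl id) Sum.inl (out v))
        (Sum.elim (fun v => Sum.map (fun u => Sum.inl (Sum.inr u)) (fun u => Sum.inr (Sum.inl u))
          (out' v)) (fun _ : Unit => Sum.inl (Sum.map Sum.inl id w))))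
      (Sum.elim (fun l => Sym2.map (Sum.map Sum.inl id) (lia l))
        (fun l => Sym2.map (fun u => Sum.inl (Sum.inr u)) (lia' l))) Φ e x =
      ∑ k, rawVal f g colour out lia Φ
          (fun u => e (Sum.map Sum.inl id u) + mark w k u) x
        * rawVal f g colour' out' lia' (fun _ y => fieldOf f g c y k) 0 x := by
  have hinj : Function.Injective (Sum.map Sum.inl id : A ⊕ R → (A ⊕ (B ⊕ Unit)) ⊕ R) :=
    Sum.map_injective.2 ⟨Sum.inl_injective, Function.injective_id⟩
  have hinj' : Function.Injective
      (fun u => Sum.inl (Sum.inr u) : B ⊕ Unit → (A ⊕ (B ⊕ Unit)) ⊕ R) :=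
    Sum.inl_injective.comp Sum.inr_injective
  have hne (a : A ⊕ R) (u : B ⊕ Unit) :
      (Sum.map Sum.inl id : A ⊕ R → (A ⊕ (B ⊕ Unit)) ⊕ R) a ≠ Sum.inl (Sum.inr u) := by
    rcases a with a | a <;> simp
  unfold rawVal
  rw [sum_arrow_sum]
  simp_rw [sum_arrow_sum (α := B) (β := Unit), sum_arrow_unit, sum_arrow_sum (α := L) (β := L')]
  -- the only new incidence at a node of the first graph is the one of the grafted root at `w`
  have h1 (i : A → Fin d) (i' : B → Fin d) (k : Fin d) (u : A ⊕ R) :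
      edgeIndices (Q := A ⊕ (B ⊕ Unit))
        (Sum.elim (fun v => Sum.map (Sum.map Sum.inl id) Sum.inl (out v))
        (Sum.elim (fun v => Sum.map (fun u => Sum.inl (Sum.inr u)) (fun u => Sum.inr (Sum.inl u))
          (out' v)) (fun _ : Unit => Sum.inl (Sum.map Sum.inl id w))))
            (Sum.elim i (Sum.elim i' fun _ : Unit => k))
            (Sum.map Sum.inl id u : (A ⊕ (B ⊕ Unit)) ⊕ R)
        = edgeIndices out i u + mark w k u := by
    rw [edgeIndices_sum, edgeIndices_sum, edgeIndices_map hinj,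
      edgeIndices_map_of_ne _ _ _ fun a => (hne u a).symm, zero_add, edgeIndices_unit]
    rw [mark_apply_of_injective hinj]
  have h2 (i : A → Fin d) (i' : B → Fin d) (k : Fin d) (u : B ⊕ Unit) :
      edgeIndices (Q := A ⊕ (B ⊕ Unit))
        (Sum.elim (fun v => Sum.map (Sum.map Sum.inl id) Sum.inl (out v))
        (Sum.elim (fun v => Sum.map (fun u => Sum.inl (Sum.inr u)) (fun u => Sum.inr (Sum.inl u))
          (out' v)) (fun _ : Unit => Sum.inl (Sum.map Sum.inl id w))))
            (Sum.elim i (Sum.elim i' fun _ : Unit => k))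
            (Sum.inl (Sum.inr u) : (A ⊕ (B ⊕ Unit)) ⊕ R)
        = edgeIndices out' i' u := by
    rw [edgeIndices_sum, edgeIndices_sum, edgeIndices_map_of_ne _ _ _ fun a => (hne a u), zero_add,
      edgeIndices_map hinj', edgeIndices_unit]
    rw [mark_of_ne (hne _ _).symm, add_zero]
  have h3 (j : L → Fin d) (j' : L' → Fin d) (u : A ⊕ R) :
      lianaIndices (Sum.elim (fun l => Sym2.map (Sum.map Sum.inl id) (lia l))
        (fun l => Sym2.map (fun u => Sum.inl (Sum.inr u)) (lia' l))) (Sum.elim j j')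
        (Sum.map Sum.inl id u : (A ⊕ (B ⊕ Unit)) ⊕ R)
        = lianaIndices lia j u := by
    rw [lianaIndices_sum, lianaIndices_map hinj, lianaIndices_map_of_ne _ _ fun a => (hne u a).symm,
      add_zero]
  have h4 (j : L → Fin d) (j' : L' → Fin d) (u : B ⊕ Unit) :
      lianaIndices (Sum.elim (fun l => Sym2.map (Sum.map Sum.inl id) (lia l))
        (fun l => Sym2.map (fun u => Sum.inl (Sum.inr u)) (lia' l))) (Sum.elim j j')
        (Sum.inl (Sum.inr u) : (A ⊕ (B ⊕ Unit)) ⊕ R)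
        = lianaIndices lia' j' u := by
    rw [lianaIndices_sum, lianaIndices_map_of_ne _ _ fun a => (hne a u), zero_add,
      lianaIndices_map hinj']
  have h1l := fun i i' k v => h1 i i' k (Sum.inl v)
  have h1r := fun i i' k v => h1 i i' k (Sum.inr v)
  have h3l := fun i i' v => h3 i i' (Sum.inl v)
  have h3r := fun i i' v => h3 i i' (Sum.inr v)
  simp only [Sum.map_inl, Sum.map_inr, id] at h1l h1r h3l h3r
  simp only [kronecker_sum, kronecker_map, kronecker_unit, mul_one, Fintype.prod_sum_type,
    Sum.elim_inl, Sum.elim_inr, h1l, h1r, h2, h3l, h3r, h4, he, Finset.sum_mul_sum, Sum.map_inl,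
    Sum.map_inr, id, Pi.zero_apply, add_zero, Finset.univ_unique, Finset.prod_singleton]
  have hsw (a b c p : Multiset (Fin d)) : a + b + c + p = a + c + (p + b) := by abel
  refine (Finset.sum_congr rfl fun i _ => Finset.sum_comm).trans (Finset.sum_comm.trans ?_)
  refine Finset.sum_congr rfl fun k _ => Finset.sum_congr rfl fun i _ =>
    Finset.sum_congr rfl fun i' _ => Finset.sum_congr rfl fun j _ =>
      Finset.sum_congr rfl fun j' _ => ?_
  simp only [hsw]
  ring

/-- Closing the root of a graph by a scalar-product edge contracts its value with the new node. -/
theorem rawVal_scal (colour : B → Colour) (out : B → (B ⊕ Unit) ⊕ B) (lia : L → Sym2 (B ⊕ Unit))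
    (c c' : Colour) (Φ : Empty → E d → ℝ) (x : E d) :
    rawVal f g (R := Empty) (A := (B ⊕ Unit) ⊕ Unit)
      (Sum.elim (Sum.elim colour fun _ => c) fun _ => c')
      (Sum.elim (Sum.elim (fun v => Sum.map (fun u => Sum.inl (Sum.inl u))
        (fun u => Sum.inl (Sum.inl u)) (out v)) (fun _ => Sum.inr (Sum.inr ())))
        (fun _ => Sum.inr (Sum.inl (Sum.inr ()))))
      (fun l => Sym2.map (fun u => Sum.inl (Sum.inl u)) (lia l)) Φ 0 x =
      ∑ k, rawVal f g colour out lia (fun _ y => fieldOf f g c y k) 0 x * fieldOf f g c' x k := by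
  have hinj : Function.Injective
      (fun u => Sum.inl (Sum.inl u) : B ⊕ Unit → ((B ⊕ Unit) ⊕ Unit) ⊕ Empty) :=
    Sum.inl_injective.comp Sum.inl_injective
  have hne (u : B ⊕ Unit) (a : Unit) :
      (Sum.inl (Sum.inl u) : ((B ⊕ Unit) ⊕ Unit) ⊕ Empty) ≠ Sum.inl (Sum.inr a) := by
    simp
  unfold rawVal
  rw [sum_arrow_sum]
  simp_rw [sum_arrow_sum (α := B) (β := Unit), sum_arrow_unit]
  have h1 (i : B → Fin d) (k l : Fin d) (u : B ⊕ Unit) :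
      edgeIndices (Q := (B ⊕ Unit) ⊕ Unit)
        (Sum.elim (Sum.elim (fun v => Sum.map (fun u => Sum.inl (Sum.inl u))
          (fun u => Sum.inl (Sum.inl u)) (out v)) (fun _ : Unit => Sum.inr (Sum.inr ())))
          (fun _ : Unit => Sum.inr (Sum.inl (Sum.inr ()))))
        (Sum.elim (Sum.elim i fun _ => k) fun _ => l)
        (Sum.inl (Sum.inl u) : ((B ⊕ Unit) ⊕ Unit) ⊕ Empty) = edgeIndices out i u := by
    rw [edgeIndices_sum, edgeIndices_sum, edgeIndices_map hinj, edgeIndices_unit_inr,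
      edgeIndices_unit_inr, add_zero, add_zero]
  have h2 (i : B → Fin d) (k l : Fin d) (a : Unit) :
      edgeIndices (Q := (B ⊕ Unit) ⊕ Unit)
        (Sum.elim (Sum.elim (fun v => Sum.map (fun u => Sum.inl (Sum.inl u))
          (fun u => Sum.inl (Sum.inl u)) (out v)) (fun _ : Unit => Sum.inr (Sum.inr ())))
          (fun _ : Unit => Sum.inr (Sum.inl (Sum.inr ()))))
        (Sum.elim (Sum.elim i fun _ => k) fun _ => l)
        (Sum.inl (Sum.inr a) : ((B ⊕ Unit) ⊕ Unit) ⊕ Empty) = 0 := by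
    rw [edgeIndices_sum, edgeIndices_sum, edgeIndices_map_of_ne _ _ _ fun u => hne u a,
      edgeIndices_unit_inr, edgeIndices_unit_inr, add_zero, add_zero]
  have h3 (j : L → Fin d) (a : Unit) :
      lianaIndices (fun l => Sym2.map (fun u => Sum.inl (Sum.inl u)) (lia l)) j
        (Sum.inl (Sum.inr a) : ((B ⊕ Unit) ⊕ Unit) ⊕ Empty) = 0 :=
    lianaIndices_map_of_ne _ _ fun u => hne u a
  have h4 (j : L → Fin d) (u : B ⊕ Unit) :
      lianaIndices (fun l => Sym2.map (fun u => Sum.inl (Sum.inl u)) (lia l)) j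
        (Sum.inl (Sum.inl u) : ((B ⊕ Unit) ⊕ Unit) ⊕ Empty) = lianaIndices lia j u :=
    lianaIndices_map hinj _ _ _
  have h5 (h : E d → ℝ) : iterD 0 h = h := by simp [iterD]
  simp only [kronecker_sum, kronecker_map, kronecker_unit_inr, Fintype.prod_sum_type,
    Sum.elim_inl, Sum.elim_inr, h1, h2, h3, h4, h5, Pi.zero_apply, add_zero, Finset.univ_unique,
    Finset.prod_singleton, Finset.univ_eq_empty, Finset.prod_empty, mul_one, Finset.sum_mul]
  rw [Finset.sum_comm]
  refine Finset.sum_congr rfl fun k _ => Finset.sum_congr rfl fun i _ => ?_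
  rw [Finset.sum_comm]
  refine Finset.sum_congr rfl fun j _ => ?_
  -- the Kronecker symbols of the new edge identify the indices of its two ends
  rw [Finset.sum_eq_single k]
  · simp only [if_true]
    ring
  · intro l _ hl
    simp [hl]
  · simp

/-- Linking the root of a graph to one of its nodes traces its value with an additional derivative
at this node. -/
theorem rawVal_loop (colour : B → Colour) (out : B → (B ⊕ Unit) ⊕ B) (lia : L → Sym2 (B ⊕ Unit))
    (c : Colour) (w : B ⊕ Unit) (Φ : Empty → E d → ℝ) (x : E d) :
    rawVal f g (R := Empty) (A := B ⊕ Unit) (Sum.elim colour fun _ => c)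
      (Sum.elim (fun v => Sum.map Sum.inl Sum.inl (out v)) (fun _ => Sum.inl (Sum.inl w)))
      (fun l => Sym2.map Sum.inl (lia l)) Φ 0 x =
      ∑ k, rawVal f g colour out lia (fun _ y => fieldOf f g c y k) (mark w k) x := by
  have hinj : Function.Injective (Sum.inl : B ⊕ Unit → (B ⊕ Unit) ⊕ Empty) :=
    Sum.inl_injective
  unfold rawVal
  rw [sum_arrow_sum]
  simp_rw [sum_arrow_unit]
  have h1 (i : B → Fin d) (k : Fin d) (u : B ⊕ Unit) :
      edgeIndices (Q := B ⊕ Unit)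
        (Sum.elim (fun v => Sum.map Sum.inl Sum.inl (out v)) (fun _ : Unit => Sum.inl (Sum.inl w)))
        (Sum.elim i fun _ => k) (Sum.inl u : (B ⊕ Unit) ⊕ Empty) =
        edgeIndices out i u + mark w k u := by
    rw [edgeIndices_sum, edgeIndices_map hinj, edgeIndices_unit]
    rw [mark_apply_of_injective hinj]
  have h4 (j : L → Fin d) (u : B ⊕ Unit) :
      lianaIndices (fun l => Sym2.map Sum.inl (lia l)) j (Sum.inl u : (B ⊕ Unit) ⊕ Empty)
        = lianaIndices lia j u :=
    lianaIndices_map hinj _ _ _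
  have hsw (a b c : Multiset (Fin d)) : a + b + c = a + c + b := by abel
  simp only [kronecker_sum, kronecker_map, kronecker_unit, Fintype.prod_sum_type,
    Sum.elim_inl, Sum.elim_inr, h1, h4, Pi.zero_apply, add_zero, Finset.univ_unique,
    Finset.prod_singleton, Finset.univ_eq_empty, Finset.prod_empty, mul_one]
  rw [Finset.sum_comm]
  refine Finset.sum_congr rfl fun k _ => Finset.sum_congr rfl fun i _ =>
    Finset.sum_congr rfl fun j _ => ?_
  have hprod (u : B ⊕ Unit) : edgeIndices out i u + mark w k u
      + lianaIndices lia j u = edgeIndices out i u + lianaIndices lia j u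
      + mark w k u := hsw _ _ _
  simp only [hprod]

/-- The value of a disjoint union is the product of the values. -/
theorem rawVal_mul (colour : B → Colour) (out : B → (B ⊕ Empty) ⊕ B) (lia : L → Sym2 (B ⊕ Empty))
    (colour' : A → Colour) (out' : A → (A ⊕ R) ⊕ A) (lia' : L' → Sym2 (A ⊕ R))
    (Φ : R → E d → ℝ) (Φ' : Empty → E d → ℝ) (x : E d) :
    rawVal f g (A := B ⊕ A) (L := L ⊕ L') (Sum.elim colour colour')
      (Sum.elim (fun v => Sum.map (Sum.map Sum.inl Empty.elim) Sum.inl (out v))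
        (fun v => Sum.map (Sum.map Sum.inr id) Sum.inr (out' v)))
      (Sum.elim (fun l => Sym2.map (Sum.map Sum.inl Empty.elim) (lia l))
        (fun l => Sym2.map (Sum.map Sum.inr id) (lia' l))) Φ 0 x =
      rawVal f g colour out lia Φ' 0 x * rawVal f g colour' out' lia' Φ 0 x := by
  have hinj : Function.Injective (Sum.map Sum.inl Empty.elim : B ⊕ Empty → (B ⊕ A) ⊕ R) :=
    Sum.map_injective.2 ⟨Sum.inl_injective, fun a => a.elim⟩
  have hinj' : Function.Injective (Sum.map Sum.inr id : A ⊕ R → (B ⊕ A) ⊕ R) :=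
    Sum.map_injective.2 ⟨Sum.inr_injective, Function.injective_id⟩
  have hne (u : B ⊕ Empty) (a : A ⊕ R) :
      (Sum.map Sum.inl Empty.elim u : (B ⊕ A) ⊕ R) ≠ Sum.map Sum.inr id a := by
    rcases u with u | u
    · rcases a with a | a <;> simp
    · exact u.elim
  unfold rawVal
  rw [sum_arrow_sum]
  simp_rw [sum_arrow_sum (α := L) (β := L')]
  have h1 (i : B → Fin d) (i' : A → Fin d) (u : B ⊕ Empty) :
      edgeIndices (Q := B ⊕ A)
        (Sum.elim (fun v => Sum.map (Sum.map Sum.inl Empty.elim) Sum.inl (out v))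
          (fun v => Sum.map (Sum.map Sum.inr id) Sum.inr (out' v))) (Sum.elim i i')
        (Sum.map Sum.inl Empty.elim u : (B ⊕ A) ⊕ R) = edgeIndices out i u := by
    rw [edgeIndices_sum, edgeIndices_map hinj, edgeIndices_map_of_ne _ _ _ fun a => (hne u a).symm,
      add_zero]
  have h2 (i : B → Fin d) (i' : A → Fin d) (u : A ⊕ R) :
      edgeIndices (Q := B ⊕ A)
        (Sum.elim (fun v => Sum.map (Sum.map Sum.inl Empty.elim) Sum.inl (out v))
          (fun v => Sum.map (Sum.map Sum.inr id) Sum.inr (out' v))) (Sum.elim i i')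
        (Sum.map Sum.inr id u : (B ⊕ A) ⊕ R) = edgeIndices out' i' u := by
    rw [edgeIndices_sum, edgeIndices_map hinj', edgeIndices_map_of_ne _ _ _ fun a => (hne a u),
      zero_add]
  have h3 (i : L → Fin d) (i' : L' → Fin d) (u : B ⊕ Empty) :
      lianaIndices
        (Sum.elim (fun l => Sym2.map (Sum.map Sum.inl Empty.elim) (lia l))
          (fun l => Sym2.map (Sum.map Sum.inr id) (lia' l))) (Sum.elim i i')
        (Sum.map Sum.inl Empty.elim u : (B ⊕ A) ⊕ R) = lianaIndices lia i u := by
    rw [lianaIndices_sum, lianaIndices_map hinj, lianaIndices_map_of_ne _ _ fun a => (hne u a).symm,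
      add_zero]
  have h4 (i : L → Fin d) (i' : L' → Fin d) (u : A ⊕ R) :
      lianaIndices
        (Sum.elim (fun l => Sym2.map (Sum.map Sum.inl Empty.elim) (lia l))
          (fun l => Sym2.map (Sum.map Sum.inr id) (lia' l))) (Sum.elim i i')
        (Sum.map Sum.inr id u : (B ⊕ A) ⊕ R) = lianaIndices lia' i' u := by
    rw [lianaIndices_sum, lianaIndices_map hinj', lianaIndices_map_of_ne _ _ fun a => (hne a u),
      zero_add]
  have h1l := fun i i' v => h1 i i' (Sum.inl v)
  have h2l := fun i i' v => h2 i i' (Sum.inl v)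
  have h2r := fun i i' v => h2 i i' (Sum.inr v)
  have h3l := fun i i' v => h3 i i' (Sum.inl v)
  have h4l := fun i i' v => h4 i i' (Sum.inl v)
  have h4r := fun i i' v => h4 i i' (Sum.inr v)
  simp only [Sum.map_inl, Sum.map_inr, id] at h1l h2l h2r h3l h4l h4r
  simp only [kronecker_sum, kronecker_map, Fintype.prod_sum_type, Sum.elim_inl, Sum.elim_inr, h1l,
    h2l, h2r, h3l, h4l, h4r, Pi.zero_apply, add_zero, Finset.univ_eq_empty, Finset.prod_empty,
    mul_one, Finset.sum_mul_sum]
  refine Finset.sum_congr rfl fun i _ => Finset.sum_congr rfl fun i' _ =>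
    Finset.sum_congr rfl fun j _ => Finset.sum_congr rfl fun j' _ => ?_
  ring

/-- A new liana contracts two additional derivatives, one at each of its ends. -/
theorem rawVal_addLiana (colour : A → Colour) (out : A → (A ⊕ R) ⊕ A) (lia : L → Sym2 (A ⊕ R))
    (v w : A ⊕ R) (Φ : R → E d → ℝ) (x : E d) :
    rawVal f g (L := L ⊕ Unit) colour out (Sum.elim lia fun _ => s(v, w)) Φ 0 x =
      ∑ k, rawVal f g colour out lia Φ (fun u => mark v k u
        + mark w k u) x := by
  unfold rawVal
  simp_rw [sum_arrow_sum (α := L) (β := Unit), sum_arrow_unit]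
  simp only [lianaIndices_sum, lianaIndices_unit, Pi.zero_apply, add_zero]
  refine (Finset.sum_congr rfl fun i _ => Finset.sum_comm).trans (Finset.sum_comm.trans ?_)
  refine Finset.sum_congr rfl fun k _ => Finset.sum_congr rfl fun i _ =>
    Finset.sum_congr rfl fun j _ => ?_
  simp only [add_assoc]

end RawValue

/-! ### Numbers of white nodes and powers of the noise intensity -/

section Counting

variable {N N₁ N₂ P P' Q Q' : Type*} [Fintype N] [Fintype N₁] [Fintype N₂]

open Classical in
/-- `1` for a white node, `0` for a black one. -/
def Colour.whiteness (c : Colour) : ℕ := if c = Colour.white then 1 else 0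

/-- The number of white nodes among nodes coloured by `colour`. -/
def whiteCount (colour : N → Colour) : ℕ := ∑ v, (colour v).whiteness

/-- The number of nodes whose outgoing edge is a scalar-product edge. -/
def scalCount (out : N → P ⊕ Q) : ℕ := ∑ v, if (out v).isRight then 1 else 0

theorem whiteCount_sum (c₁ : N₁ → Colour) (c₂ : N₂ → Colour) :
    whiteCount (Sum.elim c₁ c₂) = whiteCount c₁ + whiteCount c₂ :=
  Fintype.sum_sum_type _

theorem whiteCount_unit (c : Colour) : whiteCount (fun _ : Unit => c) = c.whiteness :=
  Fintype.sum_unique _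

theorem scalCount_sum (o₁ : N₁ → P ⊕ Q) (o₂ : N₂ → P ⊕ Q) :
    scalCount (Sum.elim o₁ o₂) = scalCount o₁ + scalCount o₂ :=
  Fintype.sum_sum_type _

theorem scalCount_map (h : P → P') (k : Q → Q') (o : N → P ⊕ Q) :
    scalCount (fun v => Sum.map h k (o v)) = scalCount o := by
  simp [scalCount]

theorem scalCount_unit (w : P) : scalCount (fun _ : Unit => (Sum.inl w : P ⊕ Q)) = 0 := by
  simp [scalCount]

theorem scalCount_unit_inr (w : Q) : scalCount (fun _ : Unit => (Sum.inr w : P ⊕ Q)) = 1 := by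
  simp [scalCount]

end Counting

namespace Graph

variable {R : Type}

theorem Ng_eq_whiteCount (γ : Graph R) : γ.Ng = whiteCount γ.colour := by
  classical
  unfold Ng whiteCount Colour.whiteness
  rw [Finset.card_filter]

/-- The exponent `2 N_l + N_g - 2 N_S` of the noise intensity in the elementary differential. -/
def weight (γ : Graph R) : ℝ := 2 * (γ.order - γ.Nf)

theorem weight_eq (γ : Graph R) :
    γ.weight = 2 * Fintype.card γ.L + whiteCount γ.colour - scalCount γ.out := by
  classical
  have h : (γ.Ng : ℝ) = whiteCount γ.colour := by rw [Ng_eq_whiteCount]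
  have h' : γ.cardES = (scalCount γ.out : ℝ) / 2 := by
    unfold cardES scalCount
    rw [Finset.card_filter]
    congr 2
    refine Finset.sum_congr rfl fun v _ => ?_
    apply if_congr _ rfl rfl
    rcases hv : γ.out v with a | a <;> simp
  unfold weight order Nl
  rw [h, h']
  ring

end Graph

theorem VField.Ng_eq (τ : VField) : τ.Ng = whiteCount τ.graph.colour + τ.rootColour.whiteness := by
  rw [← Graph.Ng_eq_whiteCount]
  rfl

/-- The exponent of the noise intensity for a vector field, whose root contributes to the number of
white nodes. -/
def VField.weight (τ : VField) : ℝ := τ.graph.weight + τ.rootColour.whiteness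

theorem VField.weight_eq (τ : VField) : τ.weight =
    2 * Fintype.card τ.graph.L + (whiteCount τ.graph.colour + τ.rootColour.whiteness)
      - scalCount τ.graph.out := by
  unfold VField.weight
  rw [Graph.weight_eq]
  ring

namespace Graph

variable {R : Type}

theorem Ng_graft (γ : Graph R) (τ : VField) (w : γ.Node) :
    (γ.graft τ w).Ng = γ.Ng + τ.Ng := by
  rw [Ng_eq_whiteCount, Ng_eq_whiteCount, VField.Ng_eq]
  exact (whiteCount_sum _ _).trans (congrArg _ ((whiteCount_sum _ _).trans
    (congrArg _ (whiteCount_unit _))))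

theorem weight_graft (γ : Graph R) (τ : VField) (w : γ.Node) :
    (γ.graft τ w).weight = γ.weight + τ.weight := by
  have h1 : (γ.graft τ w).Ng = _ := Ng_graft γ τ w
  rw [Ng_eq_whiteCount, Ng_eq_whiteCount, VField.Ng_eq] at h1
  have h2 : Fintype.card (γ.graft τ w).L = Fintype.card γ.L + Fintype.card τ.graph.L :=
    Fintype.card_sum
  have h3 : scalCount (γ.graft τ w).out = scalCount γ.out + scalCount τ.graph.out :=
    (scalCount_sum _ _).trans (congrArg₂ _ (scalCount_map _ _ _) ((scalCount_sum _ _).trans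
      (congrArg₂ _ (scalCount_map _ _ _) (scalCount_unit _))))
  rw [weight_eq, weight_eq, VField.weight_eq, h1, h2, h3]
  push_cast
  ring

theorem Ng_addLiana (γ : Graph R) (v w : γ.Node) : (γ.addLiana v w).Ng = γ.Ng := rfl

theorem weight_addLiana (γ : Graph R) (v w : γ.Node) :
    (γ.addLiana v w).weight = γ.weight + 2 := by
  have h2 : Fintype.card (γ.addLiana v w).L = Fintype.card γ.L + 1 :=
    Fintype.card_sum
  rw [weight_eq, weight_eq, h2]
  change 2 * _ + (whiteCount γ.colour : ℝ) - (scalCount γ.out : ℝ) = _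
  push_cast
  ring

end Graph

namespace VField

theorem Ng_scal (τ : VField) (c : Colour) : (τ.scal c).Ng = τ.Ng + c.whiteness := by
  rw [Graph.Ng_eq_whiteCount, VField.Ng_eq]
  exact (whiteCount_sum _ _).trans (congrArg₂ _ ((whiteCount_sum _ _).trans
    (congrArg _ (whiteCount_unit _))) (whiteCount_unit _))

theorem weight_scal (τ : VField) (c : Colour) : (τ.scal c).weight = τ.weight + c.whiteness - 2 := by
  have h1 : (τ.scal c).Ng = _ := Ng_scal τ c
  rw [Graph.Ng_eq_whiteCount, VField.Ng_eq] at h1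
  have h3 : scalCount (τ.scal c).out = scalCount τ.graph.out + 1 + 1 :=
    (scalCount_sum _ _).trans (congrArg₂ _ ((scalCount_sum _ _).trans
      (congrArg₂ _ (scalCount_map _ _ _) (scalCount_unit_inr _))) (scalCount_unit_inr _))
  rw [Graph.weight_eq, VField.weight_eq, h1, h3]
  change 2 * (Fintype.card τ.graph.L : ℝ) + _ - _ = _
  push_cast
  ring

theorem Ng_loop (τ : VField) (w : τ.graph.Node) : (τ.loop w).Ng = τ.Ng := by
  rw [Graph.Ng_eq_whiteCount, VField.Ng_eq]
  exact (whiteCount_sum _ _).trans (congrArg _ (whiteCount_unit _))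

theorem weight_loop (τ : VField) (w : τ.graph.Node) : (τ.loop w).weight = τ.weight := by
  have h1 : (τ.loop w).Ng = _ := Ng_loop τ w
  rw [Graph.Ng_eq_whiteCount, VField.Ng_eq] at h1
  have h3 : scalCount (τ.loop w).out = scalCount τ.graph.out :=
    (scalCount_sum _ _).trans (congrArg₂ _ (scalCount_map _ _ _) (scalCount_unit _))
  rw [Graph.weight_eq, VField.weight_eq, h1, h3]
  change 2 * (Fintype.card τ.graph.L : ℝ) + _ - _ = _
  push_cast
  ring

theorem Ng_graft (τ κ : VField) (w : τ.graph.Node) : (τ.graft κ w).Ng = τ.Ng + κ.Ng := by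
  have h : (τ.graft κ w).Ng = (τ.graph.graft κ w).Ng + τ.rootColour.whiteness := rfl
  have h' : τ.Ng = τ.graph.Ng + τ.rootColour.whiteness := rfl
  rw [h, h', Graph.Ng_graft]
  ring

theorem weight_graft (τ κ : VField) (w : τ.graph.Node) :
    (τ.graft κ w).weight = τ.weight + κ.weight := by
  have h : (τ.graft κ w).weight = (τ.graph.graft κ w).weight + τ.rootColour.whiteness := rfl
  rw [h, VField.weight, Graph.weight_graft]
  ring

end VField

theorem Colour.whiteness_white : Colour.white.whiteness = 1 := if_pos rfl

theorem Colour.whiteness_black : Colour.black.whiteness = 0 := if_neg nofun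

theorem dot_Ng (c : Colour) : (dot c).Ng = c.whiteness := by
  rw [VField.Ng_eq]
  change whiteCount (Empty.elim : Empty → Colour) + c.whiteness = c.whiteness
  simp [whiteCount]

theorem dot_weight (c : Colour) : (dot c).weight = c.whiteness := by
  rw [VField.weight_eq]
  change 2 * (Fintype.card Empty : ℝ)
    + ((whiteCount (Empty.elim : Empty → Colour) : ℝ) + c.whiteness)
    - (scalCount (fun v : Empty => v.elim : Empty → (Empty ⊕ Unit) ⊕ Empty) : ℝ) = c.whiteness
  simp [whiteCount, scalCount]

namespace Aroma

variable {R : Type}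

theorem Ng_mul (a : Aroma) (γ : Graph R) : (a ⊙ γ).Ng = Graph.Ng a + γ.Ng := by
  rw [Graph.Ng_eq_whiteCount, Graph.Ng_eq_whiteCount, Graph.Ng_eq_whiteCount]
  exact whiteCount_sum _ _

theorem weight_mul (a : Aroma) (γ : Graph R) : (a ⊙ γ).weight = Graph.weight a + γ.weight := by
  have h1 : (a ⊙ γ).Ng = _ := Ng_mul a γ
  rw [Graph.Ng_eq_whiteCount, Graph.Ng_eq_whiteCount, Graph.Ng_eq_whiteCount] at h1
  have h2 : Fintype.card (a ⊙ γ).L = Fintype.card a.L + Fintype.card γ.L :=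
    Fintype.card_sum
  have h3 : scalCount (a ⊙ γ).out = scalCount a.out + scalCount γ.out :=
    (scalCount_sum _ _).trans (congrArg₂ _ (scalCount_map _ _ _) (scalCount_map _ _ _))
  rw [Graph.weight_eq, Graph.weight_eq, Graph.weight_eq, h1, h2, h3]
  push_cast
  ring

end Aroma

/-! ### Iterated partial derivatives and the product rule -/

section PartialDerivatives

variable {d : ℕ}

theorem contDiff_partialD {h : E d → ℝ} (hh : ContDiff ℝ ∞ h) (k : Fin d) :
    ContDiff ℝ ∞ (partialD k h) :=
  (hh.fderiv_right (m := ∞) (by simp)).clm_apply contDiff_const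

theorem contDiff_foldr_partialD {h : E d → ℝ} (hh : ContDiff ℝ ∞ h) (l : List (Fin d)) :
    ContDiff ℝ ∞ (l.foldr partialD h) := by
  induction l with
  | nil => exact hh
  | cons k l ih => exact contDiff_partialD ih k

theorem contDiff_iterD {h : E d → ℝ} (hh : ContDiff ℝ ∞ h) (I : Multiset (Fin d)) :
    ContDiff ℝ ∞ (iterD I h) :=
  contDiff_foldr_partialD hh _

theorem partialD_comm {h : E d → ℝ} (hh : ContDiff ℝ ∞ h) (k l : Fin d) :
    partialD k (partialD l h) = partialD l (partialD k h) := by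
  have key (a b : Fin d) (x : E d) : partialD a (partialD b h) x =
      fderiv ℝ (fderiv ℝ h) x (EuclideanSpace.single a 1) (EuclideanSpace.single b 1) := by
    unfold partialD
    rw [fderiv_clm_apply ((hh.fderiv_right (m := ∞) (by simp)).differentiable (by simp) x)
      (differentiableAt_const _)]
    simp
  funext x
  rw [key, key]
  exact (hh.contDiffAt.isSymmSndFDerivAt (by
    rw [minSmoothness_of_isRCLikeNormedField]; exact WithTop.coe_le_coe.2 le_top)) _ _

theorem foldr_partialD_perm {h : E d → ℝ} (hh : ContDiff ℝ ∞ h) {l l' : List (Fin d)}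
    (hl : l.Perm l') : l.foldr partialD h = l'.foldr partialD h := by
  induction hl with
  | nil => rfl
  | cons k _ ih => simp [ih]
  | swap k k' l => exact partialD_comm (contDiff_foldr_partialD hh l) _ _
  | trans _ _ ih ih' => exact ih.trans ih'

theorem iterD_zero (h : E d → ℝ) : iterD 0 h = h := by simp [iterD]

/-- The order of the derivatives in `iterD` is irrelevant for a smooth function, so that a new one
may be taken last. -/
theorem iterD_add_singleton {h : E d → ℝ} (hh : ContDiff ℝ ∞ h) (I : Multiset (Fin d)) (k : Fin d) :
    iterD (I + {k}) h = partialD k (iterD I h) := by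
  have : ((I + {k}).sort (· ≤ ·)).Perm (k :: I.sort (· ≤ ·)) := by
    rw [← Multiset.coe_eq_coe, Multiset.sort_eq, ← Multiset.cons_coe, Multiset.sort_eq,
      add_comm, Multiset.singleton_add]
  exact foldr_partialD_perm hh this

theorem partialD_sum {ι : Type*} (s : Finset ι) {h : ι → E d → ℝ}
    (hh : ∀ i ∈ s, ContDiff ℝ ∞ (h i)) (k : Fin d) (x : E d) :
    partialD k (fun y => ∑ i ∈ s, h i y) x = ∑ i ∈ s, partialD k (h i) x := by
  unfold partialD
  rw [fderiv_fun_sum fun i hi => (hh i hi).differentiable (by simp) x]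
  simp

theorem partialD_mul {h h' : E d → ℝ} {x : E d} (hh : DifferentiableAt ℝ h x)
    (hh' : DifferentiableAt ℝ h' x) (k : Fin d) :
    partialD k (fun y => h y * h' y) x = partialD k h x * h' x + h x * partialD k h' x := by
  unfold partialD
  rw [fderiv_fun_mul hh hh']
  simp
  ring

theorem partialD_const_mul (c : ℝ) {h : E d → ℝ} {x : E d} (hh : DifferentiableAt ℝ h x)
    (k : Fin d) : partialD k (fun y => c * h y) x = c * partialD k h x := by
  unfold partialD
  rw [fderiv_const_mul hh]
  simp

open Classical in
/-- The product rule for a product of iterated derivatives. -/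
theorem partialD_prod_iterD {ι : Type*} (s : Finset ι) {h : ι → E d → ℝ}
    (hh : ∀ i, ContDiff ℝ ∞ (h i)) (I : ι → Multiset (Fin d)) (k : Fin d) (x : E d) :
    partialD k (fun y => ∏ i ∈ s, iterD (I i) (h i) y) x =
      ∑ u ∈ s, ∏ i ∈ s, iterD (I i + if i = u then {k} else 0) (h i) x := by
  induction s using Finset.induction_on with
  | empty => simp [partialD]
  | insert a s ha ih =>
    simp only [Finset.prod_insert ha, Finset.sum_insert ha]
    rw [partialD_mul ((contDiff_iterD (hh a) _).differentiable (by simp) x)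
      ((contDiff_prod fun i _ => contDiff_iterD (hh i) _).differentiable (by simp) x), ih,
      Finset.mul_sum, ← iterD_add_singleton (hh a)]
    congr 1
    · simp only [if_true]
      congr 1
      refine Finset.prod_congr rfl fun i hi => ?_
      rw [if_neg (ne_of_mem_of_not_mem hi ha), add_zero]
    · refine Finset.sum_congr rfl fun u hu => ?_
      rw [if_neg (ne_of_mem_of_not_mem hu ha).symm, add_zero]

end PartialDerivatives

section RawValueCalculus

variable {R A L : Type} {d : ℕ} [Fintype R] [Fintype A] [Fintype L]
  {f g : E d → E d} {Φ : R → E d → ℝ}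

theorem contDiff_fieldOf (hf : ContDiff ℝ ∞ f) (hg : ContDiff ℝ ∞ g) (c : Colour) (k : Fin d) :
    ContDiff ℝ ∞ fun y => fieldOf f g c y k := by
  cases c
  · exact contDiff_euclidean.1 hf k
  · exact contDiff_euclidean.1 hg k

variable (colour : A → Colour) (out : A → (A ⊕ R) ⊕ A) (lia : L → Sym2 (A ⊕ R))
  (e : A ⊕ R → Multiset (Fin d))

theorem contDiff_rawVal (hf : ContDiff ℝ ∞ f) (hg : ContDiff ℝ ∞ g)
    (hΦ : ∀ r, ContDiff ℝ ∞ (Φ r)) : ContDiff ℝ ∞ (rawVal f g colour out lia Φ e) := by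
  unfold rawVal
  refine ContDiff.sum fun i _ => ContDiff.sum fun j _ => contDiff_const.mul (ContDiff.mul ?_ ?_)
  · exact contDiff_prod fun v _ => contDiff_iterD (contDiff_fieldOf hf hg _ _) _
  · exact contDiff_prod fun r _ => contDiff_iterD (hΦ r) _

/-- The product rule: a derivative of the value of a graph is the sum of the values with an
additional derivative at one of the nodes. -/
theorem partialD_rawVal (hf : ContDiff ℝ ∞ f) (hg : ContDiff ℝ ∞ g)
    (hΦ : ∀ r, ContDiff ℝ ∞ (Φ r)) (k : Fin d) (x : E d) :
    partialD k (rawVal f g colour out lia Φ e) x =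
      ∑ w, rawVal f g colour out lia Φ (fun u => e u + mark w k u) x := by
  classical
  have hA (i : A → Fin d) (v : A) := contDiff_fieldOf hf hg (colour v) (i v)
  unfold rawVal
  rw [partialD_sum _ fun i _ => ContDiff.sum fun j _ => contDiff_const.mul (ContDiff.mul
    (contDiff_prod fun v _ => contDiff_iterD (hA i v) _)
    (contDiff_prod fun r _ => contDiff_iterD (hΦ r) _)),
    Finset.sum_comm (s := Finset.univ (α := A ⊕ R))]
  refine Finset.sum_congr rfl fun i _ => ?_
  rw [partialD_sum _ fun j _ => contDiff_const.mul (ContDiff.mul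
    (contDiff_prod fun v _ => contDiff_iterD (hA i v) _)
    (contDiff_prod fun r _ => contDiff_iterD (hΦ r) _)),
    Finset.sum_comm (s := Finset.univ (α := A ⊕ R))]
  refine Finset.sum_congr rfl fun j _ => ?_
  have h1 : ContDiff ℝ ∞ fun y => ∏ v : A, iterD (edgeIndices out i (Sum.inl v)
      + lianaIndices lia j (Sum.inl v) + e (Sum.inl v))
        (fun y => fieldOf f g (colour v) y (i v)) y :=
    contDiff_prod fun v _ => contDiff_iterD (hA i v) _
  have h2 : ContDiff ℝ ∞ fun y => ∏ r : R, iterD (edgeIndices out i (Sum.inr r)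
      + lianaIndices lia j (Sum.inr r) + e (Sum.inr r)) (Φ r) y :=
    contDiff_prod fun r _ => contDiff_iterD (hΦ r) _
  rw [partialD_const_mul _ ((h1.mul h2).differentiable (by simp) x),
    partialD_mul (h1.differentiable (by simp) x) (h2.differentiable (by simp) x),
    partialD_prod_iterD _ (fun v => hA i v), partialD_prod_iterD _ hΦ, Fintype.sum_sum_type,
    ← Finset.mul_sum, ← Finset.mul_sum, ← mul_add, Finset.sum_mul, Finset.mul_sum]
  have hl (u v : A) : mark (Sum.inl u : A ⊕ R) k (Sum.inl v) = if v = u then {k} else 0 :=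
    mark_apply_of_injective Sum.inl_injective u v k
  have hr (u v : R) : mark (Sum.inr u : A ⊕ R) k (Sum.inr v) = if v = u then {k} else 0 :=
    mark_apply_of_injective Sum.inr_injective u v k
  have hlr (u : A) (v : R) : mark (Sum.inl u : A ⊕ R) k (Sum.inr v) = 0 := mark_of_ne (by simp) k
  have hrl (u : R) (v : A) : mark (Sum.inr u : A ⊕ R) k (Sum.inl v) = 0 := mark_of_ne (by simp) k
  simp only [hl, hr, hlr, hrl, add_zero, add_assoc]

end RawValueCalculus

/-! ### Values of forests, vector fields and aromas -/

section GraphValues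

variable {d : ℕ} (f g : E d → E d)

/-- The elementary differential of a forest without its numerical prefactor, with the additional
derivatives `e u` at each node `u`. -/
def Forest.val (φ : E d → ℝ) (γ : Forest) (e : γ.Node → Multiset (Fin d)) : E d → ℝ :=
  rawVal f g γ.colour γ.out γ.liana (fun _ => φ) e

/-- The components of the vector field represented by `τ`, without numerical prefactor, with the
additional derivatives `e u` at each node `u`. -/
def VField.val (τ : VField) (e : τ.graph.Node → Multiset (Fin d)) (k : Fin d) : E d → ℝ :=
  rawVal f g τ.graph.colour τ.graph.out τ.graph.liana (fun _ y => fieldOf f g τ.rootColour y k) e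

/-- The function represented by a product of aromas, without numerical prefactor. -/
def Aroma.val (a : Aroma) : E d → ℝ :=
  rawVal f g (R := Empty) a.colour a.out a.liana (fun r => r.elim) 0

theorem Graph.indices_eq {R : Type} (γ : Graph R) (i : γ.N → Fin d) (j : γ.L → Fin d) (u : γ.Node) :
    γ.indices i j u = edgeIndices γ.out i u + lianaIndices γ.liana j u := by
  unfold Graph.indices edgeIndices lianaIndices
  congr!

theorem Graph.kronecker_out {R : Type} (γ : Graph R) (i : γ.N → Fin d) :
    kronecker γ.out i i = ∏ v, if i v = i (γ.S v) then 1 else 0 := by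
  refine Finset.prod_congr rfl fun v _ => ?_
  have : Sum.elim (fun _ => i v) i (γ.out v) = i (γ.S v) := by
    unfold Graph.S
    rcases γ.out v with a | a <;> rfl
  congr!

/-- The elementary differential of a forest is its value times the numerical prefactor. -/
theorem Forest.F_eq (σ : ℝ) (φ : E d → ℝ) (x : E d) (γ : Forest) :
    Forest.F σ f g φ x γ =
      σ ^ Graph.weight γ * (‖g x‖ ^ 2) ^ (-(Graph.Ng γ : ℝ) / 2) * γ.val f g φ 0 x := by
  unfold Forest.F Forest.val rawVal Graph.weight
  congr 1
  refine Finset.sum_congr rfl fun i _ => Finset.sum_congr rfl fun j _ => ?_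
  rw [Finset.prod_mul_distrib, mul_assoc]
  simp only [Pi.zero_apply, add_zero, Finset.univ_unique, Finset.prod_singleton, Graph.indices_eq,
    Graph.kronecker_out]

theorem Forest.val_graft (φ : E d → ℝ) (γ : Forest) (τ : VField) (w : γ.Node)
    (e : (γ.graft τ w).Node → Multiset (Fin d)) (he : ∀ u, e (Sum.inl (Sum.inr u)) = 0) (x : E d) :
    Forest.val f g φ (γ.graft τ w) e x =
      ∑ k, γ.val f g φ (fun u => e (γ.graftNode τ w u) + mark w k u) x * τ.val f g 0 k x :=
  rawVal_graft f g _ _ _ _ _ _ _ _ _ _ he x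

theorem Forest.val_graft_zero (φ : E d → ℝ) (γ : Forest) (τ : VField) (w : γ.Node) (x : E d) :
    Forest.val f g φ (γ.graft τ w) 0 x =
      ∑ k, γ.val f g φ (mark w k) x * τ.val f g 0 k x := by
  rw [Forest.val_graft f g φ γ τ w 0 fun _ => rfl]
  simp only [Pi.zero_apply, zero_add]

theorem Forest.val_graft_mark (φ : E d → ℝ) (γ : Forest) (τ : VField) (v w : γ.Node) (k : Fin d)
    (x : E d) :
    Forest.val f g φ (γ.graft τ w) (mark (γ.graftNode τ w v) k) x =
      ∑ l, γ.val f g φ (fun u => mark v k u + mark w l u) x * τ.val f g 0 l x := by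
  have hinj : Function.Injective (γ.graftNode τ w) :=
    Sum.map_injective.2 ⟨Sum.inl_injective, Function.injective_id⟩
  rw [Forest.val_graft f g φ γ τ w]
  · simp only [mark_apply_of_injective hinj]
  · intro u
    refine mark_of_ne ?_ k
    rcases v with v | v
    · exact fun h => Sum.inr_ne_inl (Sum.inl_injective h)
    · exact Sum.inl_ne_inr

theorem VField.val_graft_zero (τ κ : VField) (w : τ.graph.Node) (k : Fin d) (x : E d) :
    (τ.graft κ w).val f g 0 k x = ∑ l, τ.val f g (mark w l) k x * κ.val f g 0 l x := by
  refine (rawVal_graft f g _ _ _ _ _ _ _ _ _ 0 (fun _ => rfl) x).trans ?_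
  simp only [Pi.zero_apply, zero_add]
  rfl

theorem VField.val_scal (τ : VField) (c : Colour) (x : E d) :
    (τ.scal c).val f g x = ∑ k, τ.val f g 0 k x * fieldOf f g c x k :=
  rawVal_scal f g _ _ _ _ _ _ x

theorem VField.val_loop (τ : VField) (w : τ.graph.Node) (x : E d) :
    (τ.loop w).val f g x = ∑ k, τ.val f g (mark w k) k x :=
  rawVal_loop f g _ _ _ _ _ _ x

theorem Forest.val_mul (φ : E d → ℝ) (a : Aroma) (γ : Forest) (x : E d) :
    Forest.val f g φ (a ⊙ γ) 0 x = a.val f g x * γ.val f g φ 0 x :=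
  rawVal_mul f g _ _ _ _ _ _ _ _ x

theorem Forest.val_addLiana (φ : E d → ℝ) (γ : Forest) (v w : γ.Node) (x : E d) :
    Forest.val f g φ (γ.addLiana v w) 0 x =
      ∑ k, γ.val f g φ (fun u => mark v k u + mark w k u) x :=
  rawVal_addLiana f g _ _ _ _ _ _ x

variable {f g}

theorem Forest.contDiff_val (hf : ContDiff ℝ ∞ f) (hg : ContDiff ℝ ∞ g) {φ : E d → ℝ}
    (hφ : ContDiff ℝ ∞ φ) (γ : Forest) (e : γ.Node → Multiset (Fin d)) :
    ContDiff ℝ ∞ (γ.val f g φ e) :=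
  contDiff_rawVal _ _ _ _ hf hg fun _ => hφ

theorem VField.contDiff_val (hf : ContDiff ℝ ∞ f) (hg : ContDiff ℝ ∞ g) (τ : VField)
    (e : τ.graph.Node → Multiset (Fin d)) (k : Fin d) : ContDiff ℝ ∞ (τ.val f g e k) :=
  contDiff_rawVal _ _ _ _ hf hg fun _ => contDiff_fieldOf hf hg _ _

theorem Forest.partialD_val (hf : ContDiff ℝ ∞ f) (hg : ContDiff ℝ ∞ g) {φ : E d → ℝ}
    (hφ : ContDiff ℝ ∞ φ) (γ : Forest) (e : γ.Node → Multiset (Fin d)) (k : Fin d) (x : E d) :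
    ∑ w, γ.val f g φ (fun u => e u + mark w k u) x = partialD k (γ.val f g φ e) x :=
  (partialD_rawVal _ _ _ _ hf hg (fun _ => hφ) k x).symm

theorem Forest.partialD_val_zero (hf : ContDiff ℝ ∞ f) (hg : ContDiff ℝ ∞ g) {φ : E d → ℝ}
    (hφ : ContDiff ℝ ∞ φ) (γ : Forest) (k : Fin d) (x : E d) :
    ∑ w, γ.val f g φ (mark w k) x = partialD k (γ.val f g φ 0) x := by
  rw [← γ.partialD_val hf hg hφ]
  simp only [Pi.zero_apply, zero_add]

theorem VField.partialD_val_zero (hf : ContDiff ℝ ∞ f) (hg : ContDiff ℝ ∞ g) (τ : VField)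
    (l k : Fin d) (x : E d) :
    ∑ w, τ.val f g (mark w l) k x = partialD l (τ.val f g 0 k) x := by
  refine Eq.trans ?_ (partialD_rawVal _ _ _ _ hf hg
    (fun _ => contDiff_fieldOf hf hg τ.rootColour k) l x).symm
  simp only [Pi.zero_apply, zero_add]
  rfl

/-- The value of a graph reduced to its root. -/
theorem rawVal_isolated (f g : E d → E d) (colour : Empty → Colour)
    (out : Empty → (Empty ⊕ Unit) ⊕ Empty) (lia : Empty → Sym2 (Empty ⊕ Unit))
    (Φ : Unit → E d → ℝ) (e : Empty ⊕ Unit → Multiset (Fin d)) (x : E d) :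
    rawVal f g colour out lia Φ e x = iterD (e (Sum.inr ())) (Φ ()) x := by
  unfold rawVal
  rw [sum_arrow_empty, sum_arrow_empty]
  simp [kronecker_empty, edgeIndices_empty, lianaIndices_empty]

theorem dot_val (c : Colour) (k : Fin d) (x : E d) : (dot c).val f g 0 k x = fieldOf f g c x k := by
  refine (rawVal_isolated f g (dot c).graph.colour _ _ _ _ x).trans ?_
  exact congrFun (iterD_zero _) x

/-! ### The sums of forests in the rules, in terms of components -/

section Rules

variable (hf : ContDiff ℝ ∞ f) (hg : ContDiff ℝ ∞ g) {φ : E d → ℝ} (hφ : ContDiff ℝ ∞ φ)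
include hf hg

/-- Grafting `g` to all the nodes of `τ` gives the derivative of the field `T` in the direction
`g`. -/
theorem VField.val_graft_white (τ : VField) (k : Fin d) (x : E d) :
    ∑ w, (τ.graft white w).val f g 0 k x = ∑ l, partialD l (τ.val f g 0 k) x * g x l := by
  simp only [VField.val_graft_zero, ← τ.partialD_val_zero hf hg, Finset.sum_mul]
  rw [Finset.sum_comm]
  simp only [dot_val, fieldOf]

theorem VField.val_underWhite (τ : VField) (k : Fin d) (x : E d) :
    τ.underWhite.val f g 0 k x = ∑ l, partialD l (fun y => g y k) x * τ.val f g 0 l x := by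
  refine (VField.val_graft_zero f g _ _ _ _ _).trans (Finset.sum_congr rfl fun l _ => ?_)
  have h1 : white.val f g 0 k = fun y => g y k := by
    funext y
    rw [dot_val, fieldOf]
  have h2 := white.partialD_val_zero hf hg l k x
  rw [h1, Fintype.sum_sum_type] at h2
  have h3 : IsEmpty (white.graph.N) := inferInstanceAs (IsEmpty Empty)
  simp only [Finset.univ_eq_empty, Finset.sum_empty, zero_add] at h2
  rw [← h2]
  simp

theorem VField.sum_val_loop (τ : VField) (x : E d) :
    ∑ w, (τ.loop w).val f g x = ∑ k, partialD k (τ.val f g 0 k) x := by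
  simp only [VField.val_loop, ← τ.partialD_val_zero hf hg]
  rw [Finset.sum_comm]

theorem aromaDivG_val (x : E d) :
    aromaDivG.val f g x = ∑ k, partialD k (fun y => g y k) x := by
  have h := white.sum_val_loop hf hg x
  rw [Fintype.sum_sum_type] at h
  have h3 : IsEmpty (white.graph.N) := inferInstanceAs (IsEmpty Empty)
  simp only [Finset.univ_eq_empty, Finset.sum_empty, zero_add] at h
  have h1 (k : Fin d) : white.val f g 0 k = fun y => g y k := by
    funext y
    rw [dot_val, fieldOf]
  simp only [h1] at h
  rw [← h]
  simp

include hφ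

/-- Grafting `τ` to all the nodes of `γ` gives the derivative of the function in the direction of
the vector field. -/
theorem Forest.sum_val_graft (γ : Forest) (τ : VField) (x : E d) :
    ∑ w, Forest.val f g φ (γ.graft τ w) 0 x =
      ∑ k, partialD k (γ.val f g φ 0) x * τ.val f g 0 k x := by
  simp only [Forest.val_graft_zero, ← γ.partialD_val_zero hf hg hφ, Finset.sum_mul]
  rw [Finset.sum_comm]

/-- Adding a liana between `v` and all the nodes gives the divergence of the vector field obtained
by differentiating at `v`. -/
theorem Forest.sum_val_addLiana (γ : Forest) (v : γ.Node) (x : E d) :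
    ∑ w, Forest.val f g φ (γ.addLiana v w) 0 x = ∑ k, partialD k (γ.val f g φ (mark v k)) x := by
  simp only [Forest.val_addLiana, ← γ.partialD_val hf hg hφ]
  rw [Finset.sum_comm]

/-- The counterpart of `Forest.sum_val_addLiana` in the normal direction. -/
theorem Forest.sum_val_graft_graft (γ : Forest) (v : γ.Node) (x : E d) :
    ∑ w, Forest.val f g φ ((γ.graft white w).graft white (γ.graftNode white w v)) 0 x =
      ∑ k, (∑ l, partialD l (γ.val f g φ (mark v k)) x * g x l) * g x k := by
  simp only [Forest.val_graft_zero, Forest.val_graft_mark, ← γ.partialD_val hf hg hφ,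
    Finset.sum_mul, dot_val, fieldOf]
  rw [Finset.sum_comm]
  refine Finset.sum_congr rfl fun k _ => ?_
  rw [Finset.sum_comm]

end Rules

end GraphValues

/-! ### Deleting the forests with white nodes -/

section DropWhite

theorem dropWhite_cls (γ : Forest) : dropWhite (cls γ) = if γ.Ng = 0 then cls γ else 0 := by
  unfold dropWhite cls
  split_ifs with h
  · exact Finsupp.filter_single_of_pos (fun γ : EAT => γ.Ng = 0) h
  · exact Finsupp.filter_single_of_neg (fun γ : EAT => γ.Ng = 0) h

theorem dropWhite_add (u v : Span) : dropWhite (u + v) = dropWhite u + dropWhite v :=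
  Finsupp.filter_add

theorem dropWhite_sub (u v : Span) : dropWhite (u - v) = dropWhite u - dropWhite v :=
  Finsupp.filter_sub _ _ _

theorem dropWhite_neg (u : Span) : dropWhite (-u) = -dropWhite u :=
  Finsupp.filter_neg _ _

theorem dropWhite_smul (c : ℝ) (u : Span) : dropWhite (c • u) = c • dropWhite u :=
  Finsupp.filter_smul

theorem dropWhite_sum {ι : Type*} (s : Finset ι) (u : ι → Span) :
    dropWhite (∑ i ∈ s, u i) = ∑ i ∈ s, dropWhite (u i) :=
  (Finsupp.filter_sum _ _)

theorem dropWhite_edgeLHS {γ : Forest} {τ : VField} (hγ : γ.Ng = 0) (hτ : τ.Ng = 0) :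
    dropWhite (edgeLHS γ τ) = euclideanEdgeLHS γ τ := by
  simp [-Fintype.sum_sum_type, edgeLHS, euclideanEdgeLHS,
    dropWhite_sub, dropWhite_sum, dropWhite_cls, Graph.Ng_graft,
    Aroma.Ng_mul, VField.Ng_scal, hγ, hτ, Colour.whiteness_white]

theorem dropWhite_edgeRHS {γ : Forest} {τ : VField} (hγ : γ.Ng = 0) (hτ : τ.Ng = 0) :
    dropWhite (edgeRHS γ τ) = euclideanEdgeRHS γ τ := by
  simp [-Fintype.sum_sum_type, edgeRHS, euclideanEdgeRHS,
    dropWhite_add, dropWhite_sub, dropWhite_smul, dropWhite_sum,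
    dropWhite_cls, Aroma.Ng_mul, VField.Ng_scal, VField.Ng_loop, hγ, hτ, Colour.whiteness_white,
    Colour.whiteness_black]

theorem dropWhite_lianaLHS {γ : Forest} (v : γ.Node) (hγ : γ.Ng = 0) :
    dropWhite (lianaLHS γ v) = euclideanLianaLHS γ v := by
  simp [-Fintype.sum_sum_type, lianaLHS, euclideanLianaLHS,
    dropWhite_sub, dropWhite_sum, dropWhite_cls, Graph.Ng_graft,
    Graph.Ng_addLiana, dot_Ng, hγ, Colour.whiteness_white]

theorem dropWhite_lianaRHS {γ : Forest} (v : γ.Node) (hγ : γ.Ng = 0) :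
    dropWhite (lianaRHS γ v) = euclideanLianaRHS γ v := by
  simp [-Fintype.sum_sum_type, lianaRHS, euclideanLianaRHS,
    dropWhite_add, dropWhite_sub, dropWhite_neg, dropWhite_smul,
    dropWhite_cls, Aroma.Ng_mul, VField.Ng_scal, VField.Ng_loop, Graph.Ng_graft, dot_Ng, hγ,
    Colour.whiteness_white, Colour.whiteness_black]

end DropWhite

section Hypersurface

open Set Filter Topology
open scoped NNReal ENNReal

/-! ### Lipschitz charts and Hausdorff measures -/

section LipschitzCharts

variable {X Y : Type*} [MetricSpace X] [MeasurableSpace X] [BorelSpace X]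
  [MetricSpace Y] [MeasurableSpace Y] [BorelSpace Y]

theorem euclideanHausdorffMeasure_image_le {K : ℝ≥0} {h : X → Y} {s : Set X}
    (hh : LipschitzOnWith K h s) (k : ℕ) : μHE[k] (h '' s) ≤ (K : ℝ≥0∞) ^ k * μHE[k] s := by
  rw [Measure.euclideanHausdorffMeasure_def, Measure.euclideanHausdorffMeasure_def,
    Measure.smul_apply, Measure.smul_apply, ENNReal.smul_def, ENNReal.smul_def, smul_eq_mul,
    smul_eq_mul, mul_left_comm]
  gcongr
  simpa using hh.hausdorffMeasure_image_le (d := k) (Nat.cast_nonneg k)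

/-- If the inverse of a chart is `K`-Lipschitz, integrals against the `k`-dimensional Hausdorff
measure increase at most by the factor `K ^ k` when they are computed in the chart. -/
theorem setLIntegral_le_of_lipschitzOn_symm (Φ : OpenPartialHomeomorph X Y) {K : ℝ≥0}
    (hK : LipschitzOnWith K Φ.symm Φ.target) {A : Set X} {B : Set Y}
    (hAB : ∀ x ∈ Φ.source, x ∈ A ↔ Φ x ∈ B) (hA : MeasurableSet A) (k : ℕ)
    {v : X → ℝ≥0∞} {w : Y → ℝ≥0∞} (hw : Measurable w)
    (hv0 : ∀ x ∉ Φ.source, v x = 0) (hvw : ∀ x ∈ Φ.source, v x = w (Φ x)) :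
    ∫⁻ x in A, v x ∂μHE[k] ≤ (K : ℝ≥0∞) ^ k * ∫⁻ y in B, w y ∂μHE[k] := by
  have hs : MeasurableSet Φ.source := Φ.open_source.measurableSet
  have ht : MeasurableSet Φ.target := Φ.open_target.measurableSet
  have hm : AEMeasurable Φ ((μHE[k] : Measure X).restrict (Φ.source ∩ A)) :=
    (Φ.continuousOn.aemeasurable hs).mono_measure (Measure.restrict_mono inter_subset_left le_rfl)
  have hle : ((μHE[k] : Measure X).restrict (Φ.source ∩ A)).map Φ ≤
      ((K : ℝ≥0∞) ^ k) • (μHE[k] : Measure Y).restrict B := by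
    refine Measure.le_iff.2 fun s hs' => ?_
    rw [Measure.map_apply_of_aemeasurable hm hs', Measure.smul_apply, smul_eq_mul,
      Measure.restrict_apply' (hs.inter hA), Measure.restrict_apply hs']
    have hsub : Φ ⁻¹' s ∩ (Φ.source ∩ A) ⊆ Φ.symm '' (s ∩ B ∩ Φ.target) := by
      rintro x ⟨hx, hxs, hxA⟩
      exact ⟨Φ x, ⟨⟨hx, (hAB x hxs).1 hxA⟩, Φ.map_source hxs⟩, Φ.left_inv hxs⟩
    refine (measure_mono hsub).trans ((euclideanHausdorffMeasure_image_le
      (hK.mono inter_subset_right) k).trans ?_)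
    exact mul_le_mul_right (measure_mono inter_subset_left) _
  calc ∫⁻ x in A, v x ∂μHE[k] = ∫⁻ x in Φ.source ∩ A, v x ∂μHE[k] := by
        rw [← lintegral_indicator hA, ← lintegral_indicator (hs.inter hA)]
        congr 1
        funext x
        by_cases hx : x ∈ Φ.source
        · by_cases hxA : x ∈ A <;> simp [hx, hxA]
        · by_cases hxA : x ∈ A <;> simp [hx, hxA, hv0 x hx]
    _ = ∫⁻ x in Φ.source ∩ A, w (Φ x) ∂μHE[k] :=
        setLIntegral_congr_fun (hs.inter hA) fun x hx => hvw x hx.1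
    _ = ∫⁻ y, w y ∂((μHE[k] : Measure X).restrict (Φ.source ∩ A)).map Φ :=
        (lintegral_map' hw.aemeasurable hm).symm
    _ ≤ ∫⁻ y, w y ∂(((K : ℝ≥0∞) ^ k) • (μHE[k] : Measure Y).restrict B) :=
        lintegral_mono' hle le_rfl
    _ = _ := lintegral_smul_measure _ _

end LipschitzCharts

/-! ### Thin layers around a hyperplane -/

section Flattening

variable {m : ℕ}

/-- The point of `ℝ^(m+1)` with first coordinate `t` and other coordinates `y`. -/
def consE (t : ℝ) (y : E m) : E (m + 1) := WithLp.toLp 2 (Fin.cons t y.ofLp)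

theorem continuous_consE : Continuous fun p : ℝ × E m => consE p.1 p.2 := by
  refine (PiLp.continuous_toLp 2 _).comp (continuous_pi fun i => ?_)
  refine Fin.cases ?_ (fun j => ?_) i
  · exact continuous_fst
  · simp only [Fin.cons_succ]
    fun_prop

theorem consE_zero (t : ℝ) (y : E m) : (consE t y) 0 = t := rfl

theorem measurePreserving_consE :
    MeasurePreserving (fun p : ℝ × E m => consE p.1 p.2) (volume.prod volume) volume := by
  have h := (PiLp.volume_preserving_toLp (Fin (m + 1))).comp
    ((volume_preserving_piFinSuccAbove (fun _ : Fin (m + 1) => ℝ) 0).symm.comp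
      ((MeasurePreserving.id (volume : Measure ℝ)).prod (PiLp.volume_preserving_ofLp (Fin m))))
  have heq : (fun p : ℝ × E m => consE p.1 p.2) = WithLp.toLp 2 ∘
      ⇑(MeasurableEquiv.piFinSuccAbove (fun _ : Fin (m + 1) => ℝ) 0).symm ∘
        Prod.map id WithLp.ofLp := by
    funext p
    simp only [consE, Function.comp, Prod.map, MeasurableEquiv.piFinSuccAbove_symm_apply, id,
      Fin.insertNthEquiv_zero]
    rfl
  rw [heq]
  exact h

theorem isometry_consE_zero : Isometry (consE (m := m) 0) := by
  refine Isometry.of_dist_eq fun y z => ?_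
  rw [EuclideanSpace.dist_eq, EuclideanSpace.dist_eq, Fin.sum_univ_succ]
  simp [consE]

theorem norm_le_norm_consE (t : ℝ) (y : E m) : ‖y‖ ≤ ‖consE t y‖ := by
  rw [EuclideanSpace.norm_eq, EuclideanSpace.norm_eq, Fin.sum_univ_succ]
  refine Real.sqrt_le_sqrt ?_
  simp only [consE, Fin.cons_succ]
  exact le_add_of_nonneg_left (by positivity)

theorem range_consE_zero : range (consE (m := m) 0) = {z | z 0 = 0} := by
  ext z
  constructor
  · rintro ⟨y, rfl⟩
    rfl
  · intro hz
    refine ⟨WithLp.toLp 2 (Fin.tail z.ofLp), ?_⟩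
    ext i
    refine Fin.cases ?_ (fun j => ?_) i
    · exact hz.symm
    · rfl

theorem setLIntegral_hyperplane (w : E (m + 1) → ℝ≥0∞) (hw : Measurable w) :
    ∫⁻ z in {z | z 0 = 0}, w z ∂μHE[m] = ∫⁻ y : E m, w (consE 0 y) := by
  rw [← range_consE_zero, ← isometry_consE_zero.map_euclideanHausdorffMeasure,
    lintegral_map hw isometry_consE_zero.continuous.measurable,
    EuclideanSpace.euclideanHausdorffMeasure_eq_volume]

end Flattening

/-- A sequence of smooth bump functions on the line, of integral `1`, whose supports shrink to `0`.
-/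
def bump (n : ℕ) : ContDiffBump (0 : ℝ) where
  rIn := 1 / (2 * (n + 1))
  rOut := 1 / (n + 1)
  rIn_pos := by positivity
  rIn_lt_rOut := by
    apply one_div_lt_one_div_of_lt <;> nlinarith [(Nat.cast_nonneg n : (0 : ℝ) ≤ n)]

/-- Approximation of the Dirac mass at `0`. -/
def approxDirac (n : ℕ) : ℝ → ℝ := (bump n).normed volume

theorem contDiff_approxDirac (n : ℕ) : ContDiff ℝ ∞ (approxDirac n) := (bump n).contDiff_normed

theorem approxDirac_nonneg (n : ℕ) (t : ℝ) : 0 ≤ approxDirac n t := (bump n).nonneg_normed t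

theorem approxDirac_eq_zero {n : ℕ} {t : ℝ} (h : 1 / (n + 1 : ℝ) ≤ |t|) : approxDirac n t = 0 := by
  have h1 : t ∉ Function.support (approxDirac n) := by
    unfold approxDirac
    rw [(bump n).support_normed_eq]
    simpa [bump] using h
  simpa using h1

theorem tendsto_integral_approxDirac {G : ℝ → ℝ} (hG : Continuous G) :
    Tendsto (fun n => ∫ t, approxDirac n t * G t) atTop (𝓝 (G 0)) := by
  have h := ContDiffBump.convolution_tendsto_right_of_continuous (μ := volume) (φ := bump)
    (l := atTop) (g := fun t => G (-t)) tendsto_one_div_add_atTop_nhds_zero_nat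
    (by fun_prop) 0
  simpa [convolution_def, approxDirac] using h

/-- Integrals against an approximation of the Dirac mass in the first coordinate converge to
integrals on a hyperplane. -/
theorem tendsto_lintegral_approxDirac_hyperplane {m : ℕ} {q : E (m + 1) → ℝ} (hq : Continuous q)
    (hqc : HasCompactSupport q) (hq0 : ∀ z, 0 ≤ q z) {a : ℝ} (ha : 0 < a) :
    Tendsto (fun n => ∫⁻ z, ENNReal.ofReal (approxDirac n (a * z 0) * q z)) atTop
      (𝓝 (ENNReal.ofReal a⁻¹ * ∫⁻ z in {z | z 0 = 0}, ENNReal.ofReal (q z) ∂μHE[m])) := by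
  have hQc (t : ℝ) : Continuous fun y : E m => q (consE t y) :=
    hq.comp (continuous_consE.comp (continuous_const.prodMk continuous_id))
  obtain ⟨r, hr⟩ : ∃ r, ∀ z, r < ‖z‖ → q z = 0 := by
    obtain ⟨r, hr⟩ := hqc.isCompact.isBounded.exists_norm_le
    exact ⟨r, fun z hz => image_eq_zero_of_notMem_tsupport fun h => (hr z h).not_gt hz⟩
  have hQs (t : ℝ) : HasCompactSupport fun y : E m => q (consE t y) := by
    refine HasCompactSupport.intro (isCompact_closedBall 0 r) fun y hy => hr _ ?_
    have : r < ‖y‖ := by simpa using hy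
    exact this.trans_le (norm_le_norm_consE t y)
  -- the integrals over the hyperplanes `z 0 = t` depend continuously on `t`
  have hQ : Continuous fun t => ∫ y : E m, q (consE t y) := by
    have h1 : ∀ t, ∫ y : E m, q (consE t y) =
        ∫ y in Metric.closedBall (0 : E m) r, q (consE t y) := by
      intro t
      refine (setIntegral_eq_integral_of_forall_compl_eq_zero fun y hy => hr _ ?_).symm
      have : r < ‖y‖ := by simpa using hy
      exact this.trans_le (norm_le_norm_consE t y)
    simp_rw [h1]
    exact continuous_parametric_integral_of_continuous (f := fun t (y : E m) => q (consE t y))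
      (hq.comp continuous_consE) (isCompact_closedBall 0 r)
  have hint (n : ℕ) : ∫⁻ z, ENNReal.ofReal (approxDirac n (a * z 0) * q z) =
      ENNReal.ofReal (∫ t, approxDirac n t * (a⁻¹ * ∫ y : E m, q (consE (a⁻¹ * t) y))) := by
    have hc : Continuous fun z : E (m + 1) => approxDirac n (a * z 0) * q z :=
      ((contDiff_approxDirac n).continuous.comp (by fun_prop)).mul hq
    have hi : Integrable fun z : E (m + 1) => approxDirac n (a * z 0) * q z :=
      hc.integrable_of_hasCompactSupport hqc.mul_left
    rw [← ofReal_integral_eq_lintegral_ofReal hi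
      (Eventually.of_forall fun z => mul_nonneg (approxDirac_nonneg n _) (hq0 z))]
    congr 1
    have hi' := (measurePreserving_consE (m := m)).integrable_comp_of_integrable hi
    rw [← (measurePreserving_consE (m := m)).map_eq, integral_map continuous_consE.aemeasurable
      (by rw [(measurePreserving_consE (m := m)).map_eq]; exact hi.aestronglyMeasurable)]
    refine (integral_prod _ hi').trans ?_
    simp only [Function.comp, consE_zero, integral_const_mul]
    have := Measure.integral_comp_mul_left
      (fun t => approxDirac n t * (a⁻¹ * ∫ y : E m, q (consE (a⁻¹ * t) y))) a
    simp only [inv_mul_cancel_left₀ ha.ne'] at this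
    rw [abs_of_pos (inv_pos.2 ha), smul_eq_mul] at this
    simp_rw [mul_left_comm _ a⁻¹, integral_const_mul] at this ⊢
    exact mul_left_cancel₀ (inv_ne_zero ha.ne') this
  simp_rw [hint]
  have hlim := ENNReal.tendsto_ofReal (tendsto_integral_approxDirac
    (G := fun t => a⁻¹ * ∫ y : E m, q (consE (a⁻¹ * t) y))
    (continuous_const.mul (hQ.comp (continuous_const.mul continuous_id))))
  convert hlim using 2
  rw [setLIntegral_hyperplane _ (by fun_prop), mul_zero, ENNReal.ofReal_mul (inv_pos.2 ha).le,
    ofReal_integral_eq_lintegral_ofReal ((hQc 0).integrable_of_hasCompactSupport (hQs 0))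
      (Eventually.of_forall fun y => hq0 _)]

/-! ### Charts which almost preserve distances -/

theorem continuous_norm_gradient {m : ℕ} {ζ : E (m + 1) → ℝ} (hζ : ContDiff ℝ ∞ ζ) :
    Continuous fun x => ‖gradient ζ x‖ := by
  unfold gradient
  exact ((InnerProductSpace.toDual ℝ (E (m + 1))).symm.continuous.comp
    (hζ.continuous_fderiv (by simp))).norm

/-- Near a point where its gradient does not vanish, a function becomes, in a chart which distorts
distances as little as one likes, a multiple of the first coordinate. -/
theorem exists_chart {m : ℕ} {ζ : E (m + 1) → ℝ} (hζ : ContDiff ℝ ∞ ζ) {p : E (m + 1)}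
    (hp : gradient ζ p ≠ 0) {K : ℝ≥0} (hK : 1 < K) :
    ∃ Φ : OpenPartialHomeomorph (E (m + 1)) (E (m + 1)), p ∈ Φ.source ∧
      LipschitzOnWith K Φ Φ.source ∧ LipschitzOnWith K Φ.symm Φ.target ∧
      (∀ x ∈ Φ.source, ζ x = ‖gradient ζ p‖ * (Φ x) 0) ∧
      (∀ x ∈ Φ.source, ‖gradient ζ x‖ ≤ K * ‖gradient ζ p‖ ∧
        ‖gradient ζ p‖ ≤ K * ‖gradient ζ x‖) := by
  set a : ℝ := ‖gradient ζ p‖ with ha_def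
  have ha : 0 < a := norm_pos_iff.2 hp
  have hcont := continuous_norm_gradient hζ
  have hK0 : (0 : ℝ) < K := zero_lt_one.trans hK
  -- an isometry which maps the unit normal at `p` to the first basis vector
  obtain ⟨R, hR⟩ : ∃ R : E (m + 1) ≃ₗᵢ[ℝ] E (m + 1),
      ∀ x, (R x) 0 = inner ℝ (a⁻¹ • gradient ζ p) x := by
    set n : E (m + 1) := a⁻¹ • gradient ζ p
    set e₀ : E (m + 1) := EuclideanSpace.single 0 1
    have hn : ‖n‖ = ‖e₀‖ := by
      rw [norm_smul, norm_inv, norm_norm, ← ha_def, inv_mul_cancel₀ ha.ne']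
      simp [e₀]
    refine ⟨Submodule.reflection (ℝ ∙ (n - e₀))ᗮ, fun x => ?_⟩
    rw [← (Submodule.reflection (ℝ ∙ (n - e₀))ᗮ).inner_map_map n x, Submodule.reflection_sub hn]
    simp [e₀, EuclideanSpace.inner_single_left]
  set e₀ : E (m + 1) := EuclideanSpace.single 0 1
  -- the chart is this isometry with its first coordinate replaced by `ζ / a`; its derivative at
  -- `p` is the isometry, as `a` is the norm of the gradient
  let ψ : E (m + 1) → E (m + 1) := fun x => R x + (a⁻¹ * ζ x - (R x) 0) • e₀
  have hder : HasStrictFDerivAt ψ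
      ((R.toContinuousLinearEquiv : E (m + 1) ≃L[ℝ] E (m + 1)) : E (m + 1) →L[ℝ] E (m + 1)) p := by
    have h1 : HasStrictFDerivAt ζ (fderiv ℝ ζ p) p := hζ.contDiffAt.hasStrictFDerivAt (by simp)
    have h2 : HasStrictFDerivAt (fun x => R x) ((R.toContinuousLinearEquiv :
      E (m + 1) ≃L[ℝ] E (m + 1)) : E (m + 1) →L[ℝ] E (m + 1)) p :=
      (R.toContinuousLinearEquiv : E (m + 1) ≃L[ℝ] E (m + 1)).hasStrictFDerivAt
    have h3 : HasStrictFDerivAt (fun x => (R x) 0) (innerSL ℝ (a⁻¹ • gradient ζ p)) p := by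
      simp_rw [hR]
      exact (innerSL ℝ (a⁻¹ • gradient ζ p)).hasStrictFDerivAt
    have h4 := h2.add (((h1.const_mul a⁻¹).sub h3).smul_const e₀)
    refine h4.congr_fderiv ?_
    ext1 x
    simp
  -- a map `c`-close to an isometry multiplies distances by at most `1 + c ≤ K` and by at least
  -- `1 - c = 1 / K`
  set c : ℝ≥0 := 1 - K⁻¹ with hc_def
  have hKi : K⁻¹ < 1 := inv_lt_one_of_one_lt₀ hK
  have hc0 : 0 < c := tsub_pos_of_lt hKi
  have hcr : (c : ℝ) = 1 - (K : ℝ)⁻¹ := by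
    rw [hc_def, NNReal.coe_sub hKi.le]
    simp
  have hc1 : c < 1 := by
    rw [← NNReal.coe_lt_coe, hcr]
    have := inv_pos.2 hK0
    simp only [NNReal.coe_one]
    linarith
  obtain ⟨s, hs, hsa⟩ := hder.approximates_deriv_on_nhds (Or.inr hc0)
  have hnear : {x | ‖gradient ζ x‖ < K * a} ∩ {x | a < K * ‖gradient ζ x‖} ∈ 𝓝 p := by
    have hK1 : (1 : ℝ) < K := hK
    refine (IsOpen.inter (isOpen_lt hcont continuous_const)
      (isOpen_lt continuous_const (continuous_const.mul hcont))).mem_nhds ⟨?_, ?_⟩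
    · change a < K * a
      nlinarith
    · change a < K * a
      nlinarith
  obtain ⟨t, hts, hto, hpt⟩ := mem_nhds_iff.1 (inter_mem hs hnear)
  have hta := hsa.mono_set (hts.trans inter_subset_left)
  have hnorm : c < ‖((R.toContinuousLinearEquiv : E (m + 1) ≃L[ℝ] E (m + 1)).symm :
      E (m + 1) →L[ℝ] E (m + 1))‖₊⁻¹ := by
    have : ‖((R.toContinuousLinearEquiv : E (m + 1) ≃L[ℝ] E (m + 1)).symm :
      E (m + 1) →L[ℝ] E (m + 1))‖₊ = 1 := by
      ext
      exact R.symm.toLinearIsometry.norm_toContinuousLinearMap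
    rw [this, inv_one]
    exact hc1
  have hbound : ∀ x ∈ t, ∀ y ∈ t, dist (ψ x) (ψ y) ≤ K * dist x y ∧
      dist x y ≤ K * dist (ψ x) (ψ y) := by
    intro x hx y hy
    have h1 := hta x hx y hy
    have h2 : ‖R (x - y)‖ = ‖x - y‖ := R.norm_map _
    have h1' : ‖ψ x - ψ y - R (x - y)‖ ≤ c * ‖x - y‖ := h1
    rw [hcr] at h1'
    rw [dist_eq_norm, dist_eq_norm]
    have h3 : ‖ψ x - ψ y‖ ≤ ‖ψ x - ψ y - R (x - y)‖ + ‖R (x - y)‖ := by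
      simpa using norm_add_le (ψ x - ψ y - R (x - y)) (R (x - y))
    have h4 : ‖R (x - y)‖ ≤ ‖ψ x - ψ y‖ + ‖ψ x - ψ y - R (x - y)‖ := by
      simpa using norm_sub_le (ψ x - ψ y) (ψ x - ψ y - R (x - y))
    rw [h2] at h3 h4
    have h5 : (0 : ℝ) ≤ ‖x - y‖ := norm_nonneg _
    have hK1 : (1 : ℝ) < K := hK
    have hKK : (K : ℝ) * (K : ℝ)⁻¹ = 1 := mul_inv_cancel₀ hK0.ne'
    have h6 : 2 - (K : ℝ)⁻¹ ≤ K := by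
      have : 0 ≤ (K : ℝ)⁻¹ * ((K : ℝ) - 1) ^ 2 := by positivity
      nlinarith
    constructor
    · nlinarith
    · have h7 : (K : ℝ)⁻¹ * ‖x - y‖ ≤ ‖ψ x - ψ y‖ := by nlinarith
      calc ‖x - y‖ = K * ((K : ℝ)⁻¹ * ‖x - y‖) := by rw [← mul_assoc, hKK, one_mul]
        _ ≤ _ := by gcongr
  refine ⟨hta.toOpenPartialHomeomorph ψ t (Or.inr hnorm) hto, hpt, ?_, ?_, ?_, ?_⟩
  · exact LipschitzOnWith.of_dist_le_mul fun x hx y hy => (hbound x hx y hy).1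
  · refine LipschitzOnWith.of_dist_le_mul fun x hx y hy => ?_
    set Ψ := hta.toOpenPartialHomeomorph ψ t (Or.inr hnorm) hto
    have h := (hbound _ (Ψ.map_target hx) _ (Ψ.map_target hy)).2
    have hx' : ψ (Ψ.symm x) = x := Ψ.right_inv hx
    have hy' : ψ (Ψ.symm y) = y := Ψ.right_inv hy
    rwa [hx', hy'] at h
  · intro x _
    change ζ x = a * (ψ x) 0
    simp only [ψ, PiLp.add_apply, PiLp.smul_apply, e₀, smul_eq_mul, PiLp.single_apply, if_true,
      mul_one]
    rw [add_sub_cancel, mul_inv_cancel_left₀ ha.ne']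
  · intro x hx
    have := (hts hx).2
    exact ⟨this.1.le, this.2.le⟩

/-! ### The surface measure as a limit of thin layers -/

section ThinLayers

variable {m : ℕ}

/-- The integral of `ψ` over a thin layer around the level set `{ζ = 0}`, smoothed by an approximate
Dirac mass. -/
def layer (ζ : E (m + 1) → ℝ) (n : ℕ) (ψ : E (m + 1) → ℝ) : ℝ≥0∞ :=
  ∫⁻ x, ENNReal.ofReal (approxDirac n (ζ x) * ψ x)

/-- The integral of `ψ / |∇ζ|` over the level set `{ζ = 0}`. -/
def levelIntegral (ζ : E (m + 1) → ℝ) (ψ : E (m + 1) → ℝ) : ℝ≥0∞ :=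
  ∫⁻ x in {x | ζ x = 0}, ENNReal.ofReal (ψ x / ‖gradient ζ x‖) ∂μHE[m]

/-- The function `ψ` read in a chart whose source contains the support of `ψ`. -/
def pushFun (Φ : OpenPartialHomeomorph (E (m + 1)) (E (m + 1))) (ψ : E (m + 1) → ℝ)
    (z : E (m + 1)) : ℝ :=
  Φ.target.indicator (fun z => ψ (Φ.symm z)) z

theorem pushFun_eq_zero (Φ : OpenPartialHomeomorph (E (m + 1)) (E (m + 1))) {ψ : E (m + 1) → ℝ}
    {z : E (m + 1)} (hz : z ∉ Φ '' tsupport ψ) : pushFun Φ ψ z = 0 := by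
  unfold pushFun
  by_cases hzt : z ∈ Φ.target
  · rw [indicator_of_mem hzt]
    exact image_eq_zero_of_notMem_tsupport (f := ψ) fun h => hz ⟨_, h, Φ.right_inv hzt⟩
  · rw [indicator_of_notMem hzt]

theorem continuous_pushFun (Φ : OpenPartialHomeomorph (E (m + 1)) (E (m + 1))) {ψ : E (m + 1) → ℝ}
    (hψ : Continuous ψ) (hc : HasCompactSupport ψ) (hs : tsupport ψ ⊆ Φ.source) :
    Continuous (pushFun Φ ψ) := by
  have hcomp : IsCompact (Φ '' tsupport ψ) :=
    hc.isCompact.image_of_continuousOn (Φ.continuousOn.mono hs)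
  rw [continuous_iff_continuousAt]
  intro z
  by_cases hz : z ∈ Φ.target
  · have : (fun z => ψ (Φ.symm z)) =ᶠ[𝓝 z] pushFun Φ ψ := by
      filter_upwards [Φ.open_target.mem_nhds hz] with y hy
      exact (indicator_of_mem hy (fun z => ψ (Φ.symm z))).symm
    exact (hψ.continuousAt.comp (Φ.continuousAt_symm hz)).congr this
  · have hz' : z ∉ Φ '' tsupport ψ := by
      rintro ⟨x, hx, rfl⟩
      exact hz (Φ.map_source (hs hx))
    have : (fun _ => (0 : ℝ)) =ᶠ[𝓝 z] pushFun Φ ψ := by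
      filter_upwards [hcomp.isClosed.isOpen_compl.mem_nhds hz'] with y hy
      exact (pushFun_eq_zero Φ hy).symm
    exact continuousAt_const.congr this

theorem hasCompactSupport_pushFun (Φ : OpenPartialHomeomorph (E (m + 1)) (E (m + 1)))
    {ψ : E (m + 1) → ℝ} (hc : HasCompactSupport ψ) (hs : tsupport ψ ⊆ Φ.source) :
    HasCompactSupport (pushFun Φ ψ) :=
  HasCompactSupport.intro (hc.isCompact.image_of_continuousOn (Φ.continuousOn.mono hs))
    fun _ hz => pushFun_eq_zero Φ hz

theorem pushFun_apply (Φ : OpenPartialHomeomorph (E (m + 1)) (E (m + 1))) (ψ : E (m + 1) → ℝ)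
    {x : E (m + 1)} (hx : x ∈ Φ.source) : pushFun Φ ψ (Φ x) = ψ x := by
  unfold pushFun
  rw [indicator_of_mem (Φ.map_source hx), Φ.left_inv hx]

theorem pushFun_nonneg (Φ : OpenPartialHomeomorph (E (m + 1)) (E (m + 1))) {ψ : E (m + 1) → ℝ}
    (hψ : ∀ x, 0 ≤ ψ x) (z : E (m + 1)) : 0 ≤ pushFun Φ ψ z :=
  indicator_nonneg (fun _ _ => hψ _) z

/-- The thin layers are comparable, up to the factor `C`, with a sequence `J` whose limit `j` is
comparable, up to the same factor, with the surface integral. -/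
def LayerComparison (ζ : E (m + 1) → ℝ) (C : ℝ≥0∞) (ψ : E (m + 1) → ℝ) : Prop :=
  ∃ (J : ℕ → ℝ≥0∞) (j : ℝ≥0∞), Tendsto J atTop (𝓝 j) ∧
    (∀ n, layer ζ n ψ ≤ C * J n) ∧ (∀ n, J n ≤ C * layer ζ n ψ) ∧
    levelIntegral ζ ψ ≤ C * j ∧ j ≤ C * levelIntegral ζ ψ

/-- Near every point, thin layers compare with the surface measure, up to a factor as close to `1`
as one likes. -/
theorem layer_local {ζ : E (m + 1) → ℝ} (hζ : ContDiff ℝ ∞ ζ)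
    (hreg : ∀ x, ζ x = 0 → gradient ζ x ≠ 0) {K : ℝ≥0} (hK : 1 < K) (p : E (m + 1)) :
    ∃ U : Set (E (m + 1)), IsOpen U ∧ p ∈ U ∧ ∀ ψ : E (m + 1) → ℝ, Continuous ψ →
      HasCompactSupport ψ → (∀ x, 0 ≤ ψ x) → tsupport ψ ⊆ U →
      levelIntegral ζ ψ ≠ ⊤ ∧ LayerComparison ζ ((K : ℝ≥0∞) ^ (m + 1)) ψ := by
  have hK0 : (0 : ℝ) < K := zero_lt_one.trans hK
  by_cases hp : ζ p = 0
  swap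
  -- away from the level set, both sides vanish for thin enough layers
  · refine ⟨{x | ζ x ≠ 0}, isOpen_ne_fun hζ.continuous continuous_const, hp, ?_⟩
    intro ψ hψ hc hψ0 hs
    have h1 : levelIntegral ζ ψ = 0 := by
      unfold levelIntegral
      refine (setLIntegral_congr_fun (g := fun _ => 0)
        (hζ.continuous.measurable (measurableSet_singleton 0)) fun x hx => ?_).trans (by simp)
      have : ψ x = 0 := image_eq_zero_of_notMem_tsupport fun h => hs h hx
      simp [this]
    have h2 : ∀ᶠ n in atTop, layer ζ n ψ = 0 := by
      obtain ⟨δ, hδ, hδ'⟩ : ∃ δ > 0, ∀ x ∈ tsupport ψ, δ ≤ |ζ x| := by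
        rcases (tsupport ψ).eq_empty_or_nonempty with h | h
        · exact ⟨1, one_pos, by simp [h]⟩
        · obtain ⟨x, hx, hmin⟩ := hc.isCompact.exists_isMinOn h hζ.continuous.abs.continuousOn
          exact ⟨|ζ x|, abs_pos.2 (hs hx), fun y hy => hmin hy⟩
      have hlim := tendsto_one_div_add_atTop_nhds_zero_nat (𝕜 := ℝ)
      filter_upwards [hlim.eventually (gt_mem_nhds hδ)] with n hn
      unfold layer
      convert lintegral_zero with x
      by_cases hx : x ∈ tsupport ψ
      · rw [approxDirac_eq_zero (hn.le.trans (hδ' x hx)), zero_mul, ENNReal.ofReal_zero]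
      · rw [image_eq_zero_of_notMem_tsupport hx, mul_zero, ENNReal.ofReal_zero]
    have hK1 : 1 ≤ (K : ℝ≥0∞) ^ (m + 1) := one_le_pow₀ (by exact_mod_cast hK.le)
    refine ⟨by simp [h1], fun n => layer ζ n ψ, 0, tendsto_const_nhds.congr' (EventuallyEq.symm h2),
      fun n => le_mul_of_one_le_left' hK1, fun n => le_mul_of_one_le_left' hK1, by simp [h1],
      by simp [h1]⟩
  obtain ⟨Φ, hpΦ, hL, hLs, hζΦ, hgrad⟩ := exists_chart hζ (hreg p hp) hK
  set a : ℝ := ‖gradient ζ p‖ with ha_def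
  have ha : 0 < a := norm_pos_iff.2 (hreg p hp)
  refine ⟨Φ.source, Φ.open_source, hpΦ, fun ψ hψ hc hψ0 hs => ?_⟩
  set q := pushFun Φ ψ with hq_def
  have hq := continuous_pushFun Φ hψ hc hs
  have hqc := hasCompactSupport_pushFun Φ hc hs
  have hq0 := pushFun_nonneg Φ hψ0
  have hψs : ∀ x ∉ Φ.source, ψ x = 0 := fun x hx =>
    image_eq_zero_of_notMem_tsupport fun h => hx (hs h)
  have hqs : ∀ z ∉ Φ.target, q z = 0 := fun z hz => indicator_of_notMem hz _
  have hqψ : ∀ x ∈ Φ.source, ψ x = q (Φ x) := fun x hx => (pushFun_apply Φ ψ hx).symm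
  have hqψ' : ∀ z ∈ Φ.target, q z = ψ (Φ.symm z) := fun z hz => indicator_of_mem hz _
  have hζΦ' : ∀ z ∈ Φ.target, a * z 0 = ζ (Φ.symm z) := fun z hz => by
    rw [hζΦ _ (Φ.map_target hz), Φ.right_inv hz]
  have hM : MeasurableSet {x | ζ x = 0} := hζ.continuous.measurable (measurableSet_singleton 0)
  have hz0 : Continuous fun z : E (m + 1) => z 0 := by fun_prop
  have hH : MeasurableSet {z : E (m + 1) | z 0 = 0} := hz0.measurable (measurableSet_singleton 0)
  -- comparison on the level set
  set I : ℝ≥0∞ := ∫⁻ z in {z : E (m + 1) | z 0 = 0}, ENNReal.ofReal (q z) ∂μHE[m] with hI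
  set S : ℝ≥0∞ := ∫⁻ x in {x | ζ x = 0}, ENNReal.ofReal (ψ x) ∂μHE[m] with hS
  have hMH : ∀ x ∈ Φ.source, x ∈ {x | ζ x = 0} ↔ Φ x ∈ {z : E (m + 1) | z 0 = 0} := by
    intro x hx
    simp only [mem_ofPred_eq]
    rw [hζΦ x hx, mul_eq_zero, or_iff_right ha.ne']
  have hSI : S ≤ (K : ℝ≥0∞) ^ m * I :=
    setLIntegral_le_of_lipschitzOn_symm Φ hLs hMH hM m (by fun_prop)
      (fun x hx => by simp [hψs x hx]) (fun x hx => by rw [hqψ x hx])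
  have hIS : I ≤ (K : ℝ≥0∞) ^ m * S :=
    setLIntegral_le_of_lipschitzOn_symm Φ.symm (by simpa using hL)
      (fun z hz => by
        have := hMH _ (Φ.map_target hz)
        rw [Φ.right_inv hz] at this
        exact this.symm) hH m (by fun_prop)
      (fun z hz => by simp [hqs z hz]) (fun z hz => by rw [hqψ' z hz])
  -- comparison of the layers
  set J : ℕ → ℝ≥0∞ := fun n => ∫⁻ z, ENNReal.ofReal (approxDirac n (a * z 0) * q z) with hJ
  have hvol : (μHE[m + 1] : Measure (E (m + 1))) = volume :=
    EuclideanSpace.euclideanHausdorffMeasure_eq_volume (m + 1)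
  have hcJ (n : ℕ) : Continuous fun z : E (m + 1) => approxDirac n (a * z 0) * q z :=
    ((contDiff_approxDirac n).continuous.comp (continuous_const.mul hz0)).mul hq
  have hcL (n : ℕ) : Continuous fun x : E (m + 1) => approxDirac n (ζ x) * ψ x :=
    ((contDiff_approxDirac n).continuous.comp hζ.continuous).mul hψ
  have hLJ (n : ℕ) : layer ζ n ψ ≤ (K : ℝ≥0∞) ^ (m + 1) * J n := by
    have := setLIntegral_le_of_lipschitzOn_symm Φ hLs (A := univ) (B := univ) (by simp)
      MeasurableSet.univ (m + 1) (v := fun x => ENNReal.ofReal (approxDirac n (ζ x) * ψ x))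
      (w := fun z => ENNReal.ofReal (approxDirac n (a * z 0) * q z))
      (hcJ n).measurable.ennreal_ofReal (fun x hx => by simp [hψs x hx])
      (fun x hx => by rw [hqψ x hx, hζΦ x hx])
    simpa only [Measure.restrict_univ, hvol, layer, hJ] using this
  have hJL (n : ℕ) : J n ≤ (K : ℝ≥0∞) ^ (m + 1) * layer ζ n ψ := by
    have := setLIntegral_le_of_lipschitzOn_symm Φ.symm (by simpa using hL) (A := univ) (B := univ)
      (by simp) MeasurableSet.univ (m + 1)
      (v := fun z => ENNReal.ofReal (approxDirac n (a * z 0) * q z))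
      (w := fun x => ENNReal.ofReal (approxDirac n (ζ x) * ψ x))
      (hcL n).measurable.ennreal_ofReal (fun x hx => by simp [hqs x hx])
      (fun x hx => by rw [hqψ' x hx, hζΦ' x hx])
    simpa only [Measure.restrict_univ, hvol, layer, hJ] using this
  have hJlim : Tendsto J atTop (𝓝 (ENNReal.ofReal a⁻¹ * I)) :=
    tendsto_lintegral_approxDirac_hyperplane hq hqc hq0 ha
  -- comparison of `|∇ζ|` with its value at `p`
  have hKofReal : (K : ℝ≥0∞) = ENNReal.ofReal K := by simp
  have hTS : levelIntegral ζ ψ ≤ (K : ℝ≥0∞) * (ENNReal.ofReal a⁻¹ * S) := by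
    rw [hS, ← lintegral_const_mul _ (by fun_prop), ← lintegral_const_mul _ (by fun_prop)]
    refine lintegral_mono fun x => ?_
    rw [hKofReal, ← ENNReal.ofReal_mul (by positivity), ← ENNReal.ofReal_mul (by positivity)]
    refine ENNReal.ofReal_le_ofReal ?_
    by_cases hx : x ∈ Φ.source
    · have h1 := (hgrad x hx).2
      have h2 : 0 < ‖gradient ζ x‖ := by
        by_contra h
        have : ‖gradient ζ x‖ = 0 := le_antisymm (not_lt.1 h) (norm_nonneg _)
        rw [this, mul_zero] at h1
        exact ha.not_ge h1
      rw [div_le_iff₀ h2]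
      have h3 := hψ0 x
      calc ψ x = (a⁻¹ * ψ x) * a := by field_simp
        _ ≤ (a⁻¹ * ψ x) * (K * ‖gradient ζ x‖) := by gcongr
        _ = _ := by ring
    · simp [hψs x hx]
  have hST : ENNReal.ofReal a⁻¹ * S ≤ (K : ℝ≥0∞) * levelIntegral ζ ψ := by
    have hmeas : Measurable fun x => ENNReal.ofReal (ψ x / ‖gradient ζ x‖) :=
      (hψ.measurable.div (continuous_norm_gradient hζ).measurable).ennreal_ofReal
    unfold levelIntegral
    rw [hS, ← lintegral_const_mul _ (by fun_prop), ← lintegral_const_mul _ hmeas]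
    refine setLIntegral_mono (hmeas.const_mul _) fun x hxM => ?_
    rw [hKofReal, ← ENNReal.ofReal_mul (by positivity), ← ENNReal.ofReal_mul (by positivity)]
    refine ENNReal.ofReal_le_ofReal ?_
    by_cases hx : x ∈ Φ.source
    · have h1 := (hgrad x hx).1
      have h2 : 0 < ‖gradient ζ x‖ := norm_pos_iff.2 (hreg x hxM)
      rw [mul_div_assoc', le_div_iff₀ h2]
      have h3 := hψ0 x
      calc a⁻¹ * ψ x * ‖gradient ζ x‖ ≤ a⁻¹ * ψ x * (K * a) := by gcongr
        _ = _ := by field_simp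
    · simp [hψs x hx]
  have hIfin : I ≠ ⊤ := by
    rw [hI, setLIntegral_hyperplane _ (by fun_prop)]
    exact ((hq.comp isometry_consE_zero.continuous).integrable_of_hasCompactSupport
      (hqc.comp_isClosedEmbedding isometry_consE_zero.isClosedEmbedding)).lintegral_lt_top.ne
  have hTI : levelIntegral ζ ψ ≤ (K : ℝ≥0∞) ^ (m + 1) * (ENNReal.ofReal a⁻¹ * I) :=
    calc levelIntegral ζ ψ ≤ (K : ℝ≥0∞) * (ENNReal.ofReal a⁻¹ * S) := hTS
      _ ≤ (K : ℝ≥0∞) * (ENNReal.ofReal a⁻¹ * ((K : ℝ≥0∞) ^ m * I)) := by gcongr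
      _ = _ := by ring
  have hIT : ENNReal.ofReal a⁻¹ * I ≤ (K : ℝ≥0∞) ^ (m + 1) * levelIntegral ζ ψ :=
    calc ENNReal.ofReal a⁻¹ * I ≤ ENNReal.ofReal a⁻¹ * ((K : ℝ≥0∞) ^ m * S) := by gcongr
      _ = (K : ℝ≥0∞) ^ m * (ENNReal.ofReal a⁻¹ * S) := by ring
      _ ≤ (K : ℝ≥0∞) ^ m * ((K : ℝ≥0∞) * levelIntegral ζ ψ) := by gcongr
      _ = _ := by ring
  have hpow : (K : ℝ≥0∞) ^ (m + 1) ≠ ⊤ := ENNReal.pow_ne_top ENNReal.coe_ne_top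
  exact ⟨ne_top_of_le_ne_top
    (ENNReal.mul_ne_top hpow (ENNReal.mul_ne_top ENNReal.ofReal_ne_top hIfin)) hTI,
    J, ENNReal.ofReal a⁻¹ * I, hJlim, hLJ, hJL, hTI, hIT⟩

end ThinLayers

section LayerLimit

variable {m : ℕ}

theorem continuous_layer {ζ ψ : E (m + 1) → ℝ} (hζ : ContDiff ℝ ∞ ζ) (hψ : Continuous ψ) (n : ℕ) :
    Continuous fun x => approxDirac n (ζ x) * ψ x :=
  ((contDiff_approxDirac n).continuous.comp hζ.continuous).mul hψ

theorem layer_sum {ι : Type*} (s : Finset ι) {ζ : E (m + 1) → ℝ} (hζ : ContDiff ℝ ∞ ζ)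
    {ψ : ι → E (m + 1) → ℝ} (hψ : ∀ i, Continuous (ψ i)) (h0 : ∀ i x, 0 ≤ ψ i x) (n : ℕ) :
    layer ζ n (fun x => ∑ i ∈ s, ψ i x) = ∑ i ∈ s, layer ζ n (ψ i) := by
  unfold layer
  rw [← lintegral_finsetSum _ fun i _ => (continuous_layer hζ (hψ i) n).measurable.ennreal_ofReal]
  refine lintegral_congr fun x => ?_
  rw [Finset.mul_sum, ENNReal.ofReal_sum_of_nonneg]
  exact fun i _ => mul_nonneg (approxDirac_nonneg n _) (h0 i x)

theorem measurable_levelIntegrand {ζ ψ : E (m + 1) → ℝ} (hζ : ContDiff ℝ ∞ ζ) (hψ : Continuous ψ) :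
    Measurable fun x => ψ x / ‖gradient ζ x‖ :=
  hψ.measurable.div (continuous_norm_gradient hζ).measurable

theorem levelIntegral_sum {ι : Type*} (s : Finset ι) {ζ : E (m + 1) → ℝ} (hζ : ContDiff ℝ ∞ ζ)
    {ψ : ι → E (m + 1) → ℝ} (hψ : ∀ i, Continuous (ψ i)) (h0 : ∀ i x, 0 ≤ ψ i x) :
    levelIntegral ζ (fun x => ∑ i ∈ s, ψ i x) = ∑ i ∈ s, levelIntegral ζ (ψ i) := by
  unfold levelIntegral
  rw [← lintegral_finsetSum _ fun i _ => (measurable_levelIntegrand hζ (hψ i)).ennreal_ofReal]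
  refine lintegral_congr fun x => ?_
  rw [Finset.sum_div, ENNReal.ofReal_sum_of_nonneg]
  exact fun i _ => div_nonneg (h0 i x) (norm_nonneg _)

/-- The comparison of thin layers with the surface measure, globalised by a partition of unity. -/
theorem layer_global {ζ ψ : E (m + 1) → ℝ} (hζ : ContDiff ℝ ∞ ζ)
    (hreg : ∀ x, ζ x = 0 → gradient ζ x ≠ 0) (hψ : Continuous ψ) (hc : HasCompactSupport ψ)
    (h0 : ∀ x, 0 ≤ ψ x) {K : ℝ≥0} (hK : 1 < K) :
    levelIntegral ζ ψ ≠ ⊤ ∧ LayerComparison ζ ((K : ℝ≥0∞) ^ (m + 1)) ψ := by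
  choose U hUo hpU hU using fun p => layer_local hζ hreg hK p
  obtain ⟨t, ht⟩ := hc.isCompact.elim_finite_subcover U hUo
    fun x _ => mem_iUnion.2 ⟨x, hpU x⟩
  let e := t.equivFin
  have hcov : tsupport ψ ⊆ ⋃ i, U (e.symm i : E (m + 1)) := by
    intro x hx
    obtain ⟨p, hp, hxp⟩ := mem_iUnion₂.1 (ht hx)
    exact mem_iUnion.2 ⟨e ⟨p, hp⟩, by simpa using hxp⟩
  obtain ⟨χ, hχs, hχ1, hχ, -⟩ := exists_continuous_sum_one_of_isOpen_isCompact
    (fun i => hUo (e.symm i : E (m + 1))) hc.isCompact hcov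
  set q : Fin t.card → E (m + 1) → ℝ := fun i x => χ i x * ψ x with hq
  have hqc (i) : Continuous (q i) := (χ i).continuous.mul hψ
  have hq0 (i) (x) : 0 ≤ q i x := mul_nonneg (hχ i x).1 (h0 x)
  have hsum : ψ = fun x => ∑ i, q i x := by
    funext x
    rw [← Finset.sum_mul]
    by_cases hx : x ∈ tsupport ψ
    · have := hχ1 hx
      simp only [Finset.sum_apply, Pi.one_apply] at this
      rw [this, one_mul]
    · rw [image_eq_zero_of_notMem_tsupport hx, mul_zero]
  have hloc (i) := hU (e.symm i : E (m + 1)) (q i) (hqc i) (hc.mul_left) (hq0 i)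
    ((tsupport_mul_subset_left).trans (hχs i))
  choose hfin J j hJ h1 h2 h3 h4 using hloc
  rw [hsum]
  refine ⟨?_, fun n => ∑ i, J i n, ∑ i, j i, tendsto_finsetSum _ fun i _ => hJ i, fun n => ?_,
    fun n => ?_, ?_, ?_⟩
  all_goals
    simp only [layer_sum _ hζ hqc hq0, levelIntegral_sum _ hζ hqc hq0]
  · exact ENNReal.sum_ne_top.2 fun i _ => hfin i
  all_goals rw [Finset.mul_sum]
  · exact Finset.sum_le_sum fun i _ => h1 i n
  · exact Finset.sum_le_sum fun i _ => h2 i n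
  · exact Finset.sum_le_sum fun i _ => h3 i
  · exact Finset.sum_le_sum fun i _ => h4 i

/-- The special case of the coarea formula used below: thin layers converge to the surface measure
with density `1 / |∇ζ|`. -/
theorem tendsto_layer {ζ ψ : E (m + 1) → ℝ} (hζ : ContDiff ℝ ∞ ζ)
    (hreg : ∀ x, ζ x = 0 → gradient ζ x ≠ 0) (hψ : Continuous ψ) (hc : HasCompactSupport ψ)
    (h0 : ∀ x, 0 ≤ ψ x) :
    levelIntegral ζ ψ ≠ ⊤ ∧ Tendsto (fun n => layer ζ n ψ) atTop (𝓝 (levelIntegral ζ ψ)) := by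
  have hglob (k : ℕ) := layer_global hζ hreg hψ hc h0 (K := 1 + 1 / ((k : ℝ≥0) + 1))
    (lt_add_of_pos_right 1 (by positivity))
  set C : ℕ → ℝ≥0∞ := fun k => ((1 + 1 / ((k : ℝ≥0) + 1) : ℝ≥0) : ℝ≥0∞) ^ (m + 1) with hC
  have hCtop (k : ℕ) : C k ≠ ⊤ := ENNReal.pow_ne_top ENNReal.coe_ne_top
  have hClim : Tendsto C atTop (𝓝 1) := by
    have h1 : Tendsto (fun k : ℕ => (1 + 1 / ((k : ℝ≥0) + 1) : ℝ≥0)) atTop (𝓝 1) := by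
      simpa using (tendsto_one_div_add_atTop_nhds_zero_nat (𝕜 := ℝ≥0)).const_add 1
    have h2 := (ENNReal.tendsto_coe.2 (h1.pow (m + 1)))
    simpa [hC] using h2
  have hlim (b : ℝ≥0∞) : Tendsto (fun k => C k * (C k * b)) atTop (𝓝 b) := by
    have h1 := ENNReal.Tendsto.mul_const (b := b) hClim (Or.inl one_ne_zero)
    rcases eq_or_ne b 0 with rfl | hb
    · simp
    · rw [one_mul] at h1
      simpa using ENNReal.Tendsto.mul hClim (Or.inl one_ne_zero) h1 (Or.inr ENNReal.one_ne_top)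
  refine ⟨(hglob 0).1, tendsto_of_le_liminf_of_limsup_le ?_ ?_⟩
  · refine ge_of_tendsto' (hlim _) fun k => ?_
    obtain ⟨-, J, j, hJ, -, h2, h3, -⟩ := hglob k
    have := liminf_le_liminf (f := atTop) (Eventually.of_forall h2)
    rw [hJ.liminf_eq, ENNReal.liminf_const_mul_of_ne_top (hCtop k)] at this
    exact h3.trans (mul_le_mul' le_rfl this)
  · refine ge_of_tendsto' (hlim _) fun k => ?_
    obtain ⟨-, J, j, hJ, h1, -, -, h4⟩ := hglob k
    have := limsup_le_limsup (f := atTop) (Eventually.of_forall h1)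
    rw [(ENNReal.Tendsto.const_mul hJ (Or.inr (hCtop k))).limsup_eq] at this
    exact this.trans (mul_le_mul' le_rfl h4)

theorem levelIntegrand_integrable {ζ ψ : E (m + 1) → ℝ} (hζ : ContDiff ℝ ∞ ζ)
    (hreg : ∀ x, ζ x = 0 → gradient ζ x ≠ 0) (hψ : Continuous ψ) (hc : HasCompactSupport ψ) :
    Integrable (fun x => ψ x / ‖gradient ζ x‖) ((μHE[m]).restrict {x | ζ x = 0}) := by
  refine ⟨(measurable_levelIntegrand hζ hψ).aestronglyMeasurable, ?_⟩
  have := (tendsto_layer hζ hreg hψ.abs hc.abs fun x => abs_nonneg _).1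
  refine (lintegral_mono fun x => ?_).trans_lt this.lt_top
  rw [Real.enorm_eq_ofReal_abs, abs_div, abs_norm]

/-- Thin layers converge to the surface measure, for functions of any sign. -/
theorem tendsto_integral_layer {ζ ψ : E (m + 1) → ℝ} (hζ : ContDiff ℝ ∞ ζ)
    (hreg : ∀ x, ζ x = 0 → gradient ζ x ≠ 0) (hψ : Continuous ψ) (hc : HasCompactSupport ψ) :
    Tendsto (fun n => ∫ x, approxDirac n (ζ x) * ψ x) atTop
      (𝓝 (∫ x in {x | ζ x = 0}, ψ x / ‖gradient ζ x‖ ∂μHE[m])) := by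
  have hpos := tendsto_layer hζ hreg (hψ.sup continuous_const) (hc.sup HasCompactSupport.zero)
    fun x => le_sup_right (a := ψ x) (b := 0)
  have hneg := tendsto_layer hζ hreg (hψ.neg.sup continuous_const)
    (hc.neg.sup HasCompactSupport.zero) fun x => le_sup_right (a := -ψ x) (b := 0)
  have key := ((ENNReal.tendsto_toReal hpos.1).comp hpos.2).sub
    ((ENNReal.tendsto_toReal hneg.1).comp hneg.2)
  have hsup (a b : ℝ) (ha : 0 ≤ a) : ENNReal.ofReal (a * (b ⊔ 0)) = ENNReal.ofReal (a * b) := by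
    rw [mul_max_of_nonneg _ _ ha, mul_zero, ENNReal.ofReal_max, ENNReal.ofReal_zero]
    simp
  convert key using 2
  · rename_i n
    have hint := ((continuous_layer hζ hψ n).integrable_of_hasCompactSupport (μ := volume)
      (hc.mul_left))
    rw [integral_eq_lintegral_pos_part_sub_lintegral_neg_part hint]
    simp only [layer, Function.comp_apply, ← mul_neg]
    congr 3 <;> funext x <;> exact (hsup _ _ (approxDirac_nonneg n _)).symm
  · rw [integral_eq_lintegral_pos_part_sub_lintegral_neg_part
      (levelIntegrand_integrable hζ hreg hψ hc)]
    simp only [levelIntegral, div_eq_inv_mul, ← mul_neg]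
    congr 3 <;> funext x <;> exact (hsup _ _ (by positivity)).symm

end LayerLimit

/-! ### Integration by parts -/

section Divergence

variable {d : ℕ}

theorem continuous_partialD {h : E d → ℝ} (hh : ContDiff ℝ ∞ h) (k : Fin d) :
    Continuous (partialD k h) :=
  (contDiff_partialD hh k).continuous

theorem integral_mul_partialD {u v : E d → ℝ} (k : Fin d)
    (h1 : Integrable fun x => partialD k u x * v x) (h2 : Integrable fun x => u x * partialD k v x)
    (h3 : Integrable fun x => u x * v x) (hu : Differentiable ℝ u) (hv : Differentiable ℝ v) :
    ∫ x, u x * partialD k v x = -∫ x, partialD k u x * v x :=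
  integral_mul_fderiv_eq_neg_fderiv_mul_of_integrable h1 h2 h3 (fun x _ => hu x) fun x _ => hv x

theorem hasCompactSupport_partialD {h : E d → ℝ} (hh : HasCompactSupport h) (k : Fin d) :
    HasCompactSupport (partialD k h) :=
  (hh.fderiv (𝕜 := ℝ)).comp_left (g := fun L : E d →L[ℝ] ℝ => L (EuclideanSpace.single k 1)) rfl

theorem gradient_apply {h : E d → ℝ} (x : E d) (k : Fin d) (hh : DifferentiableAt ℝ h x) :
    gradient h x k = partialD k h x := by
  have h1 := hh.hasGradientAt.hasFDerivAt.fderiv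
  unfold partialD
  rw [h1, InnerProductSpace.toDual_apply_apply, EuclideanSpace.inner_single_right]
  simp

/-- The divergence theorem on the level set `{ζ = 0}`: a compactly supported vector field which is
tangent to the level sets of `ζ` satisfies `∫ div X / |∇ζ| dσ = 0`. The proof integrates the
divergence of `δ(ζ) X`, which is `δ(ζ) div X`, for an approximate Dirac mass `δ`. -/
theorem integral_div_tangent {m : ℕ} {ζ : E (m + 1) → ℝ} (hζ : ContDiff ℝ ∞ ζ)
    (hreg : ∀ x, ζ x = 0 → gradient ζ x ≠ 0) {X : Fin (m + 1) → E (m + 1) → ℝ}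
    (hX : ∀ k, ContDiff ℝ ∞ (X k)) (hXc : ∀ k, HasCompactSupport (X k))
    (htan : ∀ x, ∑ k, X k x * partialD k ζ x = 0) :
    ∫ x in {x | ζ x = 0}, (∑ k, partialD k (X k) x) / ‖gradient ζ x‖ ∂μHE[m] = 0 := by
  have hdivc : HasCompactSupport fun x => ∑ k, partialD k (X k) x := by
    have hsum (s : Finset (Fin (m + 1))) :
        HasCompactSupport fun x => ∑ k ∈ s, partialD k (X k) x := by
      classical
      induction s using Finset.induction_on with
      | empty => exact HasCompactSupport.zero
      | insert a s ha ih =>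
        simp only [Finset.sum_insert ha]
        exact (hasCompactSupport_partialD (hXc a) a).add ih
    exact hsum _
  have hdiv : Continuous fun x => ∑ k, partialD k (X k) x :=
    continuous_finsetSum _ fun k _ => continuous_partialD (hX k) k
  refine tendsto_nhds_unique (tendsto_integral_layer hζ hreg hdiv hdivc) ?_
  convert tendsto_const_nhds using 2 with n
  have hδ : ContDiff ℝ ∞ fun x => approxDirac n (ζ x) := (contDiff_approxDirac n).comp hζ
  have hparts (k : Fin (m + 1)) : ∫ x, approxDirac n (ζ x) * partialD k (X k) x =
      -∫ x, partialD k (fun x => approxDirac n (ζ x)) x * X k x := by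
    refine integral_mul_partialD k ?_ ?_ ?_ (hδ.differentiable (by simp))
      ((hX k).differentiable (by simp))
    · exact ((continuous_partialD hδ k).mul (hX k).continuous).integrable_of_hasCompactSupport
        (hXc k).mul_left
    · exact (hδ.continuous.mul (continuous_partialD (hX k) k)).integrable_of_hasCompactSupport
        (hasCompactSupport_partialD (hXc k) k).mul_left
    · exact (hδ.continuous.mul (hX k).continuous).integrable_of_hasCompactSupport (hXc k).mul_left
  have hchain (k : Fin (m + 1)) (x : E (m + 1)) : partialD k (fun x => approxDirac n (ζ x)) x =
      deriv (approxDirac n) (ζ x) * partialD k ζ x := by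
    have h1 := ((contDiff_approxDirac n).differentiable (by simp) (ζ x)).hasDerivAt
    have h2 := (hζ.differentiable (by simp) x).hasFDerivAt
    have h3 := (h1.comp_hasFDerivAt x h2).fderiv
    simp only [Function.comp_def] at h3
    unfold partialD
    rw [h3]
    simp
  simp only [Finset.mul_sum]
  rw [integral_finsetSum]
  · simp only [hparts]
    rw [Finset.sum_neg_distrib, ← integral_finsetSum]
    · simp only [hchain]
      rw [neg_eq_zero]
      convert integral_zero (E (m + 1)) ℝ with x
      have := htan x
      calc _ = deriv (approxDirac n) (ζ x) * ∑ k, X k x * partialD k ζ x := by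
            rw [Finset.mul_sum]; exact Finset.sum_congr rfl fun k _ => by ring
        _ = 0 := by rw [this, mul_zero]
    · exact fun k _ => ((continuous_partialD hδ k).mul
        (hX k).continuous).integrable_of_hasCompactSupport (hXc k).mul_left
  · exact fun k _ => (hδ.continuous.mul
      (continuous_partialD (hX k) k)).integrable_of_hasCompactSupport
        (hasCompactSupport_partialD (hXc k) k).mul_left

end Divergence

/-! ### Integration by parts on a compact level set -/

section TangentialProjection

theorem contDiff_gradient {d : ℕ} {h : E d → ℝ} (hh : ContDiff ℝ ∞ h) :
    ContDiff ℝ ∞ (gradient h) := by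
  refine contDiff_euclidean.2 fun k => ?_
  have : (fun x => gradient h x k) = partialD k h :=
    funext fun x => gradient_apply x k (hh.differentiable (by simp) x)
  rw [this]
  exact contDiff_partialD hh k

theorem exists_contDiff_cutoff {d : ℕ} {M U : Set (E d)} (hM : IsCompact M) (hU : IsOpen U)
    (hMU : M ⊆ U) : ∃ θ : E d → ℝ, ContDiff ℝ ∞ θ ∧ HasCompactSupport θ ∧ tsupport θ ⊆ U ∧
      ∀ x ∈ M, ∀ᶠ y in 𝓝 x, θ y = 1 := by
  obtain ⟨L, hL, hML, hLU⟩ := exists_compact_between hM hU hMU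
  obtain ⟨θ, h1, h0, -⟩ := exists_contMDiffMap_one_nhds_of_subset_interior
    (modelWithCornersSelf ℝ (E d)) (n := (⊤ : ℕ∞)) hM.isClosed hML
  have hs : tsupport (θ : E d → ℝ) ⊆ L :=
    closure_minimal (fun x hx => by_contra fun h => hx (h0 x h)) hL.isClosed
  exact ⟨θ, θ.contMDiff.contDiff, HasCompactSupport.intro hL fun x hx => h0 x hx, hs.trans hLU,
    fun x hx => h1.filter_mono (nhds_le_nhdsSet hx)⟩

variable {m : ℕ} {ζ V : E (m + 1) → ℝ}

/-- A continuous function on a compact regular level set is integrable for the surface measure. -/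
theorem integrableOn_level (hζ : ContDiff ℝ ∞ ζ) (hM : IsCompact {x | ζ x = 0})
    (hreg : ∀ x, ζ x = 0 → gradient ζ x ≠ 0) {u : E (m + 1) → ℝ}
    (hu : ContinuousOn u {x | ζ x = 0}) :
    IntegrableOn u {x | ζ x = 0} μHE[m] := by
  obtain ⟨θ, hθ, hθc, -, hθ1⟩ := exists_contDiff_cutoff hM isOpen_univ (subset_univ _)
  have hMm : MeasurableSet {x | ζ x = 0} := hM.measurableSet
  -- `θ |∇ζ| / |∇ζ|` is equal to `1` on the level set, which has therefore finite measure
  have h1 := levelIntegrand_integrable hζ hreg (hθ.continuous.mul (continuous_norm_gradient hζ))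
    hθc.mul_right
  have h2 : IntegrableOn (fun _ => (1 : ℝ)) {x | ζ x = 0} μHE[m] := by
    refine h1.congr ((ae_restrict_iff' hMm).2 (Eventually.of_forall fun x hx => ?_))
    have hx' : ‖gradient ζ x‖ ≠ 0 := norm_ne_zero_iff.2 (hreg x hx)
    change (θ x * ‖gradient ζ x‖) / ‖gradient ζ x‖ = 1
    rw [(hθ1 x hx).self_of_nhds, one_mul, div_self hx']
  have hfin : μHE[m] {x | ζ x = 0} < ⊤ := by
    rcases (integrableOn_const_iff (C := (1 : ℝ)) (by simp)).1 h2 with h | h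
    · simp at h
    · exact h
  obtain ⟨C, hC⟩ := hM.exists_bound_of_continuousOn hu
  have : IsFiniteMeasure ((μHE[m] : Measure (E (m + 1))).restrict {x | ζ x = 0}) :=
    ⟨by simpa using hfin⟩
  exact Integrable.of_bound (hu.aestronglyMeasurable hMm) C
    ((ae_restrict_iff' hMm).2 (Eventually.of_forall hC))

theorem norm_sq_eq_sum {d : ℕ} (v : E d) : ‖v‖ ^ 2 = ∑ k, v k * v k := by
  rw [EuclideanSpace.norm_sq_eq]
  exact Finset.sum_congr rfl fun k _ => by rw [Real.norm_eq_abs, sq_abs, sq]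

theorem partialD_gradient_comm {d : ℕ} {h : E d → ℝ} (hh : ContDiff ℝ ∞ h) (k l : Fin d) :
    partialD k (fun y => gradient h y l) = partialD l (fun y => gradient h y k) := by
  have (j : Fin d) : (fun y => gradient h y j) = partialD j h :=
    funext fun x => gradient_apply x j (hh.differentiable (by simp) x)
  rw [this, this, partialD_comm hh]

theorem partialD_congr {d : ℕ} {u v : E d → ℝ} {x : E d} (h : u =ᶠ[𝓝 x] v) (k : Fin d) :
    partialD k u x = partialD k v x := by
  unfold partialD
  rw [h.fderiv_eq]

theorem partialD_comp_deriv {d : ℕ} {h : E d → ℝ} {x : E d} {F : ℝ → ℝ} {F' : ℝ}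
    (hF : HasDerivAt F F' (h x)) (hh : DifferentiableAt ℝ h x) (k : Fin d) :
    partialD k (fun y => F (h y)) x = F' * partialD k h x := by
  have h3 := (hF.comp_hasFDerivAt x hh.hasFDerivAt).fderiv
  simp only [Function.comp_def] at h3
  unfold partialD
  rw [h3]
  simp

/-- The divergence of `ρ Z` divided by `ρ`, where `Z = |g|² Y - (g, Y) g` is tangent to the level
sets and `ρ` is a scalar function with `∇ρ = ρ (c f - 2 s g'g / |g|²)`. Here `G = |g|²`,
`P = (g, Y)`, `q = g'g`, and `dg k l`, `dY k l` stand for `∂_k g_l`, `∂_k Y_l`. -/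
theorem sum_div_tangential {d : ℕ} (g f Y q : Fin d → ℝ) (dg dY : Fin d → Fin d → ℝ) (G P c s : ℝ)
    (hG0 : G ≠ 0) (hq : ∀ k, q k = ∑ l, dg l k * g l) :
    ∑ k, ((c * f k - 2 * s * q k / G) * (G * Y k - P * g k) +
      (2 * q k * Y k + G * dY k k - ((∑ l, (dg k l * Y l + g l * dY k l)) * g k + P * dg k k))) =
    G * (∑ k, dY k k - (∑ k, (∑ l, dY l k * g l) * g k) / G - P * (∑ k, dg k k) / G
      + 2 * s * P * (∑ k, q k * g k) / G ^ 2 - (2 * s - 1) * (∑ k, q k * Y k) / G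
      + c * (∑ k, Y k * f k) - c * P * (∑ k, f k * g k) / G) := by
  have h1 : ∑ k, (∑ l, (dg k l * Y l + g l * dY k l)) * g k =
      ∑ k, q k * Y k + ∑ k, (∑ l, dY l k * g l) * g k := by
    simp only [Finset.sum_add_distrib, add_mul, hq, Finset.sum_mul]
    congr 1
    · rw [Finset.sum_comm]
      exact Finset.sum_congr rfl fun k _ => Finset.sum_congr rfl fun l _ => by ring
    · rw [Finset.sum_comm]
      exact Finset.sum_congr rfl fun k _ => Finset.sum_congr rfl fun l _ => by ring
  have h2 : ∑ k, ((c * f k - 2 * s * q k / G) * (G * Y k - P * g k) +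
      (2 * q k * Y k + G * dY k k - ((∑ l, (dg k l * Y l + g l * dY k l)) * g k + P * dg k k))) =
      c * G * (∑ k, Y k * f k) - c * P * (∑ k, f k * g k) - 2 * s * (∑ k, q k * Y k)
      + 2 * s * P / G * (∑ k, q k * g k) + 2 * (∑ k, q k * Y k) + G * (∑ k, dY k k)
      - (∑ k, (∑ l, (dg k l * Y l + g l * dY k l)) * g k) - P * (∑ k, dg k k) := by
    have h3 (k : Fin d) : (c * f k - 2 * s * q k / G) * (G * Y k - P * g k) +
        (2 * q k * Y k + G * dY k k - ((∑ l, (dg k l * Y l + g l * dY k l)) * g k + P * dg k k)) =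
        c * G * (Y k * f k) - c * P * (f k * g k) - 2 * s * (q k * Y k)
        + 2 * s * P / G * (q k * g k) + 2 * (q k * Y k) + G * dY k k
        - (∑ l, (dg k l * Y l + g l * dY k l)) * g k
        - P * dg k k := by
      field_simp
      ring
    rw [Finset.sum_congr rfl fun k _ => h3 k]
    simp only [Finset.sum_add_distrib, Finset.sum_sub_distrib, ← Finset.mul_sum]
  rw [h2, h1]
  field_simp
  ring

end TangentialProjection

section SurfaceDivergence

variable {m : ℕ} {ζ V : E (m + 1) → ℝ}

/-- Integration by parts on the level set `{ζ = 0}` for the measure `e^{-cV} |g|^{-n} dσ`, where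
`g = ∇ζ` and `f = -∇V`. It is obtained from the divergence of the tangential field
`e^{-cV} |g|^{-(n + 1)} (|g|² Y - (g, Y) g)`. -/
theorem integral_surface_divergence (hζ : ContDiff ℝ ∞ ζ) (hV : ContDiff ℝ ∞ V)
    (hM : IsCompact {x | ζ x = 0}) (hreg : ∀ x, ζ x = 0 → gradient ζ x ≠ 0) (c n : ℝ)
    {Y : Fin (m + 1) → E (m + 1) → ℝ} (hY : ∀ k, ContDiff ℝ ∞ (Y k)) :
    ∫ x in {x | ζ x = 0}, Real.exp (-c * V x) * ((‖gradient ζ x‖ ^ 2) ^ (-n / 2) *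
      (∑ k, partialD k (Y k) x
        - (∑ k, (∑ l, partialD l (Y k) x * gradient ζ x l) * gradient ζ x k) / ‖gradient ζ x‖ ^ 2
        - (∑ k, gradient ζ x k * Y k x) * (∑ k, partialD k (fun y => gradient ζ y k) x)
            / ‖gradient ζ x‖ ^ 2
        + (n + 1) * (∑ k, gradient ζ x k * Y k x)
            * (∑ k, (∑ l, partialD l (fun y => gradient ζ y k) x * gradient ζ x l) * gradient ζ x k)
            / (‖gradient ζ x‖ ^ 2) ^ 2
        - n * (∑ k, (∑ l, partialD l (fun y => gradient ζ y k) x * gradient ζ x l) * Y k x)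
            / ‖gradient ζ x‖ ^ 2
        + c * (∑ k, Y k x * (-gradient V x) k)
        - c * (∑ k, gradient ζ x k * Y k x) * (∑ k, (-gradient V x) k * gradient ζ x k)
            / ‖gradient ζ x‖ ^ 2)) ∂μHE[m] = 0 := by
  set g := gradient ζ with hg_def
  have hg (k) : ContDiff ℝ ∞ fun y => g y k := contDiff_euclidean.1 (contDiff_gradient hζ) k
  have hgk (k) (x) : g x k = partialD k ζ x := gradient_apply x k (hζ.differentiable (by simp) x)
  have hVk (k) (x) : gradient V x k = partialD k V x :=
    gradient_apply x k (hV.differentiable (by simp) x)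
  set G : E (m + 1) → ℝ := fun x => ‖g x‖ ^ 2 with hG_def
  have hGsum (x) : G x = ∑ k, g x k * g x k := norm_sq_eq_sum _
  have hG : ContDiff ℝ ∞ G := (contDiff_gradient hζ).norm_sq ℝ
  set P : E (m + 1) → ℝ := fun x => ∑ k, g x k * Y k x with hP_def
  have hP : ContDiff ℝ ∞ P := ContDiff.sum fun k _ => (hg k).mul (hY k)
  obtain ⟨θ, hθ, hθc, hθs, hθ1⟩ := exists_contDiff_cutoff hM (U := {x | G x ≠ 0})
    (isOpen_ne_fun hG.continuous continuous_const)
    fun x hx => pow_ne_zero 2 (norm_ne_zero_iff.2 (hreg x hx))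
  -- the exponent for which `|g|² G^(-s) / |g| = |g|^(-n)`
  set s : ℝ := (n + 1) / 2 with hs_def
  set w : E (m + 1) → ℝ := fun x => Real.exp (-c * V x) with hw_def
  have hw : ContDiff ℝ ∞ w := (contDiff_const.mul hV).exp
  have hGs {x} (hx : G x ≠ 0) : ContDiffAt ℝ ∞ (fun y => G y ^ (-s)) x :=
    hG.contDiffAt.rpow_const_of_ne hx
  set ρ : E (m + 1) → ℝ := fun x => θ x * (w x * G x ^ (-s)) with hρ_def
  have hρ : ContDiff ℝ ∞ ρ := by
    rw [contDiff_iff_contDiffAt]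
    intro x
    by_cases hx : x ∈ tsupport θ
    · exact hθ.contDiffAt.mul (hw.contDiffAt.mul (hGs (hθs hx)))
    · refine (contDiffAt_const (c := (0 : ℝ))).congr_of_eventuallyEq ?_
      filter_upwards [(isClosed_tsupport θ).isOpen_compl.mem_nhds hx] with y hy
      simp only [hρ_def, image_eq_zero_of_notMem_tsupport hy, zero_mul]
  set Z : Fin (m + 1) → E (m + 1) → ℝ := fun k x => G x * Y k x - P x * g x k with hZ_def
  have hZ (k) : ContDiff ℝ ∞ (Z k) := (hG.mul (hY k)).sub (hP.mul (hg k))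
  have hρc : HasCompactSupport ρ := hθc.mul_right
  have key := integral_div_tangent hζ hreg (X := fun k x => ρ x * Z k x) (fun k => hρ.mul (hZ k))
    (fun k => hρc.mul_right) (fun x => by
      have : ∑ k, g x k * Z k x = 0 := by
        have h1 (k) : g x k * Z k x = G x * (g x k * Y k x) - P x * (g x k * g x k) := by
          simp only [hZ_def]; ring
        simp only [h1, Finset.sum_sub_distrib, ← Finset.mul_sum, ← hGsum]
        ring
      calc _ = ρ x * ∑ k, g x k * Z k x := by
            rw [Finset.mul_sum]
            exact Finset.sum_congr rfl fun k _ => by rw [← hgk]; ring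
        _ = 0 := by rw [this, mul_zero])
  refine Eq.trans (setIntegral_congr_fun hM.measurableSet fun x hx => ?_) key
  have hGx : G x ≠ 0 := pow_ne_zero 2 (norm_ne_zero_iff.2 (hreg x hx))
  have hGpos : 0 < G x := lt_of_le_of_ne (by positivity) hGx.symm
  have hnorm : 0 < ‖g x‖ := norm_pos_iff.2 (hreg x hx)
  set q : Fin (m + 1) → ℝ := fun k => ∑ l, partialD l (fun y => g y k) x * g x l with hq_def
  have d1 {u : E (m + 1) → ℝ} (hu : ContDiff ℝ ∞ u) : DifferentiableAt ℝ u x :=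
    hu.differentiable (by simp) x
  have hdG (k) : partialD k G x = 2 * q k := by
    have h1 : G = fun y => ∑ l, g y l * g y l := funext hGsum
    rw [h1, partialD_sum _ fun l _ => (hg l).mul (hg l), hq_def, Finset.mul_sum]
    refine Finset.sum_congr rfl fun l _ => ?_
    rw [partialD_mul (d1 (hg l)) (d1 (hg l)), hg_def, partialD_gradient_comm hζ k l]
    ring
  have hdP (k) : partialD k P x =
      ∑ l, (partialD k (fun y => g y l) x * Y l x + g x l * partialD k (Y l) x) := by
    rw [hP_def, partialD_sum _ fun l _ => (hg l).mul (hY l)]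
    exact Finset.sum_congr rfl fun l _ => partialD_mul (d1 (hg l)) (d1 (hY l)) k
  have hdZ (k) : partialD k (Z k) x = 2 * q k * Y k x + G x * partialD k (Y k) x -
      ((∑ l, (partialD k (fun y => g y l) x * Y l x + g x l * partialD k (Y l) x)) * g x k
        + P x * partialD k (fun y => g y k) x) := by
    have h1 : partialD k (Z k) x = partialD k (fun y => G y * Y k y) x
        - partialD k (fun y => P y * g y k) x := by
      unfold partialD
      rw [hZ_def, fderiv_fun_sub (d1 (hG.mul (hY k))) (d1 (hP.mul (hg k)))]
      rfl
    rw [h1, partialD_mul (d1 hG) (d1 (hY k)), partialD_mul (d1 hP) (d1 (hg k)), hdG, hdP]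
  have hρx : ρ x = w x * G x ^ (-s) := by
    simp only [hρ_def, (hθ1 x hx).self_of_nhds, one_mul]
  have hdρ (k) : partialD k ρ x = ρ x * (c * (-gradient V x) k - 2 * s * q k / G x) := by
    have h1 : ρ =ᶠ[𝓝 x] fun y => w y * G y ^ (-s) := by
      filter_upwards [hθ1 x hx] with y hy
      simp only [hρ_def, hy, one_mul]
    have h2 : partialD k w x = w x * (-c) * partialD k V x :=
      partialD_comp_deriv (F := fun t => Real.exp (-c * t))
        (by simpa [hw_def] using ((hasDerivAt_id (V x)).const_mul (-c)).exp) (d1 hV) k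
    have h3 : partialD k (fun y => G y ^ (-s)) x = (-s * G x ^ (-s - 1)) * partialD k G x :=
      partialD_comp_deriv (F := fun t => t ^ (-s)) (Real.hasDerivAt_rpow_const (Or.inl hGx))
        (d1 hG) k
    rw [partialD_congr h1, partialD_mul (d1 hw) ((hGs hGx).differentiableAt (by simp)), h2, h3, hdG,
      Real.rpow_sub_one hGx, hρx, PiLp.neg_apply, hVk]
    field_simp
    ring
  have hdX (k) : partialD k (fun x => ρ x * Z k x) x = ρ x *
      ((c * (-gradient V x) k - 2 * s * q k / G x) * (G x * Y k x - P x * g x k) +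
      (2 * q k * Y k x + G x * partialD k (Y k) x -
      ((∑ l, (partialD k (fun y => g y l) x * Y l x + g x l * partialD k (Y l) x)) * g x k
        + P x * partialD k (fun y => g y k) x))) := by
    rw [partialD_mul (d1 hρ) (d1 (hZ k)), hdρ, hdZ]
    simp only [hZ_def]
    ring
  have hpow : G x ^ (-s) * G x / ‖g x‖ = G x ^ (-n / 2) := by
    have h1 : ‖g x‖ = G x ^ (1 / 2 : ℝ) := by
      rw [← Real.sqrt_eq_rpow]
      exact (Real.sqrt_sq (norm_nonneg _)).symm
    rw [h1, ← Real.rpow_add_one hGx, ← Real.rpow_sub hGpos]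
    congr 1
    rw [hs_def]; ring
  have hP' : ∑ k, g x k * Y k x = P x := rfl
  have hG' : ‖g x‖ ^ 2 = G x := rfl
  have hw' : Real.exp (-c * V x) = w x := rfl
  have hs' : n = 2 * s - 1 := by rw [hs_def]; ring
  have hs'' : n + 1 = 2 * s := by rw [hs_def]; ring
  simp only [hdX, hP', hG', hw']
  rw [← Finset.mul_sum, sum_div_tangential (g x) (fun k => (-gradient V x) k) (fun k => Y k x) q
    (fun k l => partialD k (fun y => g y l) x) (fun k l => partialD k (Y l) x) (G x) (P x) c s hGx
    fun _ => rfl, hρx, ← hpow, hs'', hs']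
  ring

end SurfaceDivergence

/-! ### Numerical prefactors and linearity -/

section Prefactor

/-- The numerical prefactor of the elementary differential of a graph, where `G` stands for `|g|²`.
-/
def Graph.prefactor {R : Type} (σ G : ℝ) (γ : Graph R) : ℝ :=
  σ ^ γ.weight * G ^ (-(γ.Ng : ℝ) / 2)

/-- The numerical prefactor of a vector field, whose root is counted among the nodes. -/
def VField.prefactor (σ G : ℝ) (τ : VField) : ℝ := σ ^ τ.weight * G ^ (-(τ.Ng : ℝ) / 2)

variable {R : Type} {σ G : ℝ} (hσ : 0 < σ) (hG : 0 < G)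

theorem Graph.prefactor_addLiana (hσ : 0 < σ) (γ : Graph R) (v w : γ.Node) :
    (γ.addLiana v w).prefactor σ G = σ ^ 2 * γ.prefactor σ G := by
  unfold Graph.prefactor
  rw [weight_addLiana, Ng_addLiana, Real.rpow_add hσ, Real.rpow_two]
  ring

theorem VField.prefactor_loop (τ : VField) (w : τ.graph.Node) :
    Graph.prefactor σ G (τ.loop w) = τ.prefactor σ G := by
  unfold Graph.prefactor VField.prefactor
  rw [weight_loop, Ng_loop]

theorem prefactor_black : black.prefactor σ G = 1 := by
  unfold VField.prefactor
  rw [dot_weight, dot_Ng, Colour.whiteness_black]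
  simp

/-- Without white nodes the prefactor is a power of `σ`, even where `g` vanishes, as `0 ^ 0 = 1`. -/
theorem Graph.prefactor_eq_of_Ng_eq_zero (γ : Graph R) (h : γ.Ng = 0) :
    γ.prefactor σ G = σ ^ γ.weight := by
  unfold Graph.prefactor
  rw [h]
  simp

section

include hG

theorem prefactor_white_sq : white.prefactor σ G * white.prefactor σ G = σ ^ 2 / G := by
  unfold VField.prefactor
  rw [dot_weight, dot_Ng, Colour.whiteness_white, mul_mul_mul_comm, ← Real.rpow_add hG]
  norm_num [Real.rpow_neg_one]
  field_simp

end

include hσ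

include hG

theorem Graph.prefactor_graft (γ : Graph R) (τ : VField) (w : γ.Node) :
    (γ.graft τ w).prefactor σ G = γ.prefactor σ G * τ.prefactor σ G := by
  unfold Graph.prefactor VField.prefactor
  rw [weight_graft, Ng_graft, Real.rpow_add hσ, mul_mul_mul_comm, ← Real.rpow_add hG]
  push_cast
  ring_nf

theorem VField.prefactor_graft (τ κ : VField) (w : τ.graph.Node) :
    (τ.graft κ w).prefactor σ G = τ.prefactor σ G * κ.prefactor σ G := by
  unfold VField.prefactor
  rw [weight_graft, Ng_graft, Real.rpow_add hσ, mul_mul_mul_comm, ← Real.rpow_add hG]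
  push_cast
  ring_nf

theorem VField.prefactor_scal (τ : VField) (c : Colour) :
    Graph.prefactor σ G (τ.scal c) = τ.prefactor σ G * (dot c).prefactor σ G / σ ^ 2 := by
  unfold Graph.prefactor VField.prefactor
  rw [weight_scal, Ng_scal, dot_weight, dot_Ng, Real.rpow_sub hσ, Real.rpow_add hσ, Real.rpow_two,
    mul_mul_mul_comm, ← Real.rpow_add hG]
  push_cast
  ring_nf

theorem Aroma.prefactor_mul (a : Aroma) (γ : Graph R) :
    (a ⊙ γ).prefactor σ G = Graph.prefactor σ G a * γ.prefactor σ G := by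
  unfold Graph.prefactor
  rw [weight_mul, Ng_mul, Real.rpow_add hσ, mul_mul_mul_comm, ← Real.rpow_add hG]
  push_cast
  ring_nf

end Prefactor

section Linearity

variable {d : ℕ} (σ : ℝ) (f g : E d → E d) (φ : E d → ℝ) (x : E d)

theorem F_eq_linearCombination (u : Span) :
    F σ f g φ u x = Finsupp.linearCombination ℝ (EAT.F σ f g φ x) u := rfl

theorem F_cls (γ : Forest) : F σ f g φ (cls γ) x =
    Graph.prefactor σ (‖g x‖ ^ 2) γ * γ.val f g φ 0 x := by
  rw [F_eq_linearCombination, cls, Finsupp.linearCombination_single, one_smul]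
  exact Forest.F_eq f g σ φ x γ

theorem F_add (u v : Span) : F σ f g φ (u + v) x = F σ f g φ u x + F σ f g φ v x := by
  simp only [F_eq_linearCombination, map_add]

theorem F_sub (u v : Span) : F σ f g φ (u - v) x = F σ f g φ u x - F σ f g φ v x := by
  simp only [F_eq_linearCombination, map_sub]

theorem F_neg (u : Span) : F σ f g φ (-u) x = -F σ f g φ u x := by
  simp only [F_eq_linearCombination, map_neg]

theorem F_smul (c : ℝ) (u : Span) : F σ f g φ (c • u) x = c * F σ f g φ u x := by
  simp only [F_eq_linearCombination, map_smul, smul_eq_mul]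

theorem F_sum {ι : Type*} (s : Finset ι) (u : ι → Span) :
    F σ f g φ (∑ i ∈ s, u i) x = ∑ i ∈ s, F σ f g φ (u i) x := by
  simp only [F_eq_linearCombination, map_sum]

end Linearity

/-! ### The rules as integration by parts -/

section Pointwise

variable {d : ℕ} {σ : ℝ} {f g : E d → E d}

theorem VField.val_scal_white (τ : VField) (x : E d) :
    (τ.scal Colour.white).val f g x = ∑ k, τ.val f g 0 k x * g x k :=
  VField.val_scal f g τ _ x

theorem VField.val_scal_black (τ : VField) (x : E d) :
    (τ.scal Colour.black).val f g x = ∑ k, τ.val f g 0 k x * f x k :=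
  VField.val_scal f g τ _ x

variable (hσ : 0 < σ) (hf : ContDiff ℝ ∞ f) (hg : ContDiff ℝ ∞ g)

section

include hf hg

theorem aromaGGG_val (x : E d) : aromaGGG.val f g x =
    ∑ k, (∑ l, partialD l (fun y => g y k) x * g x l) * g x k := by
  rw [aromaGGG, VField.val_scal_white]
  simp only [VField.val_underWhite hf hg, dot_val, fieldOf]

theorem VField.sum_val_graft_scal_white (τ : VField) (x : E d) :
    ∑ w, ((τ.graft white w).scal Colour.white).val f g x =
      ∑ k, (∑ l, partialD l (τ.val f g 0 k) x * g x l) * g x k := by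
  simp only [VField.val_scal_white, ← τ.val_graft_white hf hg, Finset.sum_mul]
  rw [Finset.sum_comm]

end

variable {φ : E d → ℝ} (hφ : ContDiff ℝ ∞ φ) {x : E d} (hx : g x ≠ 0)
  (hsymm : ∀ k l, partialD k (fun y => g y l) x = partialD l (fun y => g y k) x)

include hσ hf hg hφ hx hsymm

/-- The difference of the two sides of the edge rule is, pointwise, the integrand of the integration
by parts formula for the vector field `F(γ) F(τ)`. -/
theorem F_edge_sub (γ : Forest) (τ : VField) :
    F σ f g φ (edgeLHS γ τ) x - F σ f g φ (edgeRHS γ τ) x =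
      σ ^ (Graph.weight γ + τ.weight) * ((‖g x‖ ^ 2) ^ (-((γ.Ng : ℝ) + τ.Ng) / 2) *
      (∑ k, partialD k (fun y => γ.val f g φ 0 y * τ.val f g 0 k y) x
        - (∑ k, (∑ l, partialD l (fun y => γ.val f g φ 0 y * τ.val f g 0 k y) x * g x l) * g x k)
            / ‖g x‖ ^ 2
        - (∑ k, g x k * (γ.val f g φ 0 x * τ.val f g 0 k x)) *
            (∑ k, partialD k (fun y => g y k) x) / ‖g x‖ ^ 2
        + ((γ.Ng : ℝ) + τ.Ng + 1) * (∑ k, g x k * (γ.val f g φ 0 x * τ.val f g 0 k x))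
            * (∑ k, (∑ l, partialD l (fun y => g y k) x * g x l) * g x k) / (‖g x‖ ^ 2) ^ 2
        - ((γ.Ng : ℝ) + τ.Ng) * (∑ k, (∑ l, partialD l (fun y => g y k) x * g x l)
            * (γ.val f g φ 0 x * τ.val f g 0 k x)) / ‖g x‖ ^ 2
        + 2 / σ ^ 2 * (∑ k, γ.val f g φ 0 x * τ.val f g 0 k x * f x k)
        - 2 / σ ^ 2 * (∑ k, g x k * (γ.val f g φ 0 x * τ.val f g 0 k x)) * (∑ k, f x k * g x k)
            / ‖g x‖ ^ 2)) := by
  have hG : 0 < ‖g x‖ ^ 2 := by positivity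
  have hpre : σ ^ (Graph.weight γ + τ.weight) * (‖g x‖ ^ 2) ^ (-((γ.Ng : ℝ) + τ.Ng) / 2) =
      Graph.prefactor σ (‖g x‖ ^ 2) γ * τ.prefactor σ (‖g x‖ ^ 2) := by
    unfold Graph.prefactor VField.prefactor
    rw [Real.rpow_add hσ, mul_mul_mul_comm, ← Real.rpow_add hG]
    ring_nf
  rw [← mul_assoc, hpre]
  have hr := prefactor_white_sq (σ := σ) hG
  set a := γ.val f g φ 0 with ha
  have haD : DifferentiableAt ℝ a x := (γ.contDiff_val hf hg hφ 0).differentiable (by simp) x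
  have hTD (k) : DifferentiableAt ℝ (τ.val f g 0 k) x :=
    (τ.contDiff_val hf hg 0 k).differentiable (by simp) x
  have hgT : ∑ k, g x k * (a x * τ.val f g 0 k x) = a x * ∑ k, τ.val f g 0 k x * g x k := by
    rw [Finset.mul_sum]
    exact Finset.sum_congr rfl fun k _ => by ring
  have hfT : ∑ k, a x * τ.val f g 0 k x * f x k = a x * ∑ k, τ.val f g 0 k x * f x k := by
    rw [Finset.mul_sum]
    exact Finset.sum_congr rfl fun k _ => by ring
  have hqT : ∑ k, (∑ l, partialD l (fun y => g y k) x * g x l) * (a x * τ.val f g 0 k x) =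
      a x * ∑ k, (∑ l, partialD l (fun y => g y k) x * τ.val f g 0 l x) * g x k := by
    simp only [Finset.mul_sum, Finset.sum_mul]
    rw [Finset.sum_comm]
    exact Finset.sum_congr rfl fun k _ => Finset.sum_congr rfl fun l _ => by rw [hsymm k l]; ring
  have hdiv : ∑ k, partialD k (fun y => a y * τ.val f g 0 k y) x =
      ∑ k, partialD k a x * τ.val f g 0 k x + a x * ∑ k, partialD k (τ.val f g 0 k) x := by
    rw [Finset.mul_sum, ← Finset.sum_add_distrib]
    exact Finset.sum_congr rfl fun k _ => partialD_mul haD (hTD k) k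
  have hnn : ∑ k, (∑ l, partialD l (fun y => a y * τ.val f g 0 k y) x * g x l) * g x k =
      (∑ l, partialD l a x * g x l) * (∑ k, τ.val f g 0 k x * g x k) +
      a x * ∑ k, (∑ l, partialD l (τ.val f g 0 k) x * g x l) * g x k := by
    rw [Finset.mul_sum, Finset.mul_sum, ← Finset.sum_add_distrib]
    refine Finset.sum_congr rfl fun k _ => ?_
    have : ∑ l, partialD l (fun y => a y * τ.val f g 0 k y) x * g x l =
        τ.val f g 0 k x * (∑ l, partialD l a x * g x l)
          + a x * ∑ l, partialD l (τ.val f g 0 k) x * g x l := by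
      rw [Finset.mul_sum, Finset.mul_sum, ← Finset.sum_add_distrib]
      refine Finset.sum_congr rfl fun l _ => ?_
      rw [partialD_mul haD (hTD k)]
      ring
    rw [this]
    ring
  have hgw := γ.sum_val_graft hf hg hφ white x
  simp only [dot_val, fieldOf] at hgw
  rw [hgT, hfT, hqT, hdiv, hnn]
  unfold edgeLHS edgeRHS
  simp only [F_add, F_sub, F_smul, F_sum, F_cls, Forest.val_mul, Graph.prefactor_graft hσ hG,
    Aroma.prefactor_mul hσ hG, VField.prefactor_scal hσ hG, VField.prefactor_graft hσ hG,
    VField.prefactor_loop, prefactor_black, aromaDivG_val hf hg, aromaGGG_val hf hg, dot_val,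
    fieldOf, ← Finset.mul_sum, ← Finset.sum_mul, γ.sum_val_graft hf hg hφ τ, hgw, VField.val_scal_white,
    VField.val_scal_black, τ.sum_val_loop hf hg, τ.val_underWhite hf hg, ← ha]
  have hgs := τ.sum_val_graft_scal_white hf hg x
  simp only [VField.val_scal_white] at hgs
  rw [hgs]
  generalize white.prefactor σ (‖g x‖ ^ 2) = r at hr ⊢
  generalize Graph.prefactor σ (‖g x‖ ^ 2) γ = p
  generalize VField.prefactor σ (‖g x‖ ^ 2) τ = p'
  generalize ‖g x‖ ^ 2 = G at hG hr ⊢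
  -- the prefactor `r` of `g` satisfies `r² = σ² / G`, which turns `G` into a function of `r`
  have hr0 : r ≠ 0 := by
    rintro rfl
    have : 0 < σ ^ 2 / G := by positivity
    simp at hr
    exact this.ne hr
  obtain rfl : G = σ ^ 2 / (r * r) := by
    rw [hr]
    field_simp
  field_simp
  ring

end Pointwise

section PointwiseLiana

variable {d : ℕ} {σ : ℝ} {f g : E d → E d} (hσ : 0 < σ) (hf : ContDiff ℝ ∞ f)
  (hg : ContDiff ℝ ∞ g) {φ : E d → ℝ} (hφ : ContDiff ℝ ∞ φ) {x : E d} (hx : g x ≠ 0)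

include hσ hf hg hφ hx

/-- The difference of the two sides of the liana rule is, pointwise, the integrand of the
integration by parts formula for the vector field obtained by differentiating `γ` once more at the
node `v`. -/
theorem F_liana_sub (γ : Forest) (v : γ.Node) :
    F σ f g φ (lianaLHS γ v) x - F σ f g φ (lianaRHS γ v) x =
      σ ^ (Graph.weight γ + 2) * ((‖g x‖ ^ 2) ^ (-(γ.Ng : ℝ) / 2) *
      (∑ k, partialD k (γ.val f g φ (mark v k)) x
        - (∑ k, (∑ l, partialD l (γ.val f g φ (mark v k)) x * g x l) * g x k) / ‖g x‖ ^ 2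
        - (∑ k, g x k * γ.val f g φ (mark v k) x) * (∑ k, partialD k (fun y => g y k) x)
            / ‖g x‖ ^ 2
        + ((γ.Ng : ℝ) + 1) * (∑ k, g x k * γ.val f g φ (mark v k) x)
            * (∑ k, (∑ l, partialD l (fun y => g y k) x * g x l) * g x k) / (‖g x‖ ^ 2) ^ 2
        - (γ.Ng : ℝ) * (∑ k, (∑ l, partialD l (fun y => g y k) x * g x l)
            * γ.val f g φ (mark v k) x) / ‖g x‖ ^ 2
        + 2 / σ ^ 2 * (∑ k, γ.val f g φ (mark v k) x * f x k)
        - 2 / σ ^ 2 * (∑ k, g x k * γ.val f g φ (mark v k) x) * (∑ k, f x k * g x k)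
            / ‖g x‖ ^ 2)) := by
  have hG : 0 < ‖g x‖ ^ 2 := by positivity
  have hpre : σ ^ (Graph.weight γ + 2) * (‖g x‖ ^ 2) ^ (-(γ.Ng : ℝ) / 2) =
      σ ^ 2 * Graph.prefactor σ (‖g x‖ ^ 2) γ := by
    unfold Graph.prefactor
    rw [Real.rpow_add hσ, Real.rpow_two]
    ring
  rw [← mul_assoc, hpre]
  have hr := prefactor_white_sq (σ := σ) hG
  have hgB : ∑ k, g x k * γ.val f g φ (mark v k) x = ∑ k, γ.val f g φ (mark v k) x * g x k :=
    Finset.sum_congr rfl fun k _ => by ring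
  have hqB : ∑ k, (∑ l, partialD l (fun y => g y k) x * g x l) * γ.val f g φ (mark v k) x =
      ∑ k, γ.val f g φ (mark v k) x * ∑ l, partialD l (fun y => g y k) x * g x l :=
    Finset.sum_congr rfl fun k _ => by ring
  have hgg := γ.sum_val_graft_graft hf hg hφ v x
  rw [hgB, hqB, ← hgg, ← γ.sum_val_addLiana hf hg hφ v x]
  unfold lianaLHS lianaRHS
  simp only [F_add, F_sub, F_neg, F_smul, F_sum, F_cls, Forest.val_mul, Graph.prefactor_graft hσ hG,
    Graph.prefactor_addLiana hσ, Aroma.prefactor_mul hσ hG, VField.prefactor_scal hσ hG,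
    VField.prefactor_graft hσ hG, VField.prefactor_loop, prefactor_black, aromaDivG_val hf hg,
    aromaGGG_val hf hg, ← Finset.mul_sum, Forest.val_graft_zero f g φ γ _ v,
    VField.val_scal_white, white.val_underWhite hf hg, dot_val, fieldOf]
  generalize white.prefactor σ (‖g x‖ ^ 2) = r at hr ⊢
  generalize Graph.prefactor σ (‖g x‖ ^ 2) γ = p
  generalize ‖g x‖ ^ 2 = G at hG hr ⊢
  -- the prefactor `r` of `g` satisfies `r² = σ² / G`, which turns `G` into a function of `r`
  have hr0 : r ≠ 0 := by
    rintro rfl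
    have : 0 < σ ^ 2 / G := by positivity
    simp at hr
    exact this.ne hr
  obtain rfl : G = σ ^ 2 / (r * r) := by
    rw [hr]
    field_simp
  field_simp
  ring

end PointwiseLiana

/-! ### The rules on a compact hypersurface -/

section Gibbs

variable {d : ℕ}

/-- Equality of integrals for a Gibbs measure, in terms of the non-normalised measure. -/
theorem sameIntegral_gibbs {ν : Measure (E d)} {σ : ℝ} {V u v : E d → ℝ}
    (hw : Integrable (fun x => Real.exp (-(2 / σ ^ 2) * V x)) ν)
    (hu : Integrable (fun x => Real.exp (-(2 / σ ^ 2) * V x) * u x) ν)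
    (hv : Integrable (fun x => Real.exp (-(2 / σ ^ 2) * V x) * v x) ν)
    (h : ∫ x, Real.exp (-(2 / σ ^ 2) * V x) * (u x - v x) ∂ν = 0) :
    SameIntegral (gibbs ν σ V) u v := by
  refine ⟨(integrable_tilted_iff hw u).2 hu, (integrable_tilted_iff hw v).2 hv, ?_⟩
  have hsub : ∫ x, Real.exp (-(2 / σ ^ 2) * V x) * u x ∂ν =
      ∫ x, Real.exp (-(2 / σ ^ 2) * V x) * v x ∂ν := by
    simp only [mul_sub] at h
    rw [integral_sub hu hv] at h
    exact sub_eq_zero.1 h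
  unfold gibbs
  rw [integral_tilted, integral_tilted]
  simp only [smul_eq_mul, div_mul_eq_mul_div]
  rw [integral_div, integral_div, hsub]

theorem continuousOn_F {σ : ℝ} {f g : E d → E d} (hf : ContDiff ℝ ∞ f) (hg : ContDiff ℝ ∞ g)
    {φ : E d → ℝ} (hφ : ContDiff ℝ ∞ φ) (u : Span) : ContinuousOn (F σ f g φ u) {x | g x ≠ 0} := by
  unfold F
  refine continuousOn_finsetSum _ fun γ _ => continuousOn_const.mul ?_
  induction γ using Quotient.inductionOn with
  | _ γ =>
    have : (fun x => EAT.F σ f g φ x (Quotient.mk _ γ)) = fun x =>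
        σ ^ Graph.weight γ * (‖g x‖ ^ 2) ^ (-(Graph.Ng γ : ℝ) / 2) * γ.val f g φ 0 x :=
      funext fun x => Forest.F_eq f g σ φ x γ
    rw [this]
    refine (continuousOn_const.mul ?_).mul (γ.contDiff_val hf hg hφ 0).continuous.continuousOn
    exact (hg.continuous.norm.pow 2).continuousOn.rpow_const
      fun x hx => Or.inl (pow_ne_zero 2 (norm_ne_zero_iff.2 hx))

variable {σ : ℝ} {V ζ : E d → ℝ}

/-- Reduction of an equality of integrals on a hypersurface to the integration by parts formula, by
means of the pointwise difference of the integrands. In dimension `0` the hypersurface is empty. -/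
theorem sameIntegral_surface (hV : ContDiff ℝ ∞ V) {φ : E d → ℝ} (hζ : ContDiff ℝ ∞ ζ)
    (hφ : ContDiff ℝ ∞ φ) (hM : IsCompact {x | ζ x = 0}) (hreg : ∀ x, ζ x = 0 → gradient ζ x ≠ 0)
    (u v : Span) (C n : ℝ) {Y : Fin d → E d → ℝ} (hY : ∀ k, ContDiff ℝ ∞ (Y k))
    (h : ∀ x, ζ x = 0 → F σ (fun x => -gradient V x) (gradient ζ) φ u x
        - F σ (fun x => -gradient V x) (gradient ζ) φ v x =
      C * ((‖gradient ζ x‖ ^ 2) ^ (-n / 2) *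
      (∑ k, partialD k (Y k) x
        - (∑ k, (∑ l, partialD l (Y k) x * gradient ζ x l) * gradient ζ x k) / ‖gradient ζ x‖ ^ 2
        - (∑ k, gradient ζ x k * Y k x) * (∑ k, partialD k (fun y => gradient ζ y k) x)
            / ‖gradient ζ x‖ ^ 2
        + (n + 1) * (∑ k, gradient ζ x k * Y k x)
            * (∑ k, (∑ l, partialD l (fun y => gradient ζ y k) x * gradient ζ x l) * gradient ζ x k)
            / (‖gradient ζ x‖ ^ 2) ^ 2
        - n * (∑ k, (∑ l, partialD l (fun y => gradient ζ y k) x * gradient ζ x l) * Y k x)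
            / ‖gradient ζ x‖ ^ 2
        + 2 / σ ^ 2 * (∑ k, Y k x * (-gradient V x) k)
        - 2 / σ ^ 2 * (∑ k, gradient ζ x k * Y k x) * (∑ k, (-gradient V x) k * gradient ζ x k)
            / ‖gradient ζ x‖ ^ 2))) :
    SameIntegral (gibbs (surfaceMeasure {x | ζ x = 0}) σ V)
      (F σ (fun x => -gradient V x) (gradient ζ) φ u)
      (F σ (fun x => -gradient V x) (gradient ζ) φ v) := by
  obtain _ | m := d
  · have hempty : {x | ζ x = 0} = ∅ :=
      eq_empty_of_forall_notMem fun x hx => hreg x hx (Subsingleton.elim _ _)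
    have : surfaceMeasure {x | ζ x = 0} = 0 := by
      unfold surfaceMeasure
      rw [hempty, Measure.restrict_empty]
    rw [this]
    exact sameIntegral_gibbs integrable_zero_measure integrable_zero_measure integrable_zero_measure
      (integral_zero_measure _)
  have hsurf : surfaceMeasure {x | ζ x = 0} = (μHE[m]).restrict {x | ζ x = 0} := rfl
  rw [hsurf]
  have hw : Continuous fun x => Real.exp (-(2 / σ ^ 2) * V x) :=
    Real.continuous_exp.comp (continuous_const.mul hV.continuous)
  have hF (u : Span) : IntegrableOn (fun x => Real.exp (-(2 / σ ^ 2) * V x) *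
      F σ (fun x => -gradient V x) (gradient ζ) φ u x) {x | ζ x = 0} μHE[m] :=
    integrableOn_level hζ hM hreg (hw.continuousOn.mul
      ((continuousOn_F (contDiff_gradient hV).neg (contDiff_gradient hζ) hφ u).mono hreg))
  refine sameIntegral_gibbs (integrableOn_level hζ hM hreg hw.continuousOn) (hF u) (hF v) ?_
  have key := integral_surface_divergence hζ hV hM hreg (2 / σ ^ 2) n hY
  refine Eq.trans (setIntegral_congr_fun hM.measurableSet fun x hx => ?_)
    ((integral_const_mul C _).trans (by rw [key, mul_zero]))
  simp only [h x hx]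
  ring

theorem edge_rule_surface (hσ : 0 < σ) (hV : ContDiff ℝ ∞ V) {φ : E d → ℝ} (hζ : ContDiff ℝ ∞ ζ)
    (hφ : ContDiff ℝ ∞ φ) (hM : IsCompact {x | ζ x = 0}) (hreg : ∀ x, ζ x = 0 → gradient ζ x ≠ 0)
    (γ : Forest) (τ : VField) :
    SameIntegral (gibbs (surfaceMeasure {x | ζ x = 0}) σ V)
      (F σ (fun x => -gradient V x) (gradient ζ) φ (edgeLHS γ τ))
      (F σ (fun x => -gradient V x) (gradient ζ) φ (edgeRHS γ τ)) := by
  have hf := (contDiff_gradient hV).neg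
  have hg := contDiff_gradient hζ
  exact sameIntegral_surface hV hζ hφ hM hreg _ _ _ _
    (fun k => (γ.contDiff_val hf hg hφ 0).mul (τ.contDiff_val hf hg 0 k))
    fun x hx => F_edge_sub hσ hf hg hφ (hreg x hx)
      (fun k l => congrFun (partialD_gradient_comm hζ k l) x) γ τ

theorem liana_rule_surface (hσ : 0 < σ) (hV : ContDiff ℝ ∞ V) {φ : E d → ℝ} (hζ : ContDiff ℝ ∞ ζ)
    (hφ : ContDiff ℝ ∞ φ) (hM : IsCompact {x | ζ x = 0}) (hreg : ∀ x, ζ x = 0 → gradient ζ x ≠ 0)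
    (γ : Forest) (v : γ.Node) :
    SameIntegral (gibbs (surfaceMeasure {x | ζ x = 0}) σ V)
      (F σ (fun x => -gradient V x) (gradient ζ) φ (lianaLHS γ v))
      (F σ (fun x => -gradient V x) (gradient ζ) φ (lianaRHS γ v)) := by
  have hf := (contDiff_gradient hV).neg
  have hg := contDiff_gradient hζ
  exact sameIntegral_surface hV hζ hφ hM hreg _ _ _ _
    (fun k => γ.contDiff_val hf hg hφ (mark v k))
    fun x hx => F_liana_sub hσ hf hg hφ (hreg x hx) γ v

end Gibbs

end Hypersurface

/-! ### The Euclidean rules -/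

section Temperate

variable {d : ℕ}

theorem temperate_partialD {h : E d → ℝ} (hh : h.HasTemperateGrowth) (k : Fin d) :
    (partialD k h).HasTemperateGrowth := by
  have h1 : (fderiv ℝ h).HasTemperateGrowth :=
    ⟨hh.1.fderiv_right (by simp), fun n => by
      simpa only [norm_iteratedFDeriv_fderiv] using hh.2 (n + 1)⟩
  exact (ContinuousLinearMap.apply ℝ ℝ (EuclideanSpace.single k (1 : ℝ))).hasTemperateGrowth.comp h1

theorem temperate_iterD {h : E d → ℝ} (hh : h.HasTemperateGrowth) (I : Multiset (Fin d)) :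
    (iterD I h).HasTemperateGrowth := by
  unfold iterD
  induction I.sort (· ≤ ·) with
  | nil => exact hh
  | cons k l ih => exact temperate_partialD ih k

theorem temperate_prod {ι : Type*} (s : Finset ι) {h : ι → E d → ℝ}
    (hh : ∀ i ∈ s, (h i).HasTemperateGrowth) :
    (fun x => ∏ i ∈ s, h i x).HasTemperateGrowth := by
  classical
  induction s using Finset.induction_on with
  | empty => simp
  | insert a s ha ih =>
    simp only [Finset.prod_insert ha]
    exact (hh a (Finset.mem_insert_self a s)).mul
      (ih fun i hi => hh i (Finset.mem_insert_of_mem hi))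

variable {f g : E d → E d} (hf : ∀ k, (fun y => f y k).HasTemperateGrowth)
  (hg : ∀ k, (fun y => g y k).HasTemperateGrowth)

include hf hg

theorem temperate_fieldOf (c : Colour) (k : Fin d) :
    (fun y => fieldOf f g c y k).HasTemperateGrowth := by
  cases c
  · exact hf k
  · exact hg k

theorem temperate_rawVal {A R L : Type} [Fintype A] [Fintype R] [Fintype L] (colour : A → Colour)
    (out : A → (A ⊕ R) ⊕ A) (lia : L → Sym2 (A ⊕ R)) {Φ : R → E d → ℝ}
    (hΦ : ∀ r, (Φ r).HasTemperateGrowth) (e : A ⊕ R → Multiset (Fin d)) :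
    (rawVal f g colour out lia Φ e).HasTemperateGrowth := by
  unfold rawVal
  refine .sum fun i _ => .sum fun j _ => .mul (.const _) (.mul ?_ ?_)
  · exact temperate_prod _ fun v _ => temperate_iterD (temperate_fieldOf hf hg _ _) _
  · exact temperate_prod _ fun r _ => temperate_iterD (hΦ r) _

theorem Forest.temperate_val {φ : E d → ℝ} (hφ : φ.HasTemperateGrowth) (γ : Forest)
    (e : γ.Node → Multiset (Fin d)) : (γ.val f g φ e).HasTemperateGrowth :=
  temperate_rawVal hf hg _ _ _ (fun _ => hφ) _

theorem VField.temperate_val (τ : VField) (e : τ.graph.Node → Multiset (Fin d)) (k : Fin d) :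
    (τ.val f g e k).HasTemperateGrowth :=
  temperate_rawVal hf hg _ _ _ (fun _ => temperate_fieldOf hf hg _ _) _

omit hg in
/-- With `g = 0` the prefactors of all forests are constant. -/
theorem temperate_F (σ : ℝ) {φ : E d → ℝ} (hφ : φ.HasTemperateGrowth) (u : Span) :
    (F σ f 0 φ u).HasTemperateGrowth := by
  unfold F
  refine .sum fun γ _ => .mul (.const _) ?_
  induction γ using Quotient.inductionOn with
  | _ γ =>
    have : (fun x => EAT.F σ f 0 φ x (Quotient.mk _ γ)) = fun x =>
        σ ^ Graph.weight γ * (‖(0 : E d)‖ ^ 2) ^ (-(Graph.Ng γ : ℝ) / 2) * γ.val f 0 φ 0 x :=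
      funext fun x => Forest.F_eq f 0 σ φ x γ
    rw [this]
    exact .mul (.const _) (γ.temperate_val hf (fun _ => .const 0) hφ 0)

omit hf hg in
theorem temperate_drift {V : E d → ℝ} (hV : V.HasTemperateGrowth) (k : Fin d) :
    (fun x => (-gradient V x) k).HasTemperateGrowth := by
  have h : (fun x => (-gradient V x) k) = fun x => -partialD k V x :=
    funext fun x => by rw [PiLp.neg_apply, gradient_apply x k (hV.1.differentiable (by simp) x)]
  rw [h]
  exact (temperate_partialD hV k).neg

end Temperate

section EuclideanGibbs

variable {d : ℕ} {c : ℝ} {V : E d → ℝ}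

theorem integrable_exp_mul_temperate (hV : Continuous V)
    (hint : ∀ p : ℕ, Integrable fun x : E d => ‖x‖ ^ p * Real.exp (-c * V x)) {h : E d → ℝ}
    (hh : h.HasTemperateGrowth) : Integrable fun x => Real.exp (-c * V x) * h x := by
  obtain ⟨p, C, hC⟩ := hh.2 0
  have hmaj : Integrable fun x : E d => C * ∑ i ∈ Finset.range (p + 1),
      (p.choose i : ℝ) * (‖x‖ ^ (p - i) * Real.exp (-c * V x)) :=
    (integrable_finsetSum _ fun i _ => (hint (p - i)).const_mul _).const_mul _
  refine hmaj.mono' ?_ (Filter.Eventually.of_forall fun x => ?_)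
  · exact ((Real.continuous_exp.comp (continuous_const.mul hV)).mul
      hh.1.continuous).aestronglyMeasurable
  · have h1 := hC x
    rw [norm_iteratedFDeriv_zero] at h1
    rw [norm_mul, Real.norm_of_nonneg (Real.exp_pos _).le]
    calc Real.exp (-c * V x) * ‖h x‖ ≤ Real.exp (-c * V x) * (C * (1 + ‖x‖) ^ p) := by gcongr
      _ = _ := by
        rw [add_pow, Finset.mul_sum, Finset.mul_sum, Finset.mul_sum]
        exact Finset.sum_congr rfl fun i _ => by simp only [one_pow]; ring

/-- Integration by parts on `ℝ^d` for the Gibbs weight `e^{-cV}`. -/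
theorem integral_euclidean_divergence (hV : V.HasTemperateGrowth)
    (hint : ∀ p : ℕ, Integrable fun x : E d => ‖x‖ ^ p * Real.exp (-c * V x))
    {Y : Fin d → E d → ℝ} (hY : ∀ k, (Y k).HasTemperateGrowth) :
    ∫ x, Real.exp (-c * V x) *
      (∑ k, partialD k (Y k) x + c * ∑ k, Y k x * (-gradient V x) k) = 0 := by
  have hVd : Differentiable ℝ V := hV.1.differentiable (by simp)
  have hw : ContDiff ℝ ∞ fun x => Real.exp (-c * V x) := (contDiff_const.mul hV.1).exp
  have hint' {h : E d → ℝ} (hh : h.HasTemperateGrowth) :=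
    integrable_exp_mul_temperate hV.1.continuous hint hh
  have hdw (k : Fin d) (x : E d) : partialD k (fun x => Real.exp (-c * V x)) x =
      -(c * Real.exp (-c * V x) * partialD k V x) := by
    refine (partialD_comp_deriv (F := fun t => Real.exp (-c * t))
      (((hasDerivAt_id (V x)).const_mul (-c)).exp) (hVd x) k).trans ?_
    simp only [id]
    ring
  have hk (k : Fin d) : ∫ x, Real.exp (-c * V x) * (partialD k (Y k) x
      + c * (Y k x * (-gradient V x) k)) = 0 := by
    have hi2 : Integrable fun x => Real.exp (-c * V x) * (c * (Y k x * partialD k V x)) :=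
      hint' (.mul (.const c) ((hY k).mul (temperate_partialD hV k)))
    have hi1 := hint' (temperate_partialD (hY k) k)
    have h1 := integral_mul_partialD (u := fun x => Real.exp (-c * V x)) (v := Y k) k
      (by
        refine hi2.neg.congr (Filter.Eventually.of_forall fun x => ?_)
        simp only [hdw, Pi.neg_apply]
        ring)
      hi1 (hint' (hY k)) (hw.differentiable (by simp)) ((hY k).1.differentiable (by simp))
    have h2 (x : E d) : Real.exp (-c * V x) * (partialD k (Y k) x
        + c * (Y k x * (-gradient V x) k)) = Real.exp (-c * V x) * partialD k (Y k) x
        - Real.exp (-c * V x) * (c * (Y k x * partialD k V x)) := by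
      rw [PiLp.neg_apply, gradient_apply x k (hVd x)]
      ring
    simp only [h2]
    rw [integral_sub hi1 hi2, h1, ← integral_neg, ← integral_sub (hi2.congr ?_) hi2]
    · convert integral_zero (E d) ℝ with x
      rw [hdw]
      ring
    · exact Filter.Eventually.of_forall fun x => by simp only [hdw]; ring
  have hsum (x : E d) : Real.exp (-c * V x) *
      (∑ k, partialD k (Y k) x + c * ∑ k, Y k x * (-gradient V x) k) =
      ∑ k, Real.exp (-c * V x) * (partialD k (Y k) x + c * (Y k x * (-gradient V x) k)) := by
    rw [Finset.mul_sum, ← Finset.sum_add_distrib, Finset.mul_sum]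
  simp only [hsum]
  rw [integral_finsetSum, Finset.sum_eq_zero fun k _ => hk k]
  intro k _
  exact hint' ((temperate_partialD (hY k) k).add
    (.mul (.const c) ((hY k).mul (temperate_drift hV k))))

end EuclideanGibbs

section EuclideanRules

variable {d : ℕ} {σ : ℝ} (hσ : 0 < σ) {f g : E d → E d} (hf : ContDiff ℝ ∞ f) (hg : ContDiff ℝ ∞ g)
  {φ : E d → ℝ} (hφ : ContDiff ℝ ∞ φ) (x : E d)

theorem F_cls_of_Ng_eq_zero {γ : Forest} (h : γ.Ng = 0) :
    F σ f g φ (cls γ) x = σ ^ Graph.weight γ * γ.val f g φ 0 x := by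
  rw [F_cls, Graph.prefactor_eq_of_Ng_eq_zero γ h]

include hσ hf hg hφ

/-- The difference of the two sides of the Euclidean edge rule is, pointwise, the integrand of the
integration by parts formula for the vector field `F(γ) F(τ)`. -/
theorem F_euclideanEdge_sub {γ : Forest} {τ : VField} (hγ : γ.Ng = 0) (hτ : τ.Ng = 0) :
    F σ f g φ (euclideanEdgeLHS γ τ) x - F σ f g φ (euclideanEdgeRHS γ τ) x =
      σ ^ (Graph.weight γ + τ.weight) *
      (∑ k, partialD k (fun y => γ.val f g φ 0 y * τ.val f g 0 k y) x
        + 2 / σ ^ 2 * ∑ k, γ.val f g φ 0 x * τ.val f g 0 k x * f x k) := by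
  have haD : DifferentiableAt ℝ (γ.val f g φ 0) x :=
    (γ.contDiff_val hf hg hφ 0).differentiable (by simp) x
  have hTD (k) : DifferentiableAt ℝ (τ.val f g 0 k) x :=
    (τ.contDiff_val hf hg 0 k).differentiable (by simp) x
  have hfT : ∑ k, γ.val f g φ 0 x * τ.val f g 0 k x * f x k =
      γ.val f g φ 0 x * ∑ k, τ.val f g 0 k x * f x k := by
    rw [Finset.mul_sum]
    exact Finset.sum_congr rfl fun k _ => by ring
  have hdiv : ∑ k, partialD k (fun y => γ.val f g φ 0 y * τ.val f g 0 k y) x =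
      ∑ k, partialD k (γ.val f g φ 0) x * τ.val f g 0 k x
        + γ.val f g φ 0 x * ∑ k, partialD k (τ.val f g 0 k) x := by
    rw [Finset.mul_sum, ← Finset.sum_add_distrib]
    exact Finset.sum_congr rfl fun k _ => partialD_mul haD (hTD k) k
  have h1 (w : γ.Node) : F σ f g φ (cls (γ.graft τ w)) x =
      σ ^ (Graph.weight γ + τ.weight) * Forest.val f g φ (γ.graft τ w) 0 x := by
    rw [F_cls_of_Ng_eq_zero x (by rw [Graph.Ng_graft, hγ, hτ]), Graph.weight_graft]
  have h2 (w : τ.graph.Node) : F σ f g φ (cls (τ.loop w ⊙ γ)) x =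
      σ ^ (Graph.weight γ + τ.weight) * ((τ.loop w).val f g x * γ.val f g φ 0 x) := by
    rw [F_cls_of_Ng_eq_zero x (by rw [Aroma.Ng_mul, VField.Ng_loop, hγ, hτ]), Aroma.weight_mul,
      VField.weight_loop, Forest.val_mul, add_comm]
  have h3 : F σ f g φ (cls (τ.scal Colour.black ⊙ γ)) x = σ ^ (Graph.weight γ + τ.weight) / σ ^ 2
      * ((∑ k, τ.val f g 0 k x * f x k) * γ.val f g φ 0 x) := by
    rw [F_cls_of_Ng_eq_zero x (by
        rw [Aroma.Ng_mul, VField.Ng_scal, hγ, hτ, Colour.whiteness_black]), Aroma.weight_mul,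
      VField.weight_scal, Colour.whiteness_black, Forest.val_mul, VField.val_scal_black,
      ← Real.rpow_two, ← Real.rpow_sub hσ]
    congr 2
    push_cast
    ring
  rw [hfT, hdiv]
  unfold euclideanEdgeLHS euclideanEdgeRHS
  simp only [F_sub, F_neg, F_smul, F_sum, h1, h2, h3, ← Finset.mul_sum, ← Finset.sum_mul,
    γ.sum_val_graft hf hg hφ τ, τ.sum_val_loop hf hg]
  ring

/-- The difference of the two sides of the Euclidean liana rule is, pointwise, the integrand of the
integration by parts formula for the vector field obtained by differentiating `γ` once more at `v`.
-/
theorem F_euclideanLiana_sub {γ : Forest} (v : γ.Node) (hγ : γ.Ng = 0) :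
    F σ f g φ (euclideanLianaLHS γ v) x - F σ f g φ (euclideanLianaRHS γ v) x =
      σ ^ (Graph.weight γ + 2) * (∑ k, partialD k (γ.val f g φ (mark v k)) x
        + 2 / σ ^ 2 * ∑ k, γ.val f g φ (mark v k) x * f x k) := by
  have h1 (w : γ.Node) : F σ f g φ (cls (γ.addLiana v w)) x =
      σ ^ (Graph.weight γ + 2) * Forest.val f g φ (γ.addLiana v w) 0 x := by
    rw [F_cls_of_Ng_eq_zero x (by rw [Graph.Ng_addLiana, hγ]), Graph.weight_addLiana]
  have h2 : F σ f g φ (cls (γ.graft black v)) x = σ ^ (Graph.weight γ + 2) / σ ^ 2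
      * ∑ k, γ.val f g φ (mark v k) x * f x k := by
    rw [F_cls_of_Ng_eq_zero x (by
        rw [Graph.Ng_graft, hγ, dot_Ng, Colour.whiteness_black]), Graph.weight_graft, dot_weight,
      Colour.whiteness_black, Forest.val_graft_zero, ← Real.rpow_two, ← Real.rpow_sub hσ]
    simp only [dot_val, fieldOf]
    congr 2
    push_cast
    ring
  unfold euclideanLianaLHS euclideanLianaRHS
  simp only [F_neg, F_smul, F_sum, h1, h2, ← Finset.mul_sum, γ.sum_val_addLiana hf hg hφ v]
  ring

end EuclideanRules

section EuclideanMain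

variable {d : ℕ} {σ : ℝ} {V φ : E d → ℝ} (hV : V.HasTemperateGrowth) (hφ : φ.HasTemperateGrowth)
  (hint : ∀ p : ℕ, Integrable fun x : E d => ‖x‖ ^ p * Real.exp (-(2 / σ ^ 2) * V x))

include hV hφ hint

theorem sameIntegral_euclidean (u v : Span) (C : ℝ) {Y : Fin d → E d → ℝ}
    (hY : ∀ k, (Y k).HasTemperateGrowth)
    (h : ∀ x, F σ (fun x => -gradient V x) 0 φ u x - F σ (fun x => -gradient V x) 0 φ v x =
      C * (∑ k, partialD k (Y k) x + 2 / σ ^ 2 * ∑ k, Y k x * (-gradient V x) k)) :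
    SameIntegral (gibbs volume σ V) (F σ (fun x => -gradient V x) 0 φ u)
      (F σ (fun x => -gradient V x) 0 φ v) := by
  have hF (u : Span) : Integrable fun x => Real.exp (-(2 / σ ^ 2) * V x) *
      F σ (fun x => -gradient V x) 0 φ u x :=
    integrable_exp_mul_temperate hV.1.continuous hint (temperate_F (temperate_drift hV) σ hφ u)
  refine sameIntegral_gibbs (by simpa using hint 0) (hF u) (hF v) ?_
  have key := integral_euclidean_divergence hV hint hY
  simp only [h]
  refine Eq.trans ?_ ((integral_const_mul C _).trans (by rw [key, mul_zero]))
  exact integral_congr_ae (Filter.Eventually.of_forall fun x => by ring)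

theorem edge_rule_euclidean (hσ : 0 < σ) {γ : Forest} {τ : VField} (hγ : γ.Ng = 0) (hτ : τ.Ng = 0) :
    SameIntegral (gibbs volume σ V)
      (F σ (fun x => -gradient V x) 0 φ (euclideanEdgeLHS γ τ))
      (F σ (fun x => -gradient V x) 0 φ (euclideanEdgeRHS γ τ)) :=
  sameIntegral_euclidean hV hφ hint _ _ _
    (fun k => (γ.temperate_val (temperate_drift hV) (fun _ => .const 0) hφ 0).mul
      (τ.temperate_val (temperate_drift hV) (fun _ => .const 0) 0 k))
    fun x => F_euclideanEdge_sub hσ (contDiff_gradient hV.1).neg contDiff_const hφ.1 x hγ hτ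

theorem liana_rule_euclidean (hσ : 0 < σ) {γ : Forest} (v : γ.Node) (hγ : γ.Ng = 0) :
    SameIntegral (gibbs volume σ V)
      (F σ (fun x => -gradient V x) 0 φ (euclideanLianaLHS γ v))
      (F σ (fun x => -gradient V x) 0 φ (euclideanLianaRHS γ v)) :=
  sameIntegral_euclidean hV hφ hint _ _ _
    (fun k => γ.temperate_val (temperate_drift hV) (fun _ => .const 0) hφ (mark v k))
    fun x => F_euclideanLiana_sub hσ (contDiff_gradient hV.1).neg contDiff_const hφ.1 x v hγ

end EuclideanMain

end ExoticAromatic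

end

theorem mainTheorem7 (d : ℕ) (σ : ℝ) (hσ : 0 < σ) (V : E d → ℝ) (hV : ContDiff ℝ ∞ V) :
    -- the two rules on the compact hypersurface `{ζ = 0}`, with `f = -∇V` and `g = ∇ζ`
    (∀ (ζ φ : E d → ℝ), ContDiff ℝ ∞ ζ → ContDiff ℝ ∞ φ → IsCompact {x | ζ x = 0} →
      (∀ x, ζ x = 0 → gradient ζ x ≠ 0) →
      (∀ (γ : Forest) (τ : VField),
        SameIntegral (gibbs (surfaceMeasure {x | ζ x = 0}) σ V)
          (F σ (fun x => -gradient V x) (gradient ζ) φ (edgeLHS γ τ))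
          (F σ (fun x => -gradient V x) (gradient ζ) φ (edgeRHS γ τ))) ∧
      (∀ (γ : Forest) (v : γ.Node),
        SameIntegral (gibbs (surfaceMeasure {x | ζ x = 0}) σ V)
          (F σ (fun x => -gradient V x) (gradient ζ) φ (lianaLHS γ v))
          (F σ (fun x => -gradient V x) (gradient ζ) φ (lianaRHS γ v)))) ∧
    -- without white nodes, the rules reduce to the Euclidean ones
    (∀ (γ : Forest) (τ : VField), γ.Ng = 0 → τ.Ng = 0 →
      dropWhite (edgeLHS γ τ) = euclideanEdgeLHS γ τ ∧
      dropWhite (edgeRHS γ τ) = euclideanEdgeRHS γ τ) ∧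
    (∀ (γ : Forest) (v : γ.Node), γ.Ng = 0 →
      dropWhite (lianaLHS γ v) = euclideanLianaLHS γ v ∧
      dropWhite (lianaRHS γ v) = euclideanLianaRHS γ v) ∧
    -- which hold on `ℝ^d` for the Gibbs measure, with `g = 0`
    (∀ φ : E d → ℝ, V.HasTemperateGrowth → φ.HasTemperateGrowth →
      (∀ p : ℕ, Integrable fun x : E d => ‖x‖ ^ p * Real.exp (-(2 / σ ^ 2) * V x)) →
      (∀ (γ : Forest) (τ : VField), γ.Ng = 0 → τ.Ng = 0 →
        SameIntegral (gibbs MeasureTheory.volume σ V)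
          (F σ (fun x => -gradient V x) 0 φ (euclideanEdgeLHS γ τ))
          (F σ (fun x => -gradient V x) 0 φ (euclideanEdgeRHS γ τ))) ∧
      (∀ (γ : Forest) (v : γ.Node), γ.Ng = 0 →
        SameIntegral (gibbs MeasureTheory.volume σ V)
          (F σ (fun x => -gradient V x) 0 φ (euclideanLianaLHS γ v))
          (F σ (fun x => -gradient V x) 0 φ (euclideanLianaRHS γ v)))) := by
  refine ⟨fun ζ φ hζ hφ hM hreg => ⟨fun γ τ => ?_, fun γ v => ?_⟩,
    fun γ τ hγ hτ => ⟨dropWhite_edgeLHS hγ hτ, dropWhite_edgeRHS hγ hτ⟩,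
    fun γ v hγ => ⟨dropWhite_lianaLHS v hγ, dropWhite_lianaRHS v hγ⟩,
    fun φ hV' hφ hint => ⟨fun γ τ hγ hτ => ?_, fun γ v hγ => ?_⟩⟩
  · exact edge_rule_surface hσ hV hζ hφ hM hreg γ τ
  · exact liana_rule_surface hσ hV hζ hφ hM hreg γ v
  · exact edge_rule_euclidean hV' hφ hint hσ hγ hτ
  · exact liana_rule_euclidean hV' hφ hint hσ v hγ
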